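/- Let $d\ge 1$ be an integer, let $\delta>0$ and $\gamma>0$ be real numbers with $$(1+\gamma)\bigl(1+\tfrac{\gamma}{2}\bigr)<\frac d\delta<\gamma+2,$$ and put $V(x)=\|x\|^\delta$ for $x\in\mathbb R^d$ (Euclidean norm) and $\theta_j=j^\gamma$ for $j\ge1$. A spatial partition of $n\in\mathbb N_0$ is a family $\boldsymbol\lambda=(\lambda_x)_{x\in\mathbb Z^d}$ of integer partitions $\lambda_x$ of integers $\eta_x\ge 0$ with $\sum_x\eta_x=n$; let $r_{xj}(\boldsymbol\lambda)$ be the number of parts of $\lambda_x$ equal to $j$, and let $H_0(\boldsymbol\lambda)=\eta_0$. For $L>0$ let $\mathbb P_{L,n}$ be the measure on spatial partitions of $n$ given by $$\mathbb P_{L,n}(\boldsymbol\lambda)=\frac1{Z_{L,n}}\prod_{x\in\mathbb Z^d}\prod_{j\ge1}\frac1{r_{xj}(\boldsymbol\lambda)!}\Bigl(\frac{\theta_j}{j}e^{-jV(x/L)}\Bigr)^{r_{xj}(\boldsymbol\lambda)},$$ where $Z_{L,n}$ is the sum over all $\boldsymbol\lambda$ of the products on the right. Let $\rho(z)=\sum_{j\ge1}\theta_jz^j\int_{\mathbb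 R^d}e^{-jV(x)}\,dx$, let $z_{\rm c}$ be the radius of convergence of this power series, and let $\rho_{\rm c}=\rho(z_{\rm c})$. Let $\mathbb P_L^{z}$ be the law of independent variables $R_{xj}\sim\mathrm{Poisson}\bigl(\frac{\theta_j}{j}z^je^{-jV(x/L)}\bigr)$, $x\in\mathbb Z^d$, $j\ge1$, put $M=\sum_{x\neq0}\sum_{j\ge1}jR_{xj}$, and let $\rho_{\rm c}^L=L^{-d}\,\mathbb E_L^{z_{\rm c}}(M)$. Let $\rho>\rho_{\rm c}$. Then $\mathbb E_L^{z_{\rm c}}(M)<\infty$ for every $L>0$, $\mathbb P_{L,n}$ is a probability measure for every $n\ge1$ and $L=(n/\rho)^{1/d}$, the sum $\sum_{x\in\mathbb Z^d\setminus\{0\}}\|x\|^{-\delta(\gamma+2)}$ is finite, and as $n\to\infty$ with $L=(n/\rho)^{1/d}$, under $\mathbb P_{L,n}$, $$\frac{H_0-(\rho-\rho_{\rm c}^L)L^d}{L^{\delta(1+\gamma/2)}}\ \longrightarrow\ \Bigl(\Gamma(\gamma+2)\sum_{x\in\mathbb Z^d\setminus\{0\}}\frac1{\|x\|^{\delta(\gamma+2)}}\Bigr)^{1/2}\mathcal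 N(0,1)\quad\text{in distribution.}$$ -/

import Mathlib

open MeasureTheory ProbabilityTheory Filter
open scoped ENNReal NNReal

noncomputable section

namespace SpatialPartitions

/-- Sites of the lattice `ℤ^d`. -/
abbrev Site (d : ℕ) : Type := Fin d → ℤ

/-- A lattice site regarded as a point of `ℝ^d` (with its Euclidean norm). -/
def Site.toSpace {d : ℕ} (x : Site d) : EuclideanSpace ℝ (Fin d) :=
  WithLp.toLp 2 (fun i => (x i : ℝ))

/-- A spatial partition of the integer `n`: an integer partition `λ_x` at every site `x ∈ ℤ^d`,
such that the partitioned integers `η_x` add up to `n`. Since the sum of all `η_x` is finite, only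
finitely many of them are nonzero, so that `η` is a finitely supported function. -/
@[ext]
structure SpatialPartition (d n : ℕ) where
  /-- the site occupation numbers `η_x` -/
  occ : Site d →₀ ℕ
  /-- the partition `λ_x` of `η_x` at the site `x` -/
  part : (x : Site d) → Nat.Partition (occ x)
  /-- the total mass is `n` -/
  total : (occ.sum fun _ k => k) = n

instance (d n : ℕ) : MeasurableSpace (SpatialPartition d n) := ⊤

/-- `r_{xj}`: the number of times that the integer `j` occurs in the partition at the site `x`. -/
def SpatialPartition.mult {d n : ℕ} (lam : SpatialPartition d n) (x : Site d) (j : ℕ) : ℕ :=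
  (lam.part x).parts.count j

variable {d : ℕ}

/-- The unnormalized weight
`∏_{x ∈ ℤ^d} ∏_{j ≥ 1} (1 / r_{xj}!) * ((θ_j / j) * exp (-j V(x/L))) ^ r_{xj}`
of a spatial partition. All factors with `η_x = 0` or `j > n` have `r_{xj} = 0` and equal `1`,
so the products are taken over the remaining, finitely many, indices. -/
def weight (V : EuclideanSpace ℝ (Fin d) → ℝ) (θ : ℕ → ℝ) (L : ℝ) {n : ℕ}
    (lam : SpatialPartition d n) : ℝ :=
  ∏ x ∈ lam.occ.support, ∏ j ∈ Finset.Icc 1 n,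
    1 / ((lam.mult x j).factorial : ℝ) *
      (θ j / j * Real.exp (-(j : ℝ) * V (L⁻¹ • x.toSpace))) ^ lam.mult x j

/-- The partition function `Z_{L,n}`. -/
def partitionFunction (V : EuclideanSpace ℝ (Fin d) → ℝ) (θ : ℕ → ℝ) (L : ℝ) (n : ℕ) : ℝ≥0∞ :=
  ∑' lam : SpatialPartition d n, ENNReal.ofReal (weight V θ L lam)

/-- The canonical measure `ℙ_{L,n}` on spatial partitions of `n`: each spatial partition has mass
`weight / Z_{L,n}`. -/
def canonicalMeasure (V : EuclideanSpace ℝ (Fin d) → ℝ) (θ : ℕ → ℝ) (L : ℝ) (n : ℕ) :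
    Measure (SpatialPartition d n) :=
  (partitionFunction V θ L n)⁻¹ •
    Measure.sum fun lam : SpatialPartition d n =>
      ENNReal.ofReal (weight V θ L lam) • Measure.dirac lam

/-- The density `ρ(z) = ∑_{j ≥ 1} θ_j z^j ∫_{ℝ^d} exp (-j V(x)) dx`, with values in `[0,∞]`
(the weights `θ_j` are nonnegative). -/
def density (V : EuclideanSpace ℝ (Fin d) → ℝ) (θ : ℕ → ℝ) (z : ℝ≥0∞) : ℝ≥0∞ :=
  ∑' j : ℕ+, ENNReal.ofReal (θ j) * z ^ (j : ℕ) *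
    ∫⁻ x : EuclideanSpace ℝ (Fin d), ENNReal.ofReal (Real.exp (-((j : ℕ) : ℝ) * V x))

/-- The radius of convergence `z_c` of the power series `ρ(z)`, whose coefficients are
nonnegative. -/
def criticalFugacity (V : EuclideanSpace ℝ (Fin d) → ℝ) (θ : ℕ → ℝ) : ℝ≥0∞ :=
  sSup {z : ℝ≥0∞ | density V θ z < ∞}

/-- The critical (transition) density `ρ_c = ρ(z_c)`. -/
def criticalDensity (V : EuclideanSpace ℝ (Fin d) → ℝ) (θ : ℕ → ℝ) : ℝ≥0∞ :=
  density V θ (criticalFugacity V θ)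

/-- The grand-canonical measure `ℙ_L^z`: the joint law of independent variables
`R_{xj} ∼ Poisson ((θ_j / j) z^j exp (-j V(x/L)))`, `x ∈ ℤ^d`, `j ≥ 1`. -/
def grandCanonicalMeasure (V : EuclideanSpace ℝ (Fin d) → ℝ) (θ : ℕ → ℝ) (L : ℝ) (z : ℝ≥0) :
    Measure (Site d × ℕ+ → ℕ) :=
  Measure.infinitePi fun p : Site d × ℕ+ =>
    poissonMeasure (Real.toNNReal
      (θ p.2 / ((p.2 : ℕ) : ℝ) * (z : ℝ) ^ (p.2 : ℕ) *
        Real.exp (-((p.2 : ℕ) : ℝ) * V (L⁻¹ • p.1.toSpace))))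

/-- The number `M = ∑_{x ≠ 0} ∑_{j ≥ 1} j R_{xj}` of particles that are not at the origin. -/
def particlesOffOrigin (R : Site d × ℕ+ → ℕ) : ℝ≥0∞ :=
  ∑' x : {x : Site d // x ≠ 0}, ∑' j : ℕ+, ((j : ℕ) : ℝ≥0∞) * (R (x.1, j) : ℝ≥0∞)

/-- The expectation of `M` under the grand-canonical measure at the critical fugacity `z_c`. -/
def criticalMeanOffOrigin (V : EuclideanSpace ℝ (Fin d) → ℝ) (θ : ℕ → ℝ) (L : ℝ) : ℝ≥0∞ :=
  ∫⁻ R, particlesOffOrigin R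
    ∂(grandCanonicalMeasure V θ L (criticalFugacity V θ).toNNReal)

/-- The finite-volume critical density `ρ_c^L`: the critical mean of `M`, divided by `L^d`. -/
def finiteCriticalDensity (V : EuclideanSpace ℝ (Fin d) → ℝ) (θ : ℕ → ℝ) (L : ℝ) : ℝ :=
  (criticalMeanOffOrigin V θ L).toReal / L ^ d

/-- The length `L` with `n = ρ L^d`. -/
def boxLength (d : ℕ) (ρ : ℝ) (n : ℕ) : ℝ := ((n : ℝ) / ρ) ^ ((1 : ℝ) / d)

/-- The occupation number `H_0` of the origin. -/
def originOccupation {n : ℕ} (lam : SpatialPartition d n) : ℝ := (lam.occ 0 : ℝ)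

/-- The trap potential `V(x) = ‖x‖^δ`. -/
def powerTrap (d : ℕ) (δ : ℝ) : EuclideanSpace ℝ (Fin d) → ℝ := fun x => ‖x‖ ^ δ

/-- The weights `θ_j = j^γ`. -/
def powerWeights (γ : ℝ) : ℕ → ℝ := fun j => (j : ℝ) ^ γ

end SpatialPartitions

end

/-! ### Renewal sequences and compound Poisson laws. -/

namespace SpatialPartitions
open Finset

/-! Separate the parts at the origin, of total size `k`, from those elsewhere, of total size `m = n
- k`. The Mecke equation gives the total weight of each pair `(m, k)` a renewal recursion in either
variable, so it factorizes (`jointWeight_eq_mul`, `jointWeight_power`). The potential vanishes at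
the origin, so the factor there is `w = stretched γ`, whatever `L` is. Hence under the canonical
measure `M = n - H_0` has law proportional to `p(m) w(n - m)`, where `p = offLaw` is the critical
(`z_c = 1`) law of `M`, a compound Poisson law with rates `a = offRate`. Write `A = ∑ a_j` for its
mean, `B = ∑ j a_j` for its variance, `D = ∑ j² a_j`, and `v = L ^ (-δ)`.

Without the factor `w`, a central limit theorem holds: the characteristic function of `M - A`
differs from the Gaussian one by at most `2 |t|³ D` (`norm_charFun_sub_le`). Summing first over part
sizes and then over sites gives `B ∼ v ^ (-(γ + 2)) Γ(γ + 2) ∑ ‖x‖ ^ (-δ (γ + 2))` and `D` of order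
`v ^ (-(γ + 3))` (`tendsto_mul_tsum_polyExpSum`). The bound `d / δ < γ + 2` makes the lattice sum
converge. At the scale `v ^ (1 + γ / 2)` the error is of order `v ^ (γ / 2)`.

The factor `w` is asymptotically invisible. Its logarithmic increments near `l` are `O(l ^ (-1 / (1
+ γ)))` (`stretched_sub_le`). For `ρ > ρ_c` the origin holds a positive fraction of the `n`
particles on average, so `l = ⌊n - A⌋` has order `n`, and `w(n - m) / w(l)` is close to `1` as long
as `|m - A|` is small against `n ^ (1 / (1 + γ))`. The standard deviation of `M` has order `n ^ (δ
(1 + γ / 2) / d)`, which is smaller exactly when `(1 + γ)(1 + γ / 2) < d / δ`. For small `m` the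
ratio may grow exponentially; a Gaussian bound on the lower exponential moments of `M` controls this
(`tsum_exp_neg_le`). So the tilted and untilted laws merge in `L¹` (`tsum_abs_tilt_sub_one_le`), and
`H_0 - (n - A) = -(M - A)` inherits the normal limit. -/

/-- The coefficients of `exp (∑ a_j z^j / j)`, defined by the recursion
`m r_m = ∑_{j = 1}^m a_j r_{m - j}`. -/
noncomputable def renewal (a : ℕ → ℝ) : ℕ → ℝ
  | 0 => 1
  | m + 1 => (∑ j : Fin (m + 1), a (j + 1) * renewal a (m - j)) / (m + 1)

lemma renewal_zero (a : ℕ → ℝ) : renewal a 0 = 1 := by rw [renewal]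

lemma renewal_rec {a : ℕ → ℝ} (ha : a 0 = 0) (m : ℕ) :
    (m : ℝ) * renewal a m = ∑ p ∈ antidiagonal m, a p.1 * renewal a p.2 := by
  cases m with
  | zero => simp [ha]
  | succ m =>
    rw [renewal, Nat.antidiagonal_succ, sum_cons, ha, zero_mul, zero_add, sum_map,
      Nat.sum_antidiagonal_eq_sum_range_succ_mk, Finset.sum_range]
    push_cast
    rw [mul_div_cancel₀ _ (by positivity)]
    simp

lemma renewal_nonneg {a : ℕ → ℝ} (ha : ∀ j, 0 ≤ a j) (m : ℕ) : 0 ≤ renewal a m := by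
  induction m using Nat.strong_induction_on with
  | _ m ih =>
    cases m with
    | zero => simp [renewal_zero]
    | succ m =>
      rw [renewal]
      exact div_nonneg (sum_nonneg fun j _ => mul_nonneg (ha _) (ih _ (by omega))) (by positivity)

/-- A sequence satisfying the renewal recursion is a multiple of `renewal a`. -/
lemma eq_mul_renewal {a : ℕ → ℝ} (ha : ∀ j, 0 ≤ a j) (ha0 : a 0 = 0) {c : ℕ → ℝ≥0∞}
    (hc : ∀ m : ℕ, (m : ℝ≥0∞) * c m = ∑ p ∈ antidiagonal m, ENNReal.ofReal (a p.1) * c p.2)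
    (m : ℕ) : c m = c 0 * ENNReal.ofReal (renewal a m) := by
  induction m using Nat.strong_induction_on with
  | _ m ih =>
    rcases Nat.eq_zero_or_pos m with rfl | hm
    · simp [renewal_zero]
    · have h1 : (m : ℝ≥0∞) * c m = m * (c 0 * ENNReal.ofReal (renewal a m)) := by
        rw [hc, mul_left_comm, ← ENNReal.ofReal_natCast, ← ENNReal.ofReal_mul (by positivity),
          renewal_rec ha0, ENNReal.ofReal_sum_of_nonneg
          (fun p _ => mul_nonneg (ha _) (renewal_nonneg ha _)), mul_sum]
        refine sum_congr rfl fun p hp => ?_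
        rw [ENNReal.ofReal_mul (ha _)]
        by_cases hp0 : p.1 = 0
        · simp [hp0, ha0]
        · rw [ih p.2 (by have := mem_antidiagonal.1 hp; omega)]
          ring
      exact (ENNReal.mul_right_inj (by positivity) (by simp)).1 h1

/-- Summing the recursion over `m < N` gives `∑ m r_m ≤ A ∑ r_m`. Indices beyond `2 A` therefore
carry at most half of the partial sum, which is bounded by twice its initial segment. -/
lemma summable_renewal {a : ℕ → ℝ} (ha : ∀ j, 0 ≤ a j) (ha0 : a 0 = 0) (hs : Summable a) : Summable (renewal a) := by
  set A := ∑' j, a j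
  have hA : 0 ≤ A := tsum_nonneg ha
  have hr := renewal_nonneg ha
  have key : ∀ N, ∑ m ∈ range N, (m : ℝ) * renewal a m ≤ A * ∑ m ∈ range N, renewal a m := by
    intro N
    calc ∑ m ∈ range N, (m : ℝ) * renewal a m
        = ∑ m ∈ range N, ∑ p ∈ antidiagonal m, a p.1 * renewal a p.2 :=
          sum_congr rfl fun m _ => renewal_rec ha0 m
      _ ≤ ∑ p ∈ range N ×ˢ range N, a p.1 * renewal a p.2 := by
          rw [← Finset.sum_biUnion]
          · refine sum_le_sum_of_subset_of_nonneg ?_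
              fun p _ _ => mul_nonneg (ha _) (hr _)
            intro p hp
            simp only [mem_biUnion, mem_range, HasAntidiagonal.mem_antidiagonal,
              mem_product] at hp ⊢
            obtain ⟨m, hm, hp⟩ := hp
            omega
          · intro i _ j _ hij
            rw [Function.onFun, Finset.disjoint_left]
            intro p hp hq
            rw [HasAntidiagonal.mem_antidiagonal] at hp hq
            omega
      _ = (∑ j ∈ range N, a j) * ∑ m ∈ range N, renewal a m := by
          rw [sum_product, sum_mul_sum]
      _ ≤ _ := by
          refine mul_le_mul_of_nonneg_right (hs.sum_le_tsum _ fun _ _ => ha _)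
            (sum_nonneg fun _ _ => hr _)
  -- With `K > 2 A`, the inequality `K S ≤ A S + K S_K` for the partial sums yields `S ≤ 2 S_K`.
  obtain ⟨K, hK⟩ := exists_nat_gt (2 * A)
  refine summable_of_sum_range_le (c := 2 * ∑ m ∈ range K, renewal a m) hr fun N => ?_
  have h2 : ∀ m : ℕ, (K : ℝ) * renewal a m ≤
      m * renewal a m + K * (if m < K then renewal a m else 0) := by
    intro m
    have := hr m
    split_ifs with h
    · nlinarith [(Nat.cast_nonneg m : (0:ℝ) ≤ m)]
    · have : (K : ℝ) ≤ m := by exact_mod_cast not_lt.1 h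
      nlinarith
  have h3 := Finset.sum_le_sum fun m (_ : m ∈ range N) => h2 m
  rw [sum_add_distrib, ← mul_sum, ← mul_sum, ← sum_filter] at h3
  have h4 : ∑ m ∈ (range N).filter (· < K), renewal a m ≤ ∑ m ∈ range K, renewal a m :=
    sum_le_sum_of_subset_of_nonneg (by intro m; simp) fun _ _ _ => hr _
  have h5 := key N
  have h6 : 0 ≤ ∑ m ∈ range N, renewal a m := sum_nonneg fun _ _ => hr _
  have hK0 : (0 : ℝ) < K := by linarith
  have : (K : ℝ) * ∑ m ∈ range N, renewal a m ≤ K * (2 * ∑ m ∈ range K, renewal a m) := by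
    nlinarith
  exact le_of_mul_le_mul_left this hK0

/-- Twisting a renewal recursion by a multiplicative function. -/
lemma hasSum_renewal_twist {𝕜 : Type*} [NormedField 𝕜] [CompleteSpace 𝕜] {α r f g : ℕ → 𝕜}
    (hr : ∀ m : ℕ, (m : 𝕜) * r m = ∑ p ∈ antidiagonal m, α p.1 * r p.2)
    (hf : Summable fun j => ‖α j * f j‖) (hg : Summable fun j => ‖r j * g j‖)
    (hmul : ∀ i j, f i * g j = g (i + j)) :
    HasSum (fun m : ℕ => (m : 𝕜) * r m * g m) ((∑' j, α j * f j) * ∑' m, r m * g m) := by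
  rw [tsum_mul_tsum_eq_tsum_sum_antidiagonal_of_summable_norm hf hg]
  have h := (summable_norm_sum_mul_antidiagonal_of_summable_norm hf hg).of_norm
  refine (congrArg (fun f => HasSum f _) (funext fun m => ?_)).mpr h.hasSum
  rw [hr, sum_mul]
  refine sum_congr rfl fun p hp => ?_
  rw [← HasAntidiagonal.mem_antidiagonal.1 hp, ← hmul]
  ring

/-- `p` is the law of a compound Poisson variable `∑ j N_j`, where the independent variables
`N_j` are Poisson with parameter `a j / j`. -/
structure IsCompoundPoisson (a p : ℕ → ℝ) : Prop where
  rate_nonneg : ∀ j, 0 ≤ a j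
  nonneg : ∀ m, 0 ≤ p m
  mul_eq : ∀ m : ℕ, (m : ℝ) * p m = ∑ q ∈ antidiagonal m, a q.1 * p q.2
  hasSum : HasSum p 1

/-- The recursion is linear in the sequence, so it survives normalization; the term `renewal a 0 =
1` keeps the normalizing constant positive. -/
lemma isCompoundPoisson_renewal {a : ℕ → ℝ} (ha : ∀ j, 0 ≤ a j) (ha0 : a 0 = 0)
    (hs : Summable a) : IsCompoundPoisson a fun m => renewal a m / ∑' k, renewal a k := by
  have hr := summable_renewal ha ha0 hs
  have hpos : 0 < ∑' k, renewal a k :=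
    hr.tsum_pos (renewal_nonneg ha) 0 (by simp [renewal_zero])
  refine ⟨ha, fun m => div_nonneg (renewal_nonneg ha m) hpos.le, fun m => ?_, ?_⟩
  · rw [mul_div_assoc', renewal_rec ha0, sum_div]
    exact sum_congr rfl fun q _ => by ring
  · have := hr.hasSum.div_const (∑' k, renewal a k)
    rwa [div_self hpos.ne'] at this

/-! ### Moments, Laplace transforms and characteristic functions of compound Poisson laws. -/

namespace IsCompoundPoisson

variable {a p : ℕ → ℝ} 

lemma hasSum_mean (h : IsCompoundPoisson a p) (hs : Summable a) :
    HasSum (fun m : ℕ => (m : ℝ) * p m) (∑' j, a j) := by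
  have := hasSum_renewal_twist (f := fun _ => 1) (g := fun _ => 1) h.mul_eq
    (by simpa using hs.abs) (by simpa using h.hasSum.summable.abs) (by simp)
  simpa [h.hasSum.tsum_eq] using this

lemma summable_rate (hs : Summable fun j : ℕ => (j : ℝ) * a j) : Summable a := by
  rw [← summable_nat_add_iff 1] at hs ⊢
  refine Summable.of_norm_bounded hs.norm fun j => ?_
  rw [norm_mul]
  refine le_mul_of_one_le_left (norm_nonneg _) ?_
  simp only [RCLike.norm_natCast]
  push_cast
  linarith [(Nat.cast_nonneg j : (0:ℝ) ≤ j)]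

/-- Multiplying the recursion by `m = i + j` splits `m² p_m` into the convolutions of `i a_i` with
`p_j` and of `a_i` with `j p_j`, whose sums are `B · 1` and `A · A`. -/
lemma hasSum_sq (h : IsCompoundPoisson a p) (hs : Summable fun j : ℕ => (j : ℝ) * a j) :
    HasSum (fun m : ℕ => (m : ℝ) ^ 2 * p m) (∑' j : ℕ, (j : ℝ) * a j + (∑' j, a j) ^ 2) := by
  have hs1 := summable_rate hs
  have hm := h.hasSum_mean hs1
  have h1 := tsum_mul_tsum_eq_tsum_sum_antidiagonal_of_summable_norm hs.norm h.hasSum.summable.norm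
  have h2 := tsum_mul_tsum_eq_tsum_sum_antidiagonal_of_summable_norm hs1.norm hm.summable.norm
  have h3 := (summable_norm_sum_mul_antidiagonal_of_summable_norm hs.norm
    h.hasSum.summable.norm).of_norm.hasSum
  have h4 := (summable_norm_sum_mul_antidiagonal_of_summable_norm hs1.norm
    hm.summable.norm).of_norm.hasSum
  rw [← h1, h.hasSum.tsum_eq, mul_one] at h3
  rw [← h2, hm.tsum_eq, ← sq] at h4
  refine (congrArg (fun f => HasSum f _) (funext fun m => ?_)).mpr (h3.add h4)
  rw [sq, mul_assoc, h.mul_eq, mul_sum, ← sum_add_distrib]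
  refine sum_congr rfl fun q hq => ?_
  rw [← HasAntidiagonal.mem_antidiagonal.1 hq]
  push_cast
  ring

lemma hasSum_variance (h : IsCompoundPoisson a p) (hs : Summable fun j : ℕ => (j : ℝ) * a j) :
    HasSum (fun m : ℕ => p m * ((m : ℝ) - ∑' j, a j) ^ 2) (∑' j : ℕ, (j : ℝ) * a j) := by
  have h1 := (h.hasSum_sq hs).add (((h.hasSum_mean (summable_rate hs)).mul_left
    (-2 * ∑' j, a j)).add (h.hasSum.mul_left ((∑' j, a j) ^ 2)))
  convert h1 using 2
  · ring
  · ring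

lemma exp_neg_mul_natCast_le_one {t : ℝ} (ht : 0 ≤ t) (m : ℕ) : Real.exp (-t * m) ≤ 1 :=
  Real.exp_le_one_iff.2 (by nlinarith [(Nat.cast_nonneg m : (0:ℝ) ≤ m)])

lemma summable_norm_mul_exp_neg {b : ℕ → ℝ} (hb : Summable b) (hb0 : ∀ j, 0 ≤ b j) {t : ℝ}
    (ht : 0 ≤ t) : Summable fun j : ℕ => ‖b j * Real.exp (-t * j)‖ := by
  refine Summable.of_nonneg_of_le (fun _ => norm_nonneg _) (fun j => ?_) hb
  rw [norm_mul, Real.norm_of_nonneg (hb0 j), Real.norm_of_nonneg (Real.exp_nonneg _)]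
  exact mul_le_of_le_one_right (hb0 j) (exp_neg_mul_natCast_le_one ht j)

/-- Differentiation brings down `m p_m`, and the recursion twisted by `e ^ (-t m)` turns the result
into a product. This linear differential equation replaces the closed formula for the transform. -/
lemma hasDerivAt_laplace (h : IsCompoundPoisson a p) (hs1 : Summable a) {t : ℝ} (ht : 0 < t) :
    HasDerivAt (fun t : ℝ => ∑' m : ℕ, p m * Real.exp (-t * m))
      (-(∑' j : ℕ, a j * Real.exp (-t * j)) * ∑' m : ℕ, p m * Real.exp (-t * m)) t := by
  have hm := h.hasSum_mean hs1
  have h1 : HasDerivAt (fun t : ℝ => ∑' m : ℕ, p m * Real.exp (-t * m)) (∑' m : ℕ, p m * (Real.exp (-t * m) * (-1 * m))) t := by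
    refine hasDerivAt_tsum_of_isPreconnected (u := fun m : ℕ => (m : ℝ) * p m)
      (g := fun (m : ℕ) (t : ℝ) => p m * Real.exp (-t * m))
      (g' := fun (m : ℕ) (t : ℝ) => p m * (Real.exp (-t * m) * (-1 * m))) hm.summable
      isOpen_Ioi isPreconnected_Ioi (fun m t _ => ?_) (fun m t ht => ?_) ht
      (h.hasSum.summable.of_norm_bounded fun m => ?_) ht
    · have h0 : HasDerivAt (fun t : ℝ => -t * m) (-1 * m) t :=
        ((hasDerivAt_id' t).neg).mul_const (m : ℝ)
      exact h0.exp.const_mul (p m)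
    · rw [norm_mul, norm_mul, Real.norm_of_nonneg (h.nonneg m),
        Real.norm_of_nonneg (Real.exp_nonneg _)]
      simp only [neg_mul, one_mul, norm_neg, RCLike.norm_natCast]
      rw [mul_comm (m : ℝ)]
      refine mul_le_mul_of_nonneg_left ?_ (h.nonneg m)
      refine mul_le_of_le_one_left (by positivity) ?_
      simpa using exp_neg_mul_natCast_le_one (le_of_lt ht) m
    · rw [norm_mul, Real.norm_of_nonneg (h.nonneg m), Real.norm_of_nonneg (Real.exp_nonneg _)]
      exact mul_le_of_le_one_right (h.nonneg m) (exp_neg_mul_natCast_le_one (le_of_lt ht) m)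
  have h2 := hasSum_renewal_twist (f := fun j : ℕ => Real.exp (-t * j))
    (g := fun j : ℕ => Real.exp (-t * j)) h.mul_eq
    (summable_norm_mul_exp_neg hs1 h.rate_nonneg ht.le) (summable_norm_mul_exp_neg h.hasSum.summable h.nonneg ht.le)
    (fun i j => by rw [← Real.exp_add]; congr 1; push_cast; ring)
  convert h1 using 1
  rw [neg_mul, ← h2.tsum_eq, ← tsum_neg]
  exact tsum_congr fun m => by ring
/-- The exponential moments of a centred compound Poisson variable on the negative side are
bounded by those of a Gaussian variable of the same variance. -/
lemma tsum_exp_neg_le (h : IsCompoundPoisson a p) (hs : Summable fun j : ℕ => (j : ℝ) * a j)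
    {t : ℝ} (ht : 0 ≤ t) :
    ∑' m : ℕ, p m * Real.exp (-t * m) ≤
      Real.exp (-t * ∑' j, a j + t ^ 2 / 2 * ∑' j : ℕ, (j : ℝ) * a j) := by
  set A := ∑' j, a j with hA
  set B := ∑' j : ℕ, (j : ℝ) * a j with hB
  have hs1 := summable_rate hs
  have hm := h.hasSum_mean hs1
  set ψ : ℝ → ℝ := fun t => ∑' m : ℕ, p m * Real.exp (-t * m) with hψ
  have hψ0 : ψ 0 = 1 := by simp [hψ, h.hasSum.tsum_eq]
  have hψn : ∀ t, 0 ≤ ψ t := fun t => tsum_nonneg fun m => mul_nonneg (h.nonneg m)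
    (Real.exp_nonneg _)
  have hcont : ContinuousOn ψ (Set.Ici 0) := by
    refine continuousOn_tsum (u := p) (fun m => by fun_prop) h.hasSum.summable fun m t ht => ?_
    rw [norm_mul, Real.norm_of_nonneg (h.nonneg m), Real.norm_of_nonneg (Real.exp_nonneg _)]
    exact mul_le_of_le_one_right (h.nonneg m) (exp_neg_mul_natCast_le_one ht m)
  have hderiv : ∀ t ∈ Set.Ioi (0 : ℝ),
      HasDerivAt ψ (-(∑' j : ℕ, a j * Real.exp (-t * j)) * ψ t) t :=
    fun t ht => h.hasDerivAt_laplace hs1 ht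
  clear_value ψ A B
  -- The logarithmic derivative of this product is `A - t B - ∑ a_j e ^ (-t j)`, which is
  -- nonpositive because `e ^ (-t j) ≥ 1 - t j`. Its value at `0` is `1`.
  have hanti : AntitoneOn (fun t => ψ t * Real.exp (t * A - t ^ 2 / 2 * B)) (Set.Ici 0) := by
    refine antitoneOn_of_deriv_nonpos (convex_Ici 0) (hcont.mul (by fun_prop)) ?_ ?_
    · intro t ht
      rw [interior_Ici] at ht
      exact ((hderiv t ht).differentiableAt.mul (by fun_prop)).differentiableWithinAt
    · intro t ht
      rw [interior_Ici] at ht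
      have h3 : HasDerivAt (fun t : ℝ => Real.exp (t * A - t ^ 2 / 2 * B))
          (Real.exp (t * A - t ^ 2 / 2 * B) * (A - t * B)) t := by
        refine HasDerivAt.exp ?_
        have e1 : HasDerivAt (fun t : ℝ => t * A) (1 * A) t := (hasDerivAt_id' t).mul_const A
        have e2 : HasDerivAt (fun t : ℝ => t ^ 2 / 2 * B) (((2 : ℕ) : ℝ) * t ^ (2 - 1) / 2 * B) t :=
          ((hasDerivAt_pow 2 t).div_const 2).mul_const B
        refine (e1.sub e2).congr_deriv ?_
        push_cast
        ring
      rw [show deriv (fun t => ψ t * Real.exp (t * A - t ^ 2 / 2 * B)) t = _ from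
        ((hderiv t ht).mul h3).deriv]
      have h4 : A - t * B ≤ ∑' j, a j * Real.exp (-t * j) := by
        rw [hA, hB, ← tsum_mul_left, ← hs1.tsum_sub (hs.mul_left t)]
        refine (hs1.sub (hs.mul_left t)).tsum_le_tsum (fun j => ?_)
          (summable_norm_mul_exp_neg hs1 h.rate_nonneg (le_of_lt ht)).of_norm
        have := Real.add_one_le_exp (-t * j)
        nlinarith [h.rate_nonneg j]
      have h5 := mul_nonneg (hψn t) (Real.exp_nonneg (t * A - t ^ 2 / 2 * B))
      nlinarith
  have h6 := hanti (Set.mem_Ici.2 le_rfl) (Set.mem_Ici.2 ht) ht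
  simp only [hψ0] at h6
  rw [zero_mul, zero_pow two_ne_zero, zero_div, zero_mul, sub_zero, Real.exp_zero, mul_one] at h6
  have h7 : -t * A + t ^ 2 / 2 * B = -(t * A - t ^ 2 / 2 * B) := by ring
  rw [h7, Real.exp_neg, ← one_div, le_div_iff₀ (Real.exp_pos _)]
  simpa only [hψ] using h6

/-- For `|x| ≤ 1` this is the Taylor remainder. For `|x| ≥ 1` the triangle inequality gives `2 |x| ≤
2 x²`, which is where the constant `2` comes from. -/
lemma _root_.Complex.norm_exp_I_mul_sub_sub_le (x : ℝ) :
    ‖Complex.exp (Complex.I * x) - 1 - Complex.I * x‖ ≤ 2 * x ^ 2 := by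
  have hn : ‖Complex.I * x‖ = |x| := by simp
  rcases le_total |x| 1 with hx | hx
  · have := Complex.norm_exp_sub_one_sub_id_le (x := Complex.I * x) (by rwa [hn])
    rw [hn, sq_abs] at this
    nlinarith [sq_nonneg x]
  · have h1 := Real.norm_exp_I_mul_ofReal_sub_one_le (x := x)
    have h2 := norm_sub_le (Complex.exp (Complex.I * x) - 1) (Complex.I * x)
    rw [hn] at h2
    rw [Real.norm_eq_abs] at h1
    nlinarith [sq_abs x]

lemma norm_exp_I_mul_ofReal (x : ℝ) : ‖Complex.exp (Complex.I * x)‖ = 1 := by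
  rw [mul_comm]; exact Complex.norm_exp_ofReal_mul_I x

lemma summable_norm_mul_exp_I {b : ℕ → ℝ} (hb : Summable b) (hb0 : ∀ j, 0 ≤ b j) (t : ℝ) :
    Summable fun j : ℕ => ‖(b j : ℂ) * Complex.exp (Complex.I * (t * j : ℝ))‖ := by
  refine hb.congr fun j => ?_
  rw [norm_mul, norm_exp_I_mul_ofReal, mul_one, Complex.norm_of_nonneg (hb0 j)]

/-- The twisted recursion again, now on the unit circle: all factors have modulus one, so the finite
mean dominates for every real `t`. -/
lemma hasDerivAt_charFun (h : IsCompoundPoisson a p) (hs1 : Summable a) (t : ℝ) :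
    HasDerivAt (fun t : ℝ => ∑' m : ℕ, (p m : ℂ) * Complex.exp (Complex.I * (t * m : ℝ)))
      (Complex.I * (∑' j : ℕ, (a j : ℂ) * Complex.exp (Complex.I * (t * j : ℝ))) *
        ∑' m : ℕ, (p m : ℂ) * Complex.exp (Complex.I * (t * m : ℝ))) t := by
  have hm := h.hasSum_mean hs1
  have h1 : HasDerivAt (fun t : ℝ => ∑' m : ℕ, (p m : ℂ) * Complex.exp (Complex.I * (t * m : ℝ))) (∑' m : ℕ, (p m : ℂ) *
      (Complex.exp (Complex.I * (t * m : ℝ)) * (Complex.I * m))) t := by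
    refine hasDerivAt_tsum (u := fun m : ℕ => (m : ℝ) * p m)
      (g := fun (m : ℕ) (t : ℝ) => (p m : ℂ) * Complex.exp (Complex.I * (t * m : ℝ)))
      (g' := fun (m : ℕ) (t : ℝ) => (p m : ℂ) *
        (Complex.exp (Complex.I * (t * m : ℝ)) * (Complex.I * m))) hm.summable (fun m t => ?_)
      (fun m t => ?_) (y₀ := 0) (summable_norm_mul_exp_I h.hasSum.summable h.nonneg 0).of_norm t
    · refine (HasDerivAt.cexp ?_).const_mul _
      have := (((hasDerivAt_id t).ofReal_comp).mul_const (m : ℂ)).const_mul Complex.I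
      simpa using this
    · rw [norm_mul, norm_mul, norm_exp_I_mul_ofReal, Complex.norm_of_nonneg (h.nonneg m)]
      simp [mul_comm]
  have h2 := hasSum_renewal_twist (𝕜 := ℂ) (α := fun j => (a j : ℂ)) (r := fun m => (p m : ℂ))
    (f := fun j : ℕ => Complex.exp (Complex.I * (t * j : ℝ)))
    (g := fun j : ℕ => Complex.exp (Complex.I * (t * j : ℝ)))
    (fun m => by exact_mod_cast congrArg (fun x : ℝ => (x : ℂ)) (h.mul_eq m))
    (summable_norm_mul_exp_I hs1 h.rate_nonneg t) (summable_norm_mul_exp_I h.hasSum.summable h.nonneg t)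
    (fun i j => by rw [← Complex.exp_add]; congr 1; push_cast; ring)
  convert h1 using 1
  rw [mul_assoc, ← h2.tsum_eq, ← tsum_mul_left]
  exact tsum_congr fun m => by ring

/-- Berry–Esseen type estimate for the characteristic function of a compound Poisson variable. -/
lemma norm_charFun_sub_le (h : IsCompoundPoisson a p)
    (hs2 : Summable fun j : ℕ => (j : ℝ) * a j) (hs3 : Summable fun j : ℕ => (j : ℝ) ^ 2 * a j)
    (t : ℝ) :
    ‖∑' m : ℕ, (p m : ℂ) * Complex.exp (Complex.I * (t * (m - ∑' j, a j) : ℝ)) -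
      Complex.exp (-(t ^ 2 / 2 * ∑' j : ℕ, (j : ℝ) * a j : ℝ))‖ ≤
      2 * |t| ^ 3 * ∑' j : ℕ, (j : ℝ) ^ 2 * a j := by
  set A := ∑' j, a j with hA
  set B := ∑' j : ℕ, (j : ℝ) * a j with hB
  set D := ∑' j : ℕ, (j : ℝ) ^ 2 * a j with hD
  have hs1 := summable_rate hs2
  have hm := h.hasSum_mean hs1
  have hB0 : 0 ≤ B := tsum_nonneg fun j => mul_nonneg (by positivity) (h.rate_nonneg j)
  have hD0 : 0 ≤ D := tsum_nonneg fun j => mul_nonneg (by positivity) (h.rate_nonneg j)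
  set φ : ℝ → ℂ := fun t => ∑' m : ℕ, (p m : ℂ) * Complex.exp (Complex.I * (t * m : ℝ)) with hφ
  have hφ0 : φ 0 = 1 := by
    simp only [hφ, zero_mul, Complex.ofReal_zero, mul_zero, Complex.exp_zero, mul_one]
    rw [← Complex.ofReal_tsum, h.hasSum.tsum_eq, Complex.ofReal_one]
  have hφn : ∀ t, ‖φ t‖ ≤ 1 := fun t => by
    rw [← h.hasSum.tsum_eq]
    refine (norm_tsum_le_tsum_norm (summable_norm_mul_exp_I h.hasSum.summable h.nonneg t)).trans_eq ?_
    exact tsum_congr fun m => by rw [norm_mul, norm_exp_I_mul_ofReal, mul_one, Complex.norm_of_nonneg (h.nonneg m)]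
  have hderiv : ∀ t : ℝ, HasDerivAt φ
      (Complex.I * (∑' j : ℕ, (a j : ℂ) * Complex.exp (Complex.I * (t * j : ℝ))) * φ t) t :=
    h.hasDerivAt_charFun hs1
  have hgoal : ∑' m : ℕ, (p m : ℂ) * Complex.exp (Complex.I * (t * (m - A) : ℝ)) =
      φ t * Complex.exp (-(Complex.I * (t * A : ℝ))) := by
    rw [hφ, ← tsum_mul_right]
    refine tsum_congr fun m => ?_
    rw [mul_assoc, ← Complex.exp_add]
    congr 2
    push_cast
    ring
  set S : ℝ → ℂ := fun t => ∑' j : ℕ, (a j : ℂ) * Complex.exp (Complex.I * (t * j : ℝ)) with hS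
  have hSle : ∀ t : ℝ, ‖S t - A - Complex.I * (t * B : ℝ)‖ ≤ 2 * t ^ 2 * D := by
    intro t
    have e1 : HasSum (fun j : ℕ => (a j : ℂ)) A := by exact_mod_cast hs1.hasSum
    have e2 : HasSum (fun j : ℕ => Complex.I * (t * (j * a j) : ℝ)) (Complex.I * (t * B : ℝ)) := by
      refine HasSum.mul_left _ ?_
      exact_mod_cast hs2.hasSum.mul_left t
    have e3 := (((summable_norm_mul_exp_I hs1 h.rate_nonneg t).of_norm.hasSum).sub e1).sub e2
    rw [← e3.tsum_eq, hD, ← tsum_mul_left]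
    refine tsum_of_norm_bounded (hs3.mul_left (2 * t ^ 2)).hasSum fun j => ?_
    have e4 := Complex.norm_exp_I_mul_sub_sub_le (t * j)
    calc _ = ‖(a j : ℂ) * (Complex.exp (Complex.I * (t * j : ℝ)) - 1 -
          Complex.I * (t * j : ℝ))‖ := by congr 1; push_cast; ring
      _ ≤ a j * (2 * (t * j) ^ 2) := by
        rw [norm_mul, Complex.norm_of_nonneg (h.rate_nonneg j)]
        exact mul_le_mul_of_nonneg_left e4 (h.rate_nonneg j)
      _ = _ := by ring
  rw [hgoal]
  have hSt : ∀ t : ℝ, S t = ∑' j : ℕ, (a j : ℂ) * Complex.exp (Complex.I * (t * j : ℝ)) :=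
    fun t => rfl
  clear_value φ S A B D
  -- The centred characteristic function divided by the Gaussian one. It satisfies `χ' = i (S - A -
  -- i t B) χ`, with a bracket of size at most `2 t² D`, so it stays near `χ 0 = 1`.
  set χ : ℝ → ℂ := fun t =>
    φ t * Complex.exp (-(Complex.I * (t * A : ℝ)) + (t ^ 2 / 2 * B : ℝ)) with hχ
  have hχd : ∀ t, HasDerivAt χ
      (Complex.I * (S t - A - Complex.I * (t * B : ℝ)) * χ t) t := by
    intro t
    have h3 : HasDerivAt (fun t : ℝ =>
        Complex.exp (-(Complex.I * (t * A : ℝ)) + (t ^ 2 / 2 * B : ℝ)))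
        (Complex.exp (-(Complex.I * (t * A : ℝ)) + (t ^ 2 / 2 * B : ℝ)) *
          (-(Complex.I * A) + (t * B : ℝ))) t := by
      refine HasDerivAt.cexp (HasDerivAt.add ?_ ?_)
      · have e1 : HasDerivAt (fun t : ℝ => -(Complex.I * ((t * A : ℝ) : ℂ)))
            (-(Complex.I * ((1 * A : ℝ) : ℂ))) t :=
          ((((hasDerivAt_id' t).mul_const A).ofReal_comp).const_mul Complex.I).neg
        simpa using e1
      · refine HasDerivAt.ofReal_comp (f := fun t : ℝ => t ^ 2 / 2 * B) ?_
        have e2 : HasDerivAt (fun t : ℝ => t ^ 2 / 2 * B) (((2 : ℕ) : ℝ) * t ^ (2 - 1) / 2 * B) t :=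
          ((hasDerivAt_pow 2 t).div_const 2).mul_const B
        refine e2.congr_deriv ?_
        push_cast
        ring
    refine ((hderiv t).mul h3).congr_deriv ?_
    rw [← hSt t]
    simp only [hχ]
    push_cast
    linear_combination (t * B * φ t * Complex.exp (-(Complex.I * (t * A)) + (t ^ 2 / 2 * B)) : ℂ)
      * Complex.I_mul_I
  have hχ0 : χ 0 = 1 := by simp [hχ, hφ0]
  have hχn : ∀ y ∈ Set.Icc (-|t|) |t|, ‖χ y‖ ≤ Real.exp (t ^ 2 / 2 * B) := by
    intro y hy
    have hy2 : y ^ 2 ≤ t ^ 2 := sq_le_sq.2 (abs_le.2 hy)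
    rw [hχ, norm_mul, Complex.norm_exp]
    refine (mul_le_of_le_one_left (Real.exp_nonneg _) (hφn y)).trans ?_
    refine Real.exp_le_exp.2 ?_
    have : (-(Complex.I * (y * A : ℝ)) + (y ^ 2 / 2 * B : ℝ) : ℂ).re = y ^ 2 / 2 * B := by
      rw [Complex.add_re, Complex.neg_re, Complex.re_mul_ofReal, Complex.I_re, Complex.ofReal_re]
      ring
    rw [this]
    gcongr
  -- The symmetric interval treats both signs of `t` at once. The factor `exp (t² B / 2)` in the
  -- constant is cancelled on multiplying back by the Gaussian.
  have hmv := Convex.norm_image_sub_le_of_norm_hasDerivWithin_le (f := χ)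
    (C := 2 * t ^ 2 * D * Real.exp (t ^ 2 / 2 * B)) (s := Set.Icc (-|t|) |t|)
    (fun y _ => (hχd y).hasDerivWithinAt)
    (fun y hy => by
      have hy2 : y ^ 2 ≤ t ^ 2 := sq_le_sq.2 (abs_le.2 hy)
      rw [norm_mul, norm_mul, Complex.norm_I, one_mul]
      refine mul_le_mul ((hSle y).trans ?_) (hχn y hy) (norm_nonneg _) (by positivity)
      gcongr) (convex_Icc _ _)
    (x := 0) (y := t) ⟨by simp, abs_nonneg t⟩ ⟨neg_abs_le t, le_abs_self t⟩
  rw [hχ0, sub_zero, Real.norm_eq_abs] at hmv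
  have hfin : φ t * Complex.exp (-(Complex.I * (t * A : ℝ))) -
      Complex.exp (-(t ^ 2 / 2 * B : ℝ)) =
      (χ t - 1) * Complex.exp (-(t ^ 2 / 2 * B : ℝ)) := by
    rw [sub_mul, one_mul, hχ, mul_assoc, ← Complex.exp_add]
    congr 3
    push_cast
    ring
  rw [hfin, norm_mul, Complex.norm_exp, ← Complex.ofReal_neg, Complex.ofReal_re]
  calc ‖χ t - 1‖ * Real.exp (-(t ^ 2 / 2 * B))
      ≤ 2 * t ^ 2 * D * Real.exp (t ^ 2 / 2 * B) * |t| * Real.exp (-(t ^ 2 / 2 * B)) := by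
        gcongr
    _ = 2 * |t| ^ 3 * D * (Real.exp (t ^ 2 / 2 * B) * Real.exp (-(t ^ 2 / 2 * B))) := by
        rw [← sq_abs t]; ring
    _ = _ := by rw [← Real.exp_add, add_neg_cancel, Real.exp_zero, mul_one]

end IsCompoundPoisson
end SpatialPartitions

/-! ### Slow variation of the weights at the origin. -/

namespace SpatialPartitions
open Finset

lemma renewal_rec_range {a : ℕ → ℝ} (ha0 : a 0 = 0) (m : ℕ) :
    (m : ℝ) * renewal a m = ∑ i ∈ range (m + 1), a i * renewal a (m - i) := by
  rw [renewal_rec ha0, Nat.sum_antidiagonal_eq_sum_range_succ_mk]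

/-- Subtract the recursions at `k + 1` and `k`, aligned by the second factor. The leading term is `a
1 * renewal a k = renewal a k`; moved to the left, it turns the coefficient `k` into `k + 1`. -/
lemma renewal_sub_eq {a : ℕ → ℝ} (ha0 : a 0 = 0) (ha1 : a 1 = 1) (k : ℕ) :
    ((k : ℝ) + 1) * (renewal a (k + 1) - renewal a k) =
      ∑ i ∈ range k, (a (i + 2) - a (i + 1)) * renewal a (k - (i + 1)) := by
  have h1 := renewal_rec_range ha0 (k + 1)
  have h2 := renewal_rec_range ha0 k
  rw [sum_range_succ', ha0, zero_mul, add_zero] at h1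
  have h3 : ∑ i ∈ range (k + 1), (a (i + 1) - a i) * renewal a (k - i) =
      ((k + 1 : ℕ) : ℝ) * renewal a (k + 1) - k * renewal a k := by
    rw [h1, h2, ← sum_sub_distrib]
    refine sum_congr rfl fun i _ => ?_
    rw [Nat.add_sub_add_right]
    ring
  rw [sum_range_succ', ha0, zero_add, ha1, Nat.sub_zero] at h3
  push_cast at h3
  linarith

lemma renewal_monotone {a : ℕ → ℝ} (ha0 : a 0 = 0) (ha1 : a 1 = 1) (ha : Monotone a) :
    Monotone (renewal a) := by
  have hnn : ∀ j, 0 ≤ a j := fun j => ha0 ▸ ha (Nat.zero_le j)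
  refine monotone_nat_of_le_succ fun k => ?_
  have h := renewal_sub_eq ha0 ha1 k
  have h1 : 0 ≤ ∑ i ∈ range k, (a (i + 2) - a (i + 1)) * renewal a (k - (i + 1)) :=
    sum_nonneg fun i _ => mul_nonneg (sub_nonneg.2 (ha (by omega))) (renewal_nonneg hnn _)
  rw [← h] at h1
  have := nonneg_of_mul_nonneg_right h1 (by positivity)
  linarith

/-- The coefficients of `exp (∑ j ^ (γ - 1) z ^ j)`. -/
noncomputable def stretched (γ : ℝ) : ℕ → ℝ := renewal fun j => (j : ℝ) ^ γ

variable {γ : ℝ}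

lemma monotone_natCast_rpow (hγ : 0 < γ) : Monotone fun j : ℕ => (j : ℝ) ^ γ := fun i j hij =>
  Real.rpow_le_rpow (by positivity) (by exact_mod_cast hij) hγ.le

lemma stretched_monotone (hγ : 0 < γ) : Monotone (stretched γ) :=
  renewal_monotone (by simp [Real.zero_rpow hγ.ne']) (by simp) (monotone_natCast_rpow hγ)

lemma one_le_stretched (hγ : 0 < γ) (k : ℕ) : 1 ≤ stretched γ k := by
  have := stretched_monotone hγ (Nat.zero_le k)
  rwa [stretched, renewal_zero] at this

/-- Factor out `x ^ γ` with `x = i + 2` and use `y ≤ y ^ γ` at `y = 1 - 1 / x`; this is where `γ ≤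
1` enters. -/
lemma natCast_rpow_sub_le (hγ1 : γ ≤ 1) (i : ℕ) :
    ((i + 2 : ℕ) : ℝ) ^ γ - ((i + 1 : ℕ) : ℝ) ^ γ ≤ ((i + 2 : ℕ) : ℝ) ^ γ / (i + 2 : ℕ) := by
  set x : ℝ := ((i + 2 : ℕ) : ℝ) with hx
  have hx0 : 0 < x := by positivity
  have hy : ((i + 1 : ℕ) : ℝ) = x * (1 - 1 / x) := by
    rw [mul_sub, mul_one_div_cancel hx0.ne', hx]; push_cast; ring
  have hx1 : 1 / x ≤ 1 := by
    rw [div_le_one hx0, hx]; push_cast; linarith [(Nat.cast_nonneg i : (0:ℝ) ≤ i)]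
  have h1 : 1 - 1 / x ≤ (1 - 1 / x) ^ γ := by
    have h0 : 0 < 1 - 1 / x := by
      rw [sub_pos, div_lt_one hx0, hx]; push_cast; linarith [(Nat.cast_nonneg i : (0:ℝ) ≤ i)]
    have := Real.rpow_le_rpow_of_exponent_ge h0 (by linarith [one_div_pos.2 hx0]) hγ1
    rwa [Real.rpow_one] at this
  rw [hy, Real.mul_rpow hx0.le (by linarith)]
  have h2 : 0 < x ^ γ := Real.rpow_pos_of_pos hx0 _
  have h3 := mul_le_mul_of_nonneg_left h1 h2.le
  have : x ^ γ * (1 - 1 / x) = x ^ γ - x ^ γ / x := by ring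
  linarith

/-- In the formula for the increment, small part sizes are handled by telescoping `a` together with
monotonicity of the sequence. Large sizes use `a (i + 2) - a (i + 1) ≤ a (i + 2) / J`, after which
the recursion itself bounds the sum. -/
lemma stretched_sub_le (hγ : 0 < γ) (hγ1 : γ ≤ 1) (k : ℕ) :
    stretched γ (k + 1) - stretched γ k ≤
      2 * ((k + 1 : ℕ) : ℝ) ^ (-(1 / (1 + γ))) * stretched γ (k + 1) := by
  set a : ℕ → ℝ := fun j => (j : ℝ) ^ γ with ha
  have ha0 : a 0 = 0 := by simp [ha, Real.zero_rpow hγ.ne']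
  have ha1 : a 1 = 1 := by simp [ha]
  have hmono : Monotone a := monotone_natCast_rpow hγ
  have hnn : ∀ j, 0 ≤ a j := fun j => ha0 ▸ hmono (Nat.zero_le j)
  have hw := renewal_monotone ha0 ha1 hmono
  have hw0 := renewal_nonneg hnn
  change renewal a (k + 1) - renewal a k ≤ _ * renewal a (k + 1)
  set x : ℝ := ((k + 1 : ℕ) : ℝ) with hx
  have hx0 : 0 < x := by positivity
  have hx1 : 1 ≤ x := by rw [hx]; exact_mod_cast Nat.succ_le_succ (Nat.zero_le k)
  -- The cutoff balances the contributions `J ^ γ` and `x / J` of the small and the large sizes.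
  set J : ℝ := x ^ (1 / (1 + γ)) with hJ
  have hJ0 : 0 < J := Real.rpow_pos_of_pos hx0 _
  have hJ1 : 1 ≤ J := Real.one_le_rpow hx1 (by positivity)
  have hJinv : x ^ (-(1 / (1 + γ))) = 1 / J := by
    rw [Real.rpow_neg hx0.le, ← hJ, one_div J]
  have hJg : J ^ γ = x / J := by
    rw [eq_div_iff hJ0.ne', ← Real.rpow_add_one hJ0.ne', hJ, ← Real.rpow_mul hx0.le,
      one_div, add_comm γ 1, inv_mul_cancel₀ (by positivity), Real.rpow_one]
  -- With the cutoff `i < ⌊J⌋₊ - 1` the telescoping sum ends at `a ⌊J⌋₊`, while the remaining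
  -- indices satisfy `i + 2 ≥ ⌊J⌋₊ + 1 > J`.
  have hterm : ∀ i ∈ range k, (a (i + 2) - a (i + 1)) * renewal a (k - (i + 1)) ≤
      (if i < ⌊J⌋₊ - 1 then (a (i + 2) - a (i + 1)) else 0) * renewal a (k + 1) +
        1 / J * (a (i + 2) * renewal a (k - (i + 1))) := by
    intro i _
    have e1 : 0 ≤ a (i + 2) - a (i + 1) := sub_nonneg.2 (hmono (by omega))
    have e2 : 0 ≤ 1 / J * (a (i + 2) * renewal a (k - (i + 1))) :=
      mul_nonneg (by positivity) (mul_nonneg (hnn _) (hw0 _))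
    split_ifs with h
    · have := mul_le_mul_of_nonneg_left (hw (show k - (i + 1) ≤ k + 1 by omega)) e1
      linarith
    · rw [zero_mul, zero_add, ← mul_assoc]
      refine mul_le_mul_of_nonneg_right ?_ (hw0 _)
      refine (natCast_rpow_sub_le hγ1 i).trans ?_
      rw [one_div, mul_comm, ← div_eq_mul_inv]
      refine div_le_div_of_nonneg_left (hnn _) hJ0 ?_
      refine (Nat.lt_floor_add_one J).le.trans ?_
      have : ⌊J⌋₊ + 1 ≤ i + 2 := by omega
      exact_mod_cast this
  have hsum1 : ∑ i ∈ range k, (if i < ⌊J⌋₊ - 1 then (a (i + 2) - a (i + 1)) else 0) ≤ J ^ γ := by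
    have hfl : 1 ≤ ⌊J⌋₊ := (Nat.one_le_floor_iff J).2 hJ1
    calc _ ≤ ∑ i ∈ range (⌊J⌋₊ - 1), (a (i + 1 + 1) - a (i + 1)) := by
          rw [← sum_filter]
          refine sum_le_sum_of_subset_of_nonneg ?_ fun i _ _ => sub_nonneg.2 (hmono (by omega))
          intro i; simp
      _ = a ⌊J⌋₊ - a 1 := by
          rw [sum_range_sub (fun i => a (i + 1))]
          simp only [zero_add]
          rw [Nat.sub_add_cancel hfl]
      _ ≤ a ⌊J⌋₊ := by rw [ha1]; linarith
      _ ≤ J ^ γ := Real.rpow_le_rpow (by positivity) (Nat.floor_le hJ0.le) hγ.le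
  have hsum2 : ∑ i ∈ range k, a (i + 2) * renewal a (k - (i + 1)) ≤ x * renewal a (k + 1) := by
    have h1 := renewal_rec_range ha0 (k + 1)
    rw [sum_range_succ', sum_range_succ', ha0, zero_mul, add_zero] at h1
    rw [hx, h1]
    have h2 : ∑ i ∈ range k, a (i + 2) * renewal a (k - (i + 1)) =
        ∑ i ∈ range k, a (i + 1 + 1) * renewal a (k + 1 - (i + 1 + 1)) :=
      sum_congr rfl fun i _ => by rw [Nat.add_sub_add_right]
    rw [h2]
    exact le_add_of_nonneg_right (mul_nonneg (hnn _) (hw0 _))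
  have hmain := renewal_sub_eq ha0 ha1 k
  have h3 := (sum_le_sum hterm).trans_eq (by rw [sum_add_distrib, ← sum_mul, ← mul_sum])
  rw [← hmain] at h3
  have h4 := mul_le_mul_of_nonneg_right hsum1 (hw0 (k + 1))
  have h5 := mul_le_mul_of_nonneg_left hsum2 (by positivity : 0 ≤ 1 / J)
  have hx' : ((k : ℝ) + 1) = x := by rw [hx]; push_cast; ring
  rw [hx'] at h3
  rw [hJinv]
  rw [hJg] at h4
  refine le_of_mul_le_mul_left ?_ hx0
  calc _ ≤ _ := h3
    _ ≤ x / J * renewal a (k + 1) + 1 / J * (x * renewal a (k + 1)) := add_le_add h4 h5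
    _ = _ := by ring

/-- `stretched γ` varies slowly: its logarithmic increments beyond `l` are at most
`4 l ^ (-1 / (1 + γ))`. -/
lemma stretched_le_mul_exp (hγ : 0 < γ) (hγ1 : γ ≤ 1) {l : ℕ} (hl : 0 < l)
    (hb : 4 * (l : ℝ) ^ (-(1 / (1 + γ))) ≤ 1) {k : ℕ} (hk : l ≤ k) :
    stretched γ k ≤ stretched γ l * Real.exp (4 * (l : ℝ) ^ (-(1 / (1 + γ))) * (k - l)) := by
  induction k, hk using Nat.le_induction with
  | base => simp
  | succ k hk ih =>
    set b := 4 * (l : ℝ) ^ (-(1 / (1 + γ))) with hbdef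
    have h1 := stretched_sub_le hγ hγ1 k
    have h2 : ((k + 1 : ℕ) : ℝ) ^ (-(1 / (1 + γ))) ≤ (l : ℝ) ^ (-(1 / (1 + γ))) :=
      Real.rpow_le_rpow_of_nonpos (by exact_mod_cast hl) (by exact_mod_cast hk.trans (by omega))
        (by have : 0 ≤ 1 / (1 + γ) := by positivity
            linarith)
    have h0 := one_le_stretched hγ (k + 1)
    have h3 : stretched γ (k + 1) * (1 - b / 2) ≤ stretched γ k := by nlinarith
    have hb0 : 0 ≤ b := by positivity
    have h4 : stretched γ (k + 1) ≤ stretched γ k * Real.exp b := by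
      have e1 := Real.add_one_le_exp b
      -- Here `e ^ b ≥ 1 + b`, and `(1 - b / 2)(1 + b) ≥ 1` for `0 ≤ b ≤ 1`.
      have e2 : 1 ≤ (1 - b / 2) * Real.exp b := by nlinarith
      calc stretched γ (k + 1) ≤ stretched γ (k + 1) * ((1 - b / 2) * Real.exp b) :=
            le_mul_of_one_le_right (by linarith) e2
        _ = stretched γ (k + 1) * (1 - b / 2) * Real.exp b := by ring
        _ ≤ _ := mul_le_mul_of_nonneg_right h3 (Real.exp_nonneg _)
    refine h4.trans ((mul_le_mul_of_nonneg_right ih (Real.exp_nonneg b)).trans_eq ?_)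
    rw [mul_assoc, ← Real.exp_add]
    congr 2
    push_cast
    ring

/-- For `k ≥ l / 2`, apply `stretched_le_mul_exp` upwards from `k`; replacing `k` by `l` in the rate
costs a factor of at most `2`, hence `8`. For `k < l / 2` the right side already exceeds `1`. -/
lemma one_sub_stretched_div_le (hγ : 0 < γ) (hγ1 : γ ≤ 1) {l : ℕ} (hl : 0 < l)
    (hb : 8 * (l : ℝ) ^ (-(1 / (1 + γ))) ≤ 1) {k : ℕ} (hk : k ≤ l) :
    1 - stretched γ k / stretched γ l ≤ 8 * (l : ℝ) ^ (-(1 / (1 + γ))) * (l - k) := by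
  set β := 1 / (1 + γ) with hβ
  have hβ0 : 0 < β := by positivity
  have hβ1 : β ≤ 1 := by rw [hβ, div_le_one (by positivity)]; linarith
  have hwl := one_le_stretched hγ l
  have hwk := one_le_stretched hγ k
  have hl1 : (1 : ℝ) ≤ l := by exact_mod_cast hl
  have hl0 : (0 : ℝ) < l := by linarith
  rcases le_or_gt (l : ℝ) (2 * k) with h | h
  · have hk0 : (0 : ℝ) < k := by linarith
    have h1 : (k : ℝ) ^ (-β) ≤ 2 * (l : ℝ) ^ (-β) := by
      calc (k : ℝ) ^ (-β) ≤ ((l : ℝ) / 2) ^ (-β) :=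
            Real.rpow_le_rpow_of_nonpos (by positivity) (by linarith) (by linarith)
        _ = 2 ^ β * (l : ℝ) ^ (-β) := by
            rw [div_eq_mul_inv, Real.mul_rpow hl0.le (by norm_num), Real.inv_rpow (by norm_num),
              Real.rpow_neg (by norm_num : (0:ℝ) ≤ 2), inv_inv, mul_comm]
        _ ≤ _ := by
            refine mul_le_mul_of_nonneg_right ?_ (by positivity)
            calc (2 : ℝ) ^ β ≤ 2 ^ (1 : ℝ) := Real.rpow_le_rpow_of_exponent_le (by norm_num) hβ1
              _ = 2 := Real.rpow_one 2
    have h2 := stretched_le_mul_exp hγ hγ1 (l := k) (by exact_mod_cast hk0) (by linarith) hk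
    set E := 4 * (k : ℝ) ^ (-β) * (l - k) with hE
    have hlk : (0 : ℝ) ≤ l - k := sub_nonneg.2 (by exact_mod_cast hk)
    have h3 : Real.exp (-E) ≤ stretched γ k / stretched γ l := by
      rw [le_div_iff₀ (by linarith), Real.exp_neg, inv_mul_le_iff₀ (Real.exp_pos _), mul_comm]
      exact h2
    have h4 := Real.add_one_le_exp (-E)
    have h5 : E ≤ 8 * (l : ℝ) ^ (-β) * (l - k) := mul_le_mul_of_nonneg_right (by linarith) hlk
    linarith
  · have h1 : 0 ≤ stretched γ k / stretched γ l := by positivity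
    have h2 : 1 ≤ (l : ℝ) ^ (-β) * l := by
      nth_rewrite 2 [← Real.rpow_one (l : ℝ)]
      rw [← Real.rpow_add hl0]
      exact Real.one_le_rpow hl1 (by linarith)
    have h3 : 0 ≤ (l : ℝ) ^ (-β) := by positivity
    nlinarith

/-! ### The tilt and its distance from one. -/

/-- The ratio of the weight of `n - m` to the weight of the reference value `l`. -/
noncomputable def tilt (γ : ℝ) (l n m : ℕ) : ℝ :=
  if m ≤ n then stretched γ (n - m) / stretched γ l else 0

lemma tilt_nonneg (hγ : 0 < γ) (l n m : ℕ) : 0 ≤ tilt γ l n m := by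
  rw [tilt]
  have := one_le_stretched hγ l
  have := one_le_stretched hγ (n - m)
  split_ifs <;> positivity

/-- If `n - m ≥ l` the tilt is at least `1` and grows at most exponentially; otherwise it is at most
`1` with a deficit linear in `m - A`. The `+ 1` in the exponent absorbs the rounding of `n - A` to
`l`. -/
lemma abs_tilt_sub_one_le (hγ : 0 < γ) (hγ1 : γ ≤ 1) {l n : ℕ} {A b : ℝ} (hl : 0 < l)
    (hb : b = 4 * (l : ℝ) ^ (-(1 / (1 + γ)))) (hb2 : 2 * b ≤ 1) (hlA : (l : ℝ) ≤ n - A)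
    (hAl : n - A ≤ l + 1) (m : ℕ) :
    |tilt γ l n m - 1| ≤ |Real.exp (b * (A - m + 1)) - 1| + 2 * b * |(m : ℝ) - A| := by
  have hb0 : 0 ≤ b := by rw [hb]; positivity
  have hw0 := one_le_stretched hγ 0
  have hwl := one_le_stretched hγ l
  have hn1 : 0 ≤ |Real.exp (b * (A - m + 1)) - 1| := abs_nonneg _
  have hn2 : 0 ≤ 2 * b * |(m : ℝ) - A| := by positivity
  have h8 : 8 * (l : ℝ) ^ (-(1 / (1 + γ))) = 2 * b := by rw [hb]; ring
  rcases le_or_gt (l + m) n with h | h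
  · have hmn : m ≤ n := by omega
    rw [tilt, if_pos hmn]
    have h1 : 1 ≤ stretched γ (n - m) / stretched γ l := by
      rw [one_le_div (by linarith)]
      exact stretched_monotone hγ (by omega)
    have h2 := stretched_le_mul_exp hγ hγ1 (k := n - m) hl (by linarith) (by omega)
    rw [← hb, Nat.cast_sub hmn] at h2
    have h3 : stretched γ (n - m) / stretched γ l ≤ Real.exp (b * (A - m + 1)) := by
      rw [div_le_iff₀ (by linarith), mul_comm]
      refine h2.trans (mul_le_mul_of_nonneg_left (Real.exp_le_exp.2 ?_) (by linarith))
      exact mul_le_mul_of_nonneg_left (by linarith) hb0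
    rw [abs_of_nonneg (by linarith)]
    linarith [le_abs_self (Real.exp (b * (A - m + 1)) - 1)]
  · set k := n - m with hk
    have hkl : k ≤ l := by omega
    have hW0 := tilt_nonneg hγ l n m
    have hcast : (l : ℝ) - k ≤ m - A := by
      rcases le_or_gt m n with hmn | hmn
      · rw [hk, Nat.cast_sub hmn]; linarith
      · rw [hk, Nat.sub_eq_zero_of_le hmn.le]
        have : (n : ℝ) ≤ m := by exact_mod_cast hmn.le
        push_cast; linarith
    have h1 := one_sub_stretched_div_le hγ hγ1 hl (by linarith) hkl
    rw [h8] at h1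
    have hle : 2 * b * ((l : ℝ) - k) ≤ 2 * b * |(m : ℝ) - A| :=
      mul_le_mul_of_nonneg_left (hcast.trans (le_abs_self _)) (by linarith)
    have hW1 : tilt γ l n m ≤ 1 := by
      rw [tilt]
      split_ifs
      · rw [div_le_one (by linarith)]; exact stretched_monotone hγ hkl
      · exact zero_le_one
    have hW2 : 1 - tilt γ l n m ≤ 2 * b * ((l : ℝ) - k) := by
      rcases le_or_gt m n with hmn | hmn
      · rw [tilt, if_pos hmn]; exact h1
      -- For `m > n` the tilt is `0` and the truncated `n - m` is `0`, so the claim is `1 ≤ 2 b l`,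
      -- which holds since `l ^ (1 - 1 / (1 + γ)) ≥ 1`.
      · rw [tilt, if_neg hmn.not_ge, hk, Nat.sub_eq_zero_of_le hmn.le]
        have hl1 : (1 : ℝ) ≤ l := by exact_mod_cast hl
        have h2 : 1 ≤ (l : ℝ) ^ (-(1 / (1 + γ))) * l := by
          nth_rewrite 2 [← Real.rpow_one (l : ℝ)]
          rw [← Real.rpow_add (by linarith)]
          refine Real.one_le_rpow hl1 ?_
          have : 1 / (1 + γ) ≤ 1 := by rw [div_le_one (by positivity)]; linarith
          linarith
        push_cast
        rw [← h8]
        linarith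
    rw [abs_sub_comm, abs_of_nonneg (by linarith)]
    linarith

/-- Serves in place of Cauchy–Schwarz: it turns second-moment bounds into first-moment bounds at the
price of `ε`. -/
lemma abs_le_add_sq_div {ε : ℝ} (hε : 0 < ε) (v : ℝ) : |v| ≤ ε + v ^ 2 / ε := by
  rcases le_total |v| ε with h | h
  · have : 0 ≤ v ^ 2 / ε := by positivity
    linarith
  · have : |v| ≤ v ^ 2 / ε := by
      rw [le_div_iff₀ hε, ← sq_abs]; nlinarith
    linarith

/-- Quantitative `L¹` bound: under a compound Poisson law with a small variance on the scale on
which `stretched γ` varies, the tilt is close to `1`. -/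
lemma tsum_abs_tilt_sub_one_le (hγ : 0 < γ) (hγ1 : γ ≤ 1) {a p : ℕ → ℝ}
    (h : IsCompoundPoisson a p) (hs : Summable fun j : ℕ => (j : ℝ) * a j) {l n : ℕ} {b ε : ℝ}
    (hl : 0 < l) (hb : b = 4 * (l : ℝ) ^ (-(1 / (1 + γ)))) (hb2 : 2 * b ≤ 1)
    (hlA : (l : ℝ) ≤ n - ∑' j, a j) (hAl : n - ∑' j, a j ≤ l + 1) (hε : 0 < ε) :
    (Summable fun m => p m * |tilt γ l n m - 1|) ∧
    ∑' m, p m * |tilt γ l n m - 1| ≤ 3 * ε +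
      (Real.exp (2 * b + 2 * (b ^ 2 * ∑' j : ℕ, (j : ℝ) * a j)) - 1 +
        2 * (b ^ 2 * ∑' j : ℕ, (j : ℝ) * a j)) / ε := by
  set A := ∑' j, a j with hA
  set B := ∑' j : ℕ, (j : ℝ) * a j with hB
  have hb0 : 0 ≤ b := by rw [hb]; positivity
  have hs1 := IsCompoundPoisson.summable_rate hs
  have hvar : HasSum (fun m : ℕ => p m * ((m : ℝ) - A) ^ 2) B := h.hasSum_variance hs
  have hmean := h.hasSum_mean hs1
  have hexp : ∀ u : ℝ, 0 ≤ u → HasSum (fun m : ℕ => p m * Real.exp (u * (A - m + 1)))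
      (Real.exp (u * A + u) * ∑' m : ℕ, p m * Real.exp (-u * m)) := by
    intro u hu
    have := ((IsCompoundPoisson.summable_norm_mul_exp_neg h.hasSum.summable h.nonneg
      hu).of_norm.hasSum).mul_left (Real.exp (u * A + u))
    refine (congrArg (fun f => HasSum f _) (funext fun m => ?_)).mpr this
    rw [mul_left_comm, ← Real.exp_add]
    congr 2
    ring
  have h2 := hexp (2 * b) (by linarith)
  have h1 := hexp b hb0
  have e2 : Real.exp (2 * b * A + 2 * b) * ∑' m : ℕ, p m * Real.exp (-(2 * b) * m) ≤
      Real.exp (2 * b + 2 * (b ^ 2 * B)) := by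
    refine (mul_le_mul_of_nonneg_left (h.tsum_exp_neg_le hs (t := 2 * b) (by linarith))
      (Real.exp_nonneg _)).trans_eq ?_
    rw [← Real.exp_add]
    congr 1
    ring
  -- By `1 + x ≤ e ^ x`, the exponential moment is at least `1 + b`, because `M` has mean `A`.
  have e1 : 1 ≤ Real.exp (b * A + b) * ∑' m : ℕ, p m * Real.exp (-b * m) := by
    have h3 : HasSum (fun m : ℕ => p m * (b * (A - m + 1) + 1)) (1 + b) := by
      have := (h.hasSum.mul_left (b * A + b + 1)).sub (hmean.mul_left b)
      refine (congrArg₂ HasSum (funext fun m => ?_) ?_).mpr this |> id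
      · ring
      · ring
    have h4 := hasSum_le (fun m : ℕ => mul_le_mul_of_nonneg_left
      (Real.add_one_le_exp (b * (A - m + 1))) (h.nonneg m)) h3 h1
    linarith
  -- Expanding the square, the moment at `2 b` is bounded above by `e2` and the one at `b` below by
  -- `e1`, so the sum is at most `exp (2 b + 2 b² B) - 1`.
  have hY : HasSum (fun m : ℕ => p m * (Real.exp (b * (A - m + 1)) - 1) ^ 2) _ :=
    (congrArg (fun f => HasSum f _) (funext fun m => by
      have : Real.exp (2 * b * (A - m + 1)) = Real.exp (b * (A - m + 1)) ^ 2 := by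
        rw [← Real.exp_nat_mul]; congr 1; push_cast; ring
      simp only [this]
      ring)).mpr ((h2.sub (h1.mul_left 2)).add h.hasSum)
  have hbound := ((h.hasSum.mul_left (3 * ε)).add (hY.div_const ε)).add
    ((hvar.mul_left (2 * b ^ 2)).div_const ε)
  have hpt : ∀ m, p m * |tilt γ l n m - 1| ≤
      3 * ε * p m + p m * (Real.exp (b * (A - m + 1)) - 1) ^ 2 / ε +
        2 * b ^ 2 * (p m * ((m : ℝ) - A) ^ 2) / ε := by
    intro m
    have g1 := abs_tilt_sub_one_le hγ hγ1 hl hb hb2 hlA hAl m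
    have g2 := abs_le_add_sq_div hε (Real.exp (b * (A - m + 1)) - 1)
    have g3 := abs_le_add_sq_div hε (b * ((m : ℝ) - A))
    rw [abs_mul, abs_of_nonneg hb0] at g3
    have g4 : |tilt γ l n m - 1| ≤ 3 * ε + (Real.exp (b * (A - m + 1)) - 1) ^ 2 / ε +
        2 * ((b * ((m : ℝ) - A)) ^ 2 / ε) := by linarith
    refine (mul_le_mul_of_nonneg_left g4 (h.nonneg m)).trans_eq ?_
    ring
  have hsum : Summable fun m => p m * |tilt γ l n m - 1| :=
    Summable.of_nonneg_of_le (fun m => mul_nonneg (h.nonneg m) (abs_nonneg _)) hpt hbound.summable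
  refine ⟨hsum, (hasSum_le hpt hsum.hasSum hbound).trans ?_⟩
  rw [mul_one, add_assoc, ← add_div]
  refine add_le_add (by linarith) (div_le_div_of_nonneg_right ?_ hε.le)
  linarith

end SpatialPartitions

namespace SpatialPartitions
open scoped Topology

/-! ### Sums `∑ j ^ p e ^ (-j u)` -/

/-- The sum `∑_{j ≥ 1} j ^ p e ^ (-j u)`. -/
noncomputable def polyExpSum (p u : ℝ) : ℝ := ∑' j : ℕ, (j : ℝ) ^ p * Real.exp (-(j * u))

lemma hasSum_integral_Ioc_natCast {f : ℝ → ℝ} (hf : IntegrableOn f (Set.Ioi 0)) :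
    HasSum (fun n : ℕ => ∫ t in Set.Ioc (n : ℝ) (n + 1), f t) (∫ t in Set.Ioi 0, f t) := by
  have hU : ⋃ n : ℕ, Set.Ioc (n : ℝ) (n + 1) = Set.Ioi 0 := by
    ext t
    simp only [Set.mem_iUnion, Set.mem_Ioc, Set.mem_Ioi]
    constructor
    · rintro ⟨n, hn, -⟩
      exact lt_of_le_of_lt (Nat.cast_nonneg n) hn
    · intro ht
      have h1 : 0 < ⌈t⌉₊ := Nat.ceil_pos.2 ht
      refine ⟨⌈t⌉₊ - 1, ?_, ?_⟩
      · rw [← Nat.lt_ceil]; omega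
      · have h2 := Nat.le_ceil t
        have h3 : ((⌈t⌉₊ - 1 : ℕ) : ℝ) + 1 = ⌈t⌉₊ := by
          exact_mod_cast Nat.sub_add_cancel h1
        rwa [h3]
  rw [← hU] at hf ⊢
  refine hasSum_integral_iUnion (fun _ => measurableSet_Ioc) (fun i j hij => ?_) hf
  rw [Function.onFun, Set.disjoint_left]
  rintro t ⟨h1, h2⟩ ⟨h3, h4⟩
  have h5 : (i : ℝ) < j + 1 := h1.trans_le h4
  have h6 : (j : ℝ) < i + 1 := h3.trans_le h2
  have : i < j + 1 := by exact_mod_cast h5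
  have : j < i + 1 := by exact_mod_cast h6
  omega

section PolyExp

variable {p u : ℝ} 

lemma integrableOn_rpow_mul_exp (hp : 0 < p) (hu : 0 < u) :
    IntegrableOn (fun t : ℝ => t ^ p * Real.exp (-(t * u))) (Set.Ioi 0) := by
  have := integrableOn_rpow_mul_exp_neg_mul_rpow (p := 1) (s := p) (b := u)
    (by linarith) one_pos hu
  refine this.congr_fun (fun t _ => ?_) measurableSet_Ioi
  simp only [Real.rpow_one]
  rw [neg_mul, mul_comm u]

lemma integral_rpow_mul_exp (hp : 0 < p) (hu : 0 < u) :
    ∫ t in Set.Ioi (0 : ℝ), t ^ p * Real.exp (-(t * u)) =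
      Real.Gamma (p + 1) * u ^ (-(p + 1)) := by
  have := Real.integral_rpow_mul_exp_neg_mul_Ioi (a := p + 1) (by linarith) hu
  rw [add_sub_cancel_right, one_div, Real.inv_rpow hu.le, ← Real.rpow_neg hu.le] at this
  rw [mul_comm, ← this]
  simp_rw [mul_comm u]

/-- The integrand is not monotone, so its two factors are compared separately. The exponential one
costs `e ^ u`, harmless as `u → 0`. -/
lemma mul_exp_le_integral_Ioc (hp : 0 < p) (hu : 0 < u) (n : ℕ) :
    (n : ℝ) ^ p * Real.exp (-(n * u)) ≤
      Real.exp u * ∫ t in Set.Ioc (n : ℝ) (n + 1), t ^ p * Real.exp (-(t * u)) := by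
  have hint : IntegrableOn (fun t : ℝ => t ^ p * Real.exp (-(t * u))) (Set.Ioc (n : ℝ) (n + 1)) :=
    (integrableOn_rpow_mul_exp hp hu).mono_set fun t ht => lt_of_le_of_lt (Nat.cast_nonneg n) ht.1
  have h := setIntegral_mono_on (μ := volume)
    (f := fun _ => (n : ℝ) ^ p * Real.exp (-(n * u)) * Real.exp (-u))
    (integrableOn_const (by simp)) hint measurableSet_Ioc fun t ht => by
      rw [mul_assoc, ← Real.exp_add]
      have : (n : ℝ) ≤ t := ht.1.le
      refine mul_le_mul (Real.rpow_le_rpow (by positivity) this hp.le)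
        (Real.exp_le_exp.2 ?_) (Real.exp_nonneg _) (by have : (0:ℝ) ≤ n := by positivity
                                                       exact Real.rpow_nonneg (by linarith) _)
      nlinarith [ht.2]
  simp only [setIntegral_const, smul_eq_mul] at h
  rw [Real.volume_real_Ioc_of_le (by linarith), add_sub_cancel_left, one_mul] at h
  rw [← inv_mul_le_iff₀ (Real.exp_pos u), ← Real.exp_neg, mul_comm]
  exact h

lemma integral_Ioc_le_mul_exp (hp : 0 < p) (hu : 0 < u) (n : ℕ) :
    ∫ t in Set.Ioc (n : ℝ) (n + 1), t ^ p * Real.exp (-(t * u)) ≤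
      Real.exp u * (((n + 1 : ℕ) : ℝ) ^ p * Real.exp (-((n + 1 : ℕ) * u))) := by
  have hint : IntegrableOn (fun t : ℝ => t ^ p * Real.exp (-(t * u))) (Set.Ioc (n : ℝ) (n + 1)) :=
    (integrableOn_rpow_mul_exp hp hu).mono_set fun t ht => lt_of_le_of_lt (Nat.cast_nonneg n) ht.1
  have h := setIntegral_mono_on (μ := volume)
    (g := fun _ => Real.exp u * (((n + 1 : ℕ) : ℝ) ^ p * Real.exp (-((n + 1 : ℕ) * u)))) hint
    (integrableOn_const (by simp)) measurableSet_Ioc fun t ht => by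
      rw [mul_left_comm, ← Real.exp_add]
      have h0 : (0 : ℝ) < t := lt_of_le_of_lt (Nat.cast_nonneg n) ht.1
      push_cast
      refine mul_le_mul (Real.rpow_le_rpow h0.le ht.2 hp.le)
        (Real.exp_le_exp.2 ?_) (Real.exp_nonneg _) (by positivity)
      nlinarith [ht.1]
  simp only [setIntegral_const, smul_eq_mul] at h
  rwa [Real.volume_real_Ioc_of_le (by linarith), add_sub_cancel_left, one_mul] at h

lemma summable_polyExp (hp : 0 < p) (hu : 0 < u) :
    Summable fun j : ℕ => (j : ℝ) ^ p * Real.exp (-(j * u)) :=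
  Summable.of_nonneg_of_le (fun j => by positivity) (mul_exp_le_integral_Ioc hp hu)
    ((hasSum_integral_Ioc_natCast (integrableOn_rpow_mul_exp hp hu)).summable.mul_left _)

lemma polyExpSum_nonneg : 0 ≤ polyExpSum p u := tsum_nonneg fun j => by positivity

lemma polyExpSum_le (hp : 0 < p) (hu : 0 < u) :
    polyExpSum p u ≤ Real.exp u * (Real.Gamma (p + 1) * u ^ (-(p + 1))) := by
  rw [← integral_rpow_mul_exp hp hu]
  exact hasSum_le (mul_exp_le_integral_Ioc hp hu) (summable_polyExp hp hu).hasSum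
    ((hasSum_integral_Ioc_natCast (integrableOn_rpow_mul_exp hp hu)).mul_left _)

lemma le_polyExpSum (hp : 0 < p) (hu : 0 < u) :
    Real.Gamma (p + 1) * u ^ (-(p + 1)) ≤ Real.exp u * polyExpSum p u := by
  rw [← integral_rpow_mul_exp hp hu]
  have hs := summable_polyExp hp hu
  have h1 : polyExpSum p u = ∑' n : ℕ, ((n + 1 : ℕ) : ℝ) ^ p * Real.exp (-((n + 1 : ℕ) * u)) := by
    rw [polyExpSum, hs.tsum_eq_zero_add]
    simp [Real.zero_rpow hp.ne']
  rw [h1]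
  exact hasSum_le (integral_Ioc_le_mul_exp hp hu)
    (hasSum_integral_Ioc_natCast (integrableOn_rpow_mul_exp hp hu))
    (((summable_nat_add_iff 1).2 hs).hasSum.mul_left _)

/-- Removes the factor `e ^ u`, so that one bound serves all sites. For `j ≥ 1` one has `e ^ (-j u)
≤ e ^ (-u / 2) e ^ (-j u / 2)`, and `e ^ (-u / 2)` cancels the factor of `polyExpSum_le` at `u / 2`.
-/
lemma polyExpSum_le_of_pos (hp : 0 < p) (hu : 0 < u) :
    polyExpSum p u ≤ 2 ^ (p + 1) * Real.Gamma (p + 1) * u ^ (-(p + 1)) := by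
  have hu2 : 0 < u / 2 := by linarith
  have h1 : polyExpSum p u ≤ Real.exp (-(u / 2)) * polyExpSum p (u / 2) := by
    rw [polyExpSum, polyExpSum, ← tsum_mul_left]
    refine (summable_polyExp hp hu).tsum_le_tsum (fun j => ?_)
      ((summable_polyExp hp hu2).mul_left _)
    rw [mul_left_comm, ← Real.exp_add]
    rcases Nat.eq_zero_or_pos j with rfl | hj
    · simp [Real.zero_rpow hp.ne']
    · refine mul_le_mul_of_nonneg_left (Real.exp_le_exp.2 ?_) (by positivity)
      have : (1 : ℝ) ≤ j := by exact_mod_cast hj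
      nlinarith
  refine h1.trans ((mul_le_mul_of_nonneg_left (polyExpSum_le hp hu2)
    (Real.exp_nonneg _)).trans_eq ?_)
  rw [← mul_assoc, ← Real.exp_add, neg_add_cancel, Real.exp_zero, one_mul, div_eq_mul_inv,
    Real.mul_rpow hu.le (by norm_num), Real.inv_rpow (by norm_num),
    Real.rpow_neg (by norm_num : (0:ℝ) ≤ 2), inv_inv]
  ring

lemma tendsto_mul_polyExpSum (hp : 0 < p) :
    Tendsto (fun u => u ^ (p + 1) * polyExpSum p u) (𝓝[>] 0) (𝓝 (Real.Gamma (p + 1))) := by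
  have hlow : Tendsto (fun u : ℝ => Real.exp (-u) * Real.Gamma (p + 1)) (𝓝[>] 0)
      (𝓝 (Real.Gamma (p + 1))) := by
    have : Continuous fun u : ℝ => Real.exp (-u) * Real.Gamma (p + 1) := by fun_prop
    have h := (this.tendsto 0).mono_left (nhdsWithin_le_nhds (s := Set.Ioi 0))
    simpa using h
  have hupp : Tendsto (fun u : ℝ => Real.exp u * Real.Gamma (p + 1)) (𝓝[>] 0)
      (𝓝 (Real.Gamma (p + 1))) := by
    have : Continuous fun u : ℝ => Real.exp u * Real.Gamma (p + 1) := by fun_prop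
    have h := (this.tendsto 0).mono_left (nhdsWithin_le_nhds (s := Set.Ioi 0))
    simpa using h
  refine tendsto_of_tendsto_of_tendsto_of_le_of_le' hlow hupp ?_ ?_ <;>
    filter_upwards [self_mem_nhdsWithin] with u hu
  · have hu : 0 < u := hu
    have h := le_polyExpSum hp hu
    rw [Real.rpow_neg hu.le, ← div_eq_mul_inv, div_le_iff₀ (by positivity)] at h
    rw [Real.exp_neg, inv_mul_le_iff₀ (Real.exp_pos _)]
    linarith
  · have hu : 0 < u := hu
    have h := polyExpSum_le hp hu
    rw [Real.rpow_neg hu.le, ← div_eq_mul_inv, mul_div_assoc', le_div_iff₀ (by positivity)] at h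
    linarith

end PolyExp

/-! ### Sums over the lattice -/

/-- The Euclidean norm of a lattice site. -/
noncomputable abbrev Site.len {d : ℕ} (x : Site d) : ℝ := ‖x.toSpace‖

lemma Site.one_le_len {d : ℕ} {x : Site d} (hx : x ≠ 0) : 1 ≤ x.len := by
  obtain ⟨i, hi⟩ := Function.ne_iff.1 hx
  have h1 : |(x i : ℝ)| ≤ x.len := by
    have := PiLp.norm_apply_le (p := 2) x.toSpace i
    rw [Real.norm_eq_abs] at this
    exact this
  refine le_trans ?_ h1
  have : (1 : ℤ) ≤ |x i| := Int.one_le_abs hi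
  exact_mod_cast this

/-- The half-open unit cube with lower corner `x`. -/
def Site.cube {d : ℕ} (x : Site d) : Set (EuclideanSpace ℝ (Fin d)) :=
  WithLp.ofLp ⁻¹' (Set.univ.pi fun i => Set.Ico (x i : ℝ) (x i + 1))

lemma Site.measurableSet_cube {d : ℕ} (x : Site d) : MeasurableSet x.cube :=
  (PiLp.volume_preserving_ofLp (Fin d)).measurable
    (MeasurableSet.univ_pi fun _ => measurableSet_Ico)

lemma Site.volume_cube {d : ℕ} (x : Site d) : volume x.cube = 1 := by
  rw [Site.cube, (PiLp.volume_preserving_ofLp (Fin d)).measure_preimage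
    (MeasurableSet.univ_pi fun _ => measurableSet_Ico).nullMeasurableSet, Real.volume_pi_Ico]
  simp

lemma Site.mem_cube {d : ℕ} {x : Site d} {y : EuclideanSpace ℝ (Fin d)} :
    y ∈ x.cube ↔ x = fun i => ⌊y i⌋ := by
  rw [Site.cube, Set.mem_preimage, Set.mem_univ_pi, funext_iff]
  refine forall_congr' fun i => ?_
  rw [eq_comm, Int.floor_eq_iff, Set.mem_Ico]

lemma Site.iUnion_cube (d : ℕ) : ⋃ x : Site d, x.cube = Set.univ :=
  Set.eq_univ_of_forall fun _ => Set.mem_iUnion.2 ⟨_, Site.mem_cube.2 rfl⟩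

lemma Site.norm_sub_le_of_mem_cube {d : ℕ} {x : Site d} {y : EuclideanSpace ℝ (Fin d)}
    (hy : y ∈ x.cube) : ‖y‖ - Real.sqrt d ≤ x.len := by
  have h1 : ‖y - x.toSpace‖ ≤ Real.sqrt d := by
    rw [EuclideanSpace.norm_eq]
    refine Real.sqrt_le_sqrt ?_
    have h2 : ∀ i : Fin d, ‖(y - x.toSpace) i‖ ^ 2 ≤ 1 := by
      intro i
      have h3 : (x i : ℝ) ≤ y i ∧ y i < x i + 1 := by
        have := hy
        rw [Site.cube, Set.mem_preimage, Set.mem_univ_pi] at this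
        exact this i
      have h4 : (y - x.toSpace) i = y i - x i := rfl
      rw [h4, Real.norm_eq_abs, sq_abs]
      nlinarith [h3.1, h3.2]
    calc _ ≤ ∑ _i : Fin d, (1 : ℝ) := Finset.sum_le_sum fun i _ => h2 i
      _ = d := by simp
  have := norm_sub_norm_le y x.toSpace
  linarith

/-- Comparison of the sum of a radially decreasing function over the lattice with an integral. -/
lemma tsum_site_le_lintegral {d : ℕ} {g : ℝ → ℝ≥0∞} (hg : Antitone g) :
    ∑' x : Site d, g x.len ≤ ∫⁻ y : EuclideanSpace ℝ (Fin d), g (‖y‖ - Real.sqrt d) := by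
  rw [← setLIntegral_univ, ← Site.iUnion_cube,
    lintegral_iUnion Site.measurableSet_cube (fun x x' h => Set.disjoint_left.2 fun y hy hy' =>
      h ((Site.mem_cube.1 hy).trans (Site.mem_cube.1 hy').symm))]
  refine ENNReal.tsum_le_tsum fun x => ?_
  calc g x.len = ∫⁻ _ in x.cube, g x.len := by simp [Site.volume_cube]
    _ ≤ _ := setLIntegral_mono' x.measurableSet_cube fun y hy =>
      hg (Site.norm_sub_le_of_mem_cube hy)

/-- The sum of `‖x‖ ^ (-q)` over the lattice converges for `q > d`. -/
lemma summable_len_rpow {d : ℕ} {q : ℝ} (hq : (d : ℝ) < q) :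
    Summable fun x : {x : Site d // x ≠ 0} => x.1.len ^ (-q) := by
  set c : ℝ := 1 + Real.sqrt d with hc
  have hc1 : 1 ≤ c := by rw [hc]; linarith [Real.sqrt_nonneg (d : ℝ)]
  have hq0 : 0 < q := lt_of_le_of_lt (Nat.cast_nonneg d) hq
  -- With `c = 1 + √d`, evaluating `g` at `‖y‖ - √d` gives exactly `(1 + ‖y‖) ^ (-q)`. The
  -- truncation makes `g` antitone on all of `ℝ`. On sites, `c + ‖x‖ ≤ (c + 1) ‖x‖`.
  set g : ℝ → ℝ≥0∞ := fun r => ENNReal.ofReal ((c + max r (-Real.sqrt d)) ^ (-q)) with hgdef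
  have hpos : ∀ r : ℝ, 1 ≤ c + max r (-Real.sqrt d) := fun r => by
    have := le_max_right r (-Real.sqrt d)
    rw [hc]; linarith
  have hg : Antitone g := fun r r' h => ENNReal.ofReal_le_ofReal
    (Real.rpow_le_rpow_of_nonpos (by linarith [hpos r])
      (by have := max_le_max_right (-Real.sqrt d) h
          linarith) (by linarith))
  have h1 : ∑' x : Site d, g x.len < ∞ := by
    refine (tsum_site_le_lintegral hg).trans_lt ?_
    have h2 := finite_integral_one_add_norm (E := EuclideanSpace ℝ (Fin d)) (μ := volume) (r := q)
      (by simpa using hq)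
    refine lt_of_eq_of_lt (lintegral_congr fun y => ?_) h2
    have h0 := norm_nonneg y
    simp only [hgdef]
    rw [max_eq_left (by linarith), hc]
    congr 2
    ring
  have h3 : Summable fun x : Site d => (g x.len).toReal := ENNReal.summable_toReal h1.ne
  refine Summable.of_nonneg_of_le (fun x => by positivity) (fun x => ?_)
    ((h3.comp_injective (i := fun x : {x : Site d // x ≠ 0} => x.1)
      Subtype.val_injective).mul_left ((c + 1) ^ q))
  have hx := Site.one_le_len x.2
  simp only [Function.comp, hgdef]
  rw [ENNReal.toReal_ofReal (Real.rpow_nonneg (by linarith [hpos x.1.len]) _),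
    max_eq_left (by linarith [Real.sqrt_nonneg (d : ℝ)]), Real.rpow_neg (by linarith),
    Real.rpow_neg (by linarith), ← div_eq_mul_inv, inv_eq_one_div,
    div_le_div_iff₀ (by positivity) (by positivity), one_mul,
    ← Real.mul_rpow (by linarith) (by linarith)]
  exact Real.rpow_le_rpow (by linarith) (by nlinarith) hq0.le

end SpatialPartitions

namespace SpatialPartitions
open scoped Topology

/-! ### Boltzmann sums over the sites of a power trap -/

/-- Raise `u / r ≤ e ^ (u / r)` to the power `r`. -/
lemma exp_neg_le_rpow {u r : ℝ} (hu : 0 < u) (hr : 0 < r) :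
    Real.exp (-u) ≤ r ^ r * u ^ (-r) := by
  have h1 : u / r ≤ Real.exp (u / r) := by linarith [Real.add_one_le_exp (u / r)]
  have h2 := Real.rpow_le_rpow (by positivity) h1 hr.le
  rw [← Real.exp_mul, div_mul_cancel₀ _ hr.ne', Real.div_rpow hu.le hr.le,
    div_le_iff₀ (by positivity)] at h2
  rw [Real.exp_neg, Real.rpow_neg hu.le, ← div_eq_mul_inv, le_div_iff₀ (by positivity),
    inv_mul_le_iff₀ (Real.exp_pos _)]
  exact h2

/-- The sum `∑_{x ≠ 0} exp (-a ‖x‖ ^ δ)`. -/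
noncomputable def trapSum (d : ℕ) (δ a : ℝ) : ℝ :=
  ∑' x : {x : Site d // x ≠ 0}, Real.exp (-(a * x.1.len ^ δ))

variable {d : ℕ} {δ : ℝ}

lemma Site.len_pos {x : Site d} (hx : x ≠ 0) : 0 < x.len := zero_lt_one.trans_le (one_le_len hx)

lemma trapSum_nonneg (a : ℝ) : 0 ≤ trapSum d δ a := tsum_nonneg fun _ => Real.exp_nonneg _

lemma exp_neg_trap_le {r : ℝ} (hr : 0 < r) {a : ℝ} (ha : 0 < a) (x : {x : Site d // x ≠ 0}) :
    Real.exp (-(a * x.1.len ^ δ)) ≤ r ^ r * a ^ (-r) * x.1.len ^ (-(δ * r)) := by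
  have hx := Site.len_pos x.2
  refine (exp_neg_le_rpow (by positivity) hr).trans_eq ?_
  rw [Real.mul_rpow ha.le (by positivity), ← Real.rpow_mul hx.le, mul_neg, mul_assoc]

lemma summable_trapSum (hδ : 0 < δ) {a : ℝ} (ha : 0 < a) :
    Summable fun x : {x : Site d // x ≠ 0} => Real.exp (-(a * x.1.len ^ δ)) := by
  have hq : (d : ℝ) < δ * (d / δ + 1) := by
    rw [mul_add, mul_div_cancel₀ _ hδ.ne']; linarith
  exact Summable.of_nonneg_of_le (fun _ => Real.exp_nonneg _)
    (exp_neg_trap_le (r := d / δ + 1) (by positivity) ha) ((summable_len_rpow hq).mul_left _)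

lemma trapSum_le_rpow (hδ : 0 < δ) {r : ℝ} (hr : 0 < r) (hdr : (d : ℝ) < δ * r) {a : ℝ}
    (ha : 0 < a) : trapSum d δ a ≤
      r ^ r * (∑' x : {x : Site d // x ≠ 0}, x.1.len ^ (-(δ * r))) * a ^ (-r) := by
  refine ((summable_trapSum hδ ha).tsum_le_tsum (exp_neg_trap_le hr ha)
    ((summable_len_rpow hdr).mul_left _)).trans_eq ?_
  rw [tsum_mul_left]
  ring

/-- The integral of `exp (-(‖y‖ - b)₊ ^ δ)`. -/
noncomputable def trapIntegral (d : ℕ) (δ b : ℝ) : ℝ≥0∞ :=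
  ∫⁻ y : EuclideanSpace ℝ (Fin d), ENNReal.ofReal (Real.exp (-(max (‖y‖ - b) 0) ^ δ))

/-- An integrable majorant uniform in the shift `b ≤ b₀`, for dominated convergence as `b → 0`: `1 +
t ≤ (1 + b₀)(1 + s)`, and `(1 + s) ^ q e ^ (-s ^ δ)` is bounded separately on `s ≤ 1` and `s > 1`.
-/
lemma exp_neg_shift_le (hδ : 0 < δ) {q b b₀ : ℝ} (hq : 0 < q) (hb0 : 0 ≤ b) (hb : b ≤ b₀) {t : ℝ}
    (ht : 0 ≤ t) : Real.exp (-(max (t - b) 0) ^ δ) ≤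
      (1 + b₀) ^ q * 2 ^ q * (1 + (q / δ) ^ (q / δ)) * (1 + t) ^ (-q) := by
  set s := max (t - b) 0 with hs
  have hs0 : 0 ≤ s := le_max_right _ _
  have h1 : 1 + t ≤ (1 + b₀) * (1 + s) := by
    have : t - b ≤ s := le_max_left _ _
    nlinarith
  have h2 : (1 + s) ^ q * Real.exp (-s ^ δ) ≤ 2 ^ q * (1 + (q / δ) ^ (q / δ)) := by
    have hpos : 0 ≤ (q / δ) ^ (q / δ) := by positivity
    rcases le_or_gt s 1 with h | h
    · have e1 : (1 + s) ^ q ≤ 2 ^ q := Real.rpow_le_rpow (by linarith) (by linarith) hq.le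
      have e2 : Real.exp (-s ^ δ) ≤ 1 + (q / δ) ^ (q / δ) := by
        have : Real.exp (-s ^ δ) ≤ 1 := Real.exp_le_one_iff.2 (neg_nonpos.2 (by positivity))
        linarith
      exact mul_le_mul e1 e2 (Real.exp_nonneg _) (by positivity)
    · have hs1 : 0 < s := by linarith
      have e1 : (1 + s) ^ q ≤ (2 * s) ^ q := Real.rpow_le_rpow (by linarith) (by linarith) hq.le
      rw [Real.mul_rpow (by norm_num) hs0] at e1
      have e2 := exp_neg_le_rpow (u := s ^ δ) (by positivity) (div_pos hq hδ)
      rw [← Real.rpow_mul hs0, mul_neg, mul_div_cancel₀ _ hδ.ne'] at e2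
      calc _ ≤ 2 ^ q * s ^ q * ((q / δ) ^ (q / δ) * s ^ (-q)) :=
            mul_le_mul e1 e2 (Real.exp_nonneg _) (by positivity)
        _ = 2 ^ q * (q / δ) ^ (q / δ) * (s ^ q * s ^ (-q)) := by ring
        _ = 2 ^ q * (q / δ) ^ (q / δ) := by
            rw [← Real.rpow_add hs1, add_neg_cancel, Real.rpow_zero, mul_one]
        _ ≤ _ := mul_le_mul_of_nonneg_left (by linarith) (by positivity)
  have h3 : (1 + t) ^ q ≤ (1 + b₀) ^ q * (1 + s) ^ q := by
    rw [← Real.mul_rpow (by linarith) (by linarith)]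
    exact Real.rpow_le_rpow (by linarith) h1 hq.le
  have ht1 : 0 < 1 + t := by linarith
  rw [Real.rpow_neg ht1.le, ← div_eq_mul_inv, le_div_iff₀ (by positivity)]
  calc _ ≤ Real.exp (-s ^ δ) * ((1 + b₀) ^ q * (1 + s) ^ q) :=
        mul_le_mul_of_nonneg_left h3 (Real.exp_nonneg _)
    _ = (1 + b₀) ^ q * ((1 + s) ^ q * Real.exp (-s ^ δ)) := by ring
    _ ≤ (1 + b₀) ^ q * (2 ^ q * (1 + (q / δ) ^ (q / δ))) :=
        mul_le_mul_of_nonneg_left h2 (Real.rpow_nonneg (by linarith) _)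
    _ = _ := by ring

lemma lintegral_bound_lt_top (C : ℝ) : ∫⁻ y : EuclideanSpace ℝ (Fin d),
    ENNReal.ofReal (C * (1 + ‖y‖) ^ (-((d : ℝ) + 1))) < ∞ := by
  rcases le_or_gt 0 C with hC | hC
  · simp_rw [ENNReal.ofReal_mul hC]
    rw [lintegral_const_mul' _ _ ENNReal.ofReal_ne_top]
    exact ENNReal.mul_lt_top ENNReal.ofReal_lt_top (finite_integral_one_add_norm (by simp))
  · refine lt_of_eq_of_lt ?_ ENNReal.zero_lt_top
    rw [← lintegral_zero (μ := (volume : Measure (EuclideanSpace ℝ (Fin d))))]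
    refine lintegral_congr fun y => ENNReal.ofReal_eq_zero.2 ?_
    exact mul_nonpos_of_nonpos_of_nonneg hC.le (by positivity)

lemma trapIntegral_lt_top (hδ : 0 < δ) {b : ℝ} (hb : 0 ≤ b) : trapIntegral d δ b < ∞ :=
  (lintegral_mono fun y => ENNReal.ofReal_le_ofReal
    (exp_neg_shift_le hδ (q := d + 1) (by positivity) hb le_rfl (norm_nonneg y))).trans_lt
    (lintegral_bound_lt_top _)

lemma trapIntegral_mono (hδ : 0 < δ) {b b' : ℝ} (h : b ≤ b') :
    trapIntegral d δ b ≤ trapIntegral d δ b' := by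
  refine lintegral_mono fun y => ENNReal.ofReal_le_ofReal (Real.exp_le_exp.2 (neg_le_neg ?_))
  exact Real.rpow_le_rpow (le_max_right _ _) (max_le_max_right _ (by linarith)) hδ.le

lemma tendsto_trapIntegral (hδ : 0 < δ) :
    Tendsto (trapIntegral d δ) (𝓝[>] 0) (𝓝 (trapIntegral d δ 0)) := by
  have hcont : ∀ y : EuclideanSpace ℝ (Fin d), Continuous fun b : ℝ =>
      ENNReal.ofReal (Real.exp (-(max (‖y‖ - b) 0) ^ δ)) := fun y =>
    ENNReal.continuous_ofReal.comp (Real.continuous_exp.comp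
      (((continuous_const.sub continuous_id).max continuous_const).rpow_const
        fun _ => Or.inr hδ.le).neg)
  refine tendsto_lintegral_filter_of_dominated_convergence (fun y => ENNReal.ofReal
    ((1 + 1) ^ ((d : ℝ) + 1) * 2 ^ ((d : ℝ) + 1) *
      (1 + (((d : ℝ) + 1) / δ) ^ (((d : ℝ) + 1) / δ)) * (1 + ‖y‖) ^ (-((d : ℝ) + 1))))
    (Eventually.of_forall fun b => ?_) ?_ (lintegral_bound_lt_top _).ne
    (Eventually.of_forall fun y => ?_)
  · exact ENNReal.measurable_ofReal.comp (by fun_prop)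
  · filter_upwards [Ioc_mem_nhdsGT zero_lt_one] with b hb
    exact Eventually.of_forall fun y => ENNReal.ofReal_le_ofReal
      (exp_neg_shift_le hδ (by positivity) hb.1.le hb.2 (norm_nonneg y))
  · exact ((hcont y).tendsto 0).mono_left nhdsWithin_le_nhds

lemma lintegral_comp_smul {F : EuclideanSpace ℝ (Fin d) → ℝ≥0∞} (hF : Measurable F) {c : ℝ}
    (hc : 0 < c) : ∫⁻ y, F (c • y) = ENNReal.ofReal ((c ^ d)⁻¹) * ∫⁻ y, F y := by
  have h := Measure.map_addHaar_smul (volume : Measure (EuclideanSpace ℝ (Fin d))) hc.ne'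
  rw [finrank_euclideanSpace_fin, abs_of_pos (by positivity)] at h
  rw [← lintegral_map hF (measurable_const_smul c), h, lintegral_smul_measure, smul_eq_mul]

lemma rpow_pow_inv {a : ℝ} (ha : 0 < a) :
    (((a ^ (1 / δ)) ^ d)⁻¹ : ℝ) = a ^ (-((d : ℝ) / δ)) := by
  rw [← Real.rpow_natCast, ← Real.rpow_mul ha.le, Real.rpow_neg ha.le]
  congr 2
  ring

lemma lintegral_exp_trap (hδ : 0 < δ) {a : ℝ} (ha : 0 < a) (b : ℝ) :
    ∫⁻ y : EuclideanSpace ℝ (Fin d), ENNReal.ofReal (Real.exp (-(a * max (‖y‖ - b) 0 ^ δ))) =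
      ENNReal.ofReal (a ^ (-((d : ℝ) / δ))) * trapIntegral d δ (a ^ (1 / δ) * b) := by
  have hc : 0 < a ^ (1 / δ) := Real.rpow_pos_of_pos ha _
  have h := lintegral_comp_smul (d := d) (F := fun y =>
    ENNReal.ofReal (Real.exp (-(max (‖y‖ - a ^ (1 / δ) * b) 0) ^ δ)))
    (ENNReal.measurable_ofReal.comp (by fun_prop)) hc
  rw [rpow_pow_inv ha] at h
  rw [trapIntegral, ← h]
  refine lintegral_congr fun y => ?_
  congr 3
  rw [norm_smul, Real.norm_of_nonneg hc.le, ← mul_sub]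
  nth_rewrite 2 [← mul_zero (a ^ (1 / δ))]
  rw [← mul_max_of_nonneg _ _ hc.le, Real.mul_rpow hc.le (le_max_right _ _), ← Real.rpow_mul ha.le,
    one_div_mul_cancel hδ.ne', Real.rpow_one]

lemma ofReal_trapSum_le (hδ : 0 < δ) {a : ℝ} (ha : 0 < a) :
    ENNReal.ofReal (trapSum d δ a) ≤
      ENNReal.ofReal (a ^ (-((d : ℝ) / δ))) * trapIntegral d δ (a ^ (1 / δ) * Real.sqrt d) := by
  set g : ℝ → ℝ≥0∞ := fun r => ENNReal.ofReal (Real.exp (-(a * max r 0 ^ δ))) with hg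
  have hanti : Antitone g := fun r r' h => ENNReal.ofReal_le_ofReal (Real.exp_le_exp.2
    (neg_le_neg (mul_le_mul_of_nonneg_left (Real.rpow_le_rpow (le_max_right _ _)
      (max_le_max_right _ h) hδ.le) ha.le)))
  rw [trapSum, ENNReal.ofReal_tsum_of_nonneg (fun _ => Real.exp_nonneg _) (summable_trapSum hδ ha),
    ← lintegral_exp_trap hδ ha]
  calc _ = ∑' x : {x : Site d // x ≠ 0}, g x.1.len :=
        tsum_congr fun x => by simp only [hg]; rw [max_eq_left (norm_nonneg _)]
    _ ≤ ∑' x : Site d, g x.len :=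
        ENNReal.tsum_comp_le_tsum_of_injective Subtype.val_injective _
    _ ≤ _ := tsum_site_le_lintegral hanti

/-- A one-sided Riemann-sum comparison: after scaling by `a ^ (1 / δ)`, the discretization survives
only as the shift `a ^ (1 / δ) √d`, which vanishes as `a → 0`. -/
lemma mul_trapSum_le (hδ : 0 < δ) {a : ℝ} (ha : 0 < a) :
    a ^ ((d : ℝ) / δ) * trapSum d δ a ≤ (trapIntegral d δ (a ^ (1 / δ) * Real.sqrt d)).toReal := by
  have hfin := trapIntegral_lt_top (d := d) hδ (b := a ^ (1 / δ) * Real.sqrt d) (by positivity)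
  have h := ENNReal.toReal_mono (ENNReal.mul_ne_top ENNReal.ofReal_ne_top hfin.ne)
    (ofReal_trapSum_le (d := d) hδ ha)
  rw [ENNReal.toReal_ofReal (trapSum_nonneg a), ENNReal.toReal_mul,
    ENNReal.toReal_ofReal (by positivity), Real.rpow_neg ha.le, inv_mul_eq_div,
    le_div_iff₀ (by positivity)] at h
  linarith

/-- For `a ≤ 1` use the integral comparison with its largest shift; for `a ≥ 1` the lattice sum
decays faster than `a ^ (-d / δ)`, because the origin is excluded. -/
lemma exists_mul_trapSum_le (hδ : 0 < δ) :
    ∃ C : ℝ, ∀ a : ℝ, 0 < a → a ^ ((d : ℝ) / δ) * trapSum d δ a ≤ C := by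
  set r : ℝ := d / δ + 1 with hr
  have hr0 : 0 < r := by positivity
  have hdr : (d : ℝ) < δ * r := by rw [hr, mul_add, mul_div_cancel₀ _ hδ.ne']; linarith
  set K := r ^ r * (∑' x : {x : Site d // x ≠ 0}, x.1.len ^ (-(δ * r))) with hK
  have hK0 : 0 ≤ K := mul_nonneg (by positivity) (tsum_nonneg fun x => by positivity)
  refine ⟨max K (trapIntegral d δ (Real.sqrt d)).toReal, fun a ha => ?_⟩
  rcases le_total a 1 with h | h
  · refine (mul_trapSum_le hδ ha).trans (le_trans ?_ (le_max_right _ _))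
    refine ENNReal.toReal_mono (trapIntegral_lt_top hδ (Real.sqrt_nonneg _)).ne
      (trapIntegral_mono hδ ?_)
    exact mul_le_of_le_one_left (Real.sqrt_nonneg _) (Real.rpow_le_one ha.le h (by positivity))
  · refine le_trans ?_ (le_max_left _ _)
    calc _ ≤ a ^ ((d : ℝ) / δ) * (K * a ^ (-r)) :=
          mul_le_mul_of_nonneg_left (trapSum_le_rpow hδ hr0 hdr ha) (by positivity)
      _ = K * a ^ ((d : ℝ) / δ + -r) := by rw [Real.rpow_add ha]; ring
      _ ≤ K * 1 := mul_le_mul_of_nonneg_left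
          (Real.rpow_le_one_of_one_le_of_nonpos h (by rw [hr]; linarith)) hK0
      _ = K := mul_one K

/-- The mean number of particles away from the origin does not exceed the critical density in the
limit. -/
lemma eventually_mul_tsum_trapSum_lt (hδ : 0 < δ) {γ ρ : ℝ} (hγ : 0 < γ)
    (hκ : 1 + γ < (d : ℝ) / δ)
    (hρ : ∑' j : ℕ, (j : ℝ) ^ (γ - d / δ) * (trapIntegral d δ 0).toReal < ρ) :
    ∀ᶠ v in 𝓝[>] (0 : ℝ),
      v ^ ((d : ℝ) / δ) * ∑' j : ℕ, (j : ℝ) ^ γ * trapSum d δ (j * v) < ρ := by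
  obtain ⟨C, hC⟩ := exists_mul_trapSum_le (d := d) hδ
  set κ : ℝ := d / δ with hκdef
  have hC0 : 0 ≤ C := (mul_nonneg (by positivity) (trapSum_nonneg 1)).trans (hC 1 one_pos)
  have hsj : Summable fun j : ℕ => (j : ℝ) ^ (γ - κ) := Real.summable_nat_rpow.2 (by linarith)
  -- A majorant of `v ^ κ j ^ γ trapSum (j v) = j ^ (γ - κ) (j v) ^ κ trapSum (j v)`. The minimum
  -- with `C` gives domination, summable since `κ > 1 + γ`; the other entry has the right limit as
  -- `v → 0`.
  set f : ℝ → ℕ → ℝ := fun v j =>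
    (j : ℝ) ^ (γ - κ) * min C (trapIntegral d δ ((j * v) ^ (1 / δ) * Real.sqrt d)).toReal with hf
  have hf0 : ∀ v j, 0 ≤ f v j := fun v j =>
    mul_nonneg (by positivity) (le_min hC0 ENNReal.toReal_nonneg)
  have hfC : ∀ v j, f v j ≤ (j : ℝ) ^ (γ - κ) * C := fun v j =>
    mul_le_mul_of_nonneg_left (min_le_left _ _) (by positivity)
  have hlim : Tendsto (fun v => ∑' j, f v j) (𝓝[>] 0)
      (𝓝 (∑' j : ℕ, (j : ℝ) ^ (γ - κ) * min C (trapIntegral d δ 0).toReal)) := by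
    refine tendsto_tsum_of_dominated_convergence (hsj.mul_right C) (fun j => ?_)
      (Eventually.of_forall fun v j => by rw [Real.norm_of_nonneg (hf0 v j)]; exact hfC v j)
    rcases Nat.eq_zero_or_pos j with rfl | hj
    · have h0 : γ - κ ≠ 0 := by linarith
      simp [hf, Real.zero_rpow h0]
    · refine Tendsto.const_mul _ (Tendsto.min tendsto_const_nhds ?_)
      refine (ENNReal.tendsto_toReal (trapIntegral_lt_top hδ le_rfl).ne).comp ?_
      rcases Nat.eq_zero_or_pos d with hd | hd
      · have : ∀ v : ℝ, ((j * v) ^ (1 / δ) * Real.sqrt d : ℝ) = 0 := fun v => by simp [hd]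
        simp only [this]
        exact tendsto_const_nhds
      · refine (tendsto_trapIntegral hδ).comp ?_
        refine tendsto_nhdsWithin_iff.2 ⟨?_, ?_⟩
        · have hcont : Continuous fun v : ℝ => (j * v) ^ (1 / δ) * Real.sqrt d :=
            ((continuous_const.mul continuous_id).rpow_const
              fun _ => Or.inr (by positivity)).mul continuous_const
          have := (hcont.tendsto 0).mono_left (nhdsWithin_le_nhds (s := Set.Ioi 0))
          simpa [Real.zero_rpow (inv_pos.2 hδ).ne'] using this
        · filter_upwards [self_mem_nhdsWithin] with v hv
          have hv : 0 < v := hv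
          have : (0 : ℝ) < j := by exact_mod_cast hj
          have : (0 : ℝ) < d := by exact_mod_cast hd
          exact Set.mem_Ioi.2 (by positivity)
  have hle : ∑' j : ℕ, (j : ℝ) ^ (γ - κ) * min C (trapIntegral d δ 0).toReal < ρ := by
    refine lt_of_le_of_lt ?_ hρ
    exact (hsj.mul_right _).tsum_le_tsum
      (fun j => mul_le_mul_of_nonneg_left (min_le_right _ _) (by positivity)) (hsj.mul_right _)
  filter_upwards [hlim.eventually_lt_const hle, self_mem_nhdsWithin] with v hv hv0
  have hv0 : 0 < v := hv0
  refine lt_of_le_of_lt ?_ hv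
  have hterm : ∀ j : ℕ, v ^ κ * ((j : ℝ) ^ γ * trapSum d δ (j * v)) ≤ f v j := by
    intro j
    rcases Nat.eq_zero_or_pos j with rfl | hj
    · simpa [Real.zero_rpow hγ.ne'] using hf0 v 0
    · have hj0 : (0 : ℝ) < j := by exact_mod_cast hj
      have hjv : 0 < j * v := by positivity
      have e : v ^ κ * ((j : ℝ) ^ γ * trapSum d δ (j * v)) =
          (j : ℝ) ^ (γ - κ) * ((j * v) ^ κ * trapSum d δ (j * v)) := by
        rw [Real.mul_rpow hj0.le hv0.le, Real.rpow_sub hj0]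
        field_simp
      rw [e]
      exact mul_le_mul_of_nonneg_left (le_min (hC _ hjv) (mul_trapSum_le hδ hjv)) (by positivity)
  rw [← tsum_mul_left]
  have hsf : Summable (f v) := Summable.of_nonneg_of_le (hf0 v) (hfC v) (hsj.mul_right C)
  refine Summable.tsum_le_tsum hterm (Summable.of_nonneg_of_le (fun j => ?_) hterm hsf) hsf
  exact mul_nonneg (by positivity) (mul_nonneg (by positivity) (trapSum_nonneg _))

section Moments

variable {p : ℝ}

lemma summable_polyExpSum_trap (hp : 0 < p) (hdp : (d : ℝ) < δ * (p + 1)) {v : ℝ} (hv : 0 < v) :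
    Summable fun x : {x : Site d // x ≠ 0} => polyExpSum p (v * x.1.len ^ δ) := by
  refine Summable.of_nonneg_of_le (fun _ => polyExpSum_nonneg) (fun x => ?_)
    ((summable_len_rpow hdp).mul_left (2 ^ (p + 1) * Real.Gamma (p + 1) * v ^ (-(p + 1))))
  have hx := Site.len_pos x.2
  refine (polyExpSum_le_of_pos hp (by positivity)).trans_eq ?_
  rw [Real.mul_rpow hv.le (by positivity), ← Real.rpow_mul hx.le]
  ring_nf

/-- Exchanging the sums over the particle sizes and over the sites. -/
lemma hasSum_rpow_mul_trapSum (hp : 0 < p) (hdp : (d : ℝ) < δ * (p + 1)) {v : ℝ} (hv : 0 < v) :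
    HasSum (fun j : ℕ => (j : ℝ) ^ p * trapSum d δ (j * v))
      (∑' x : {x : Site d // x ≠ 0}, polyExpSum p (v * x.1.len ^ δ)) := by
  obtain ⟨F, hF⟩ : ∃ F : {x : Site d // x ≠ 0} × ℕ → ℝ, ∀ x j,
      F (x, j) = (j : ℝ) ^ p * Real.exp (-(j * (v * x.1.len ^ δ))) := 
    ⟨fun q => (q.2 : ℝ) ^ p * Real.exp (-(q.2 * (v * q.1.1.len ^ δ))), fun _ _ => rfl⟩
  have hsum : Summable F := by
    refine (summable_prod_of_nonneg fun q => ?_).2 ⟨fun x => ?_, ?_⟩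
    · rw [Pi.zero_apply, ← Prod.mk.eta (p := q), hF]
      positivity
    · have hx := Site.len_pos x.2
      have hu : 0 < v * x.1.len ^ δ := mul_pos hv (Real.rpow_pos_of_pos hx _)
      simp_rw [hF]
      exact summable_polyExp hp hu
    · simp_rw [hF]
      exact summable_polyExpSum_trap hp hdp hv
  have hsw : Summable fun q : ℕ × {x : Site d // x ≠ 0} => F q.swap :=
    hsum.comp_injective Prod.swap_injective
  have h1 := hsw.hasSum.prod_fiberwise fun j => (hsw.prod_factor j).hasSum
  have h2 : ∑' q : ℕ × {x : Site d // x ≠ 0}, F q.swap =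
      ∑' x : {x : Site d // x ≠ 0}, polyExpSum p (v * x.1.len ^ δ) := by
    have h3 := (Equiv.prodComm ℕ {x : Site d // x ≠ 0}).tsum_eq F
    simp only [Equiv.prodComm_apply] at h3
    rw [h3, hsum.tsum_prod]
    simp_rw [hF]
    rfl
  rw [h2] at h1
  refine (congrArg (fun f => HasSum f _) (funext fun j => ?_)).mpr h1
  simp only [hF, Prod.swap_prod_mk]
  rw [trapSum, tsum_mul_left]
  simp_rw [mul_assoc]

/-- Dominated convergence site by site. Since `d < δ (p + 1)`, fixed sites near the origin dominate
and no continuum limit occurs; hence a lattice sum in the limiting variance. -/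
lemma tendsto_mul_tsum_polyExpSum (hp : 0 < p) (hdp : (d : ℝ) < δ * (p + 1)) :
    Tendsto (fun v : ℝ => v ^ (p + 1) *
        ∑' x : {x : Site d // x ≠ 0}, polyExpSum p (v * x.1.len ^ δ)) (𝓝[>] 0)
      (𝓝 (Real.Gamma (p + 1) * ∑' x : {x : Site d // x ≠ 0}, x.1.len ^ (-(δ * (p + 1))))) := by
  simp_rw [← tsum_mul_left]
  have hrw : ∀ v : ℝ, 0 < v → ∀ x : {x : Site d // x ≠ 0},
      v ^ (p + 1) * polyExpSum p (v * x.1.len ^ δ) = (v * x.1.len ^ δ) ^ (p + 1) *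
        polyExpSum p (v * x.1.len ^ δ) * x.1.len ^ (-(δ * (p + 1))) := by
    intro v hv x
    have hx := Site.len_pos x.2
    rw [Real.mul_rpow hv.le (by positivity), ← Real.rpow_mul hx.le, Real.rpow_neg hx.le]
    field_simp
  refine tendsto_tsum_of_dominated_convergence
    ((summable_len_rpow hdp).mul_left (2 ^ (p + 1) * Real.Gamma (p + 1))) (fun x => ?_) ?_
  · have hx := Site.len_pos x.2
    have hxδ : 0 < x.1.len ^ δ := by positivity
    have h1 : Tendsto (fun v : ℝ => v * x.1.len ^ δ) (𝓝[>] 0) (𝓝[>] 0) := by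
      refine tendsto_nhdsWithin_iff.2 ⟨?_, ?_⟩
      · have hcont : Continuous fun v : ℝ => v * x.1.len ^ δ := by fun_prop
        have := (hcont.tendsto 0).mono_left (nhdsWithin_le_nhds (s := Set.Ioi 0))
        simpa using this
      · filter_upwards [self_mem_nhdsWithin] with v hv
        exact mul_pos hv hxδ
    refine (((tendsto_mul_polyExpSum hp).comp h1).mul_const
      (x.1.len ^ (-(δ * (p + 1))))).congr' ?_
    filter_upwards [self_mem_nhdsWithin] with v hv
    exact (hrw v hv x).symm
  · filter_upwards [self_mem_nhdsWithin] with v hv x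
    have hv : 0 < v := hv
    have hx := Site.len_pos x.2
    have hu : 0 < v * x.1.len ^ δ := by positivity
    rw [Real.norm_of_nonneg (mul_nonneg (by positivity) polyExpSum_nonneg), hrw v hv x]
    refine mul_le_mul_of_nonneg_right ?_ (by positivity)
    have := polyExpSum_le_of_pos hp hu
    rw [Real.rpow_neg hu.le, ← div_eq_mul_inv, le_div_iff₀ (by positivity)] at this
    linarith

end Moments

end SpatialPartitions

namespace SpatialPartitions
open Finset

/-! ### Products of Poisson weights -/

section PoissonWeight

variable {I : Type*}

/-- The unnormalized Poisson weight `∏_i λ_i ^ {r_i} / r_i!` of a configuration `r`. -/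
noncomputable def poissonWeight (lam : I → ℝ≥0∞) (r : I →₀ ℕ) : ℝ≥0∞ :=
  r.prod fun i k => lam i ^ k * (k.factorial : ℝ≥0∞)⁻¹

lemma poissonWeight_zero (lam : I → ℝ≥0∞) : poissonWeight lam 0 = 1 := Finsupp.prod_zero_index

lemma poissonWeight_eq_prod (lam : I → ℝ≥0∞) {r : I →₀ ℕ} {s : Finset I} (hs : r.support ⊆ s) :
    poissonWeight lam r = ∏ i ∈ s, lam i ^ r i * ((r i).factorial : ℝ≥0∞)⁻¹ :=
  Finsupp.prod_of_support_subset _ hs _ (by simp)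

lemma poissonWeight_add_single (lam : I → ℝ≥0∞) (r : I →₀ ℕ) (i : I) :
    ((r i + 1 : ℕ) : ℝ≥0∞) * poissonWeight lam (r + Finsupp.single i 1) =
      lam i * poissonWeight lam r := by
  classical
  set s := insert i r.support with hs
  have hi : i ∈ s := mem_insert_self _ _
  have h1 : (r + Finsupp.single i 1).support ⊆ s := by
    refine Finsupp.support_add.trans (union_subset (subset_insert _ _) ?_)
    exact Finsupp.support_single_subset.trans (by simpa using hi)
  rw [poissonWeight_eq_prod lam h1, poissonWeight_eq_prod lam (subset_insert i r.support),
    ← mul_prod_erase s _ hi, ← mul_prod_erase s _ hi]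
  have h2 : ∏ j ∈ s.erase i, lam j ^ (r + Finsupp.single i 1 : I →₀ ℕ) j *
      (((r + Finsupp.single i 1 : I →₀ ℕ) j).factorial : ℝ≥0∞)⁻¹ =
      ∏ j ∈ s.erase i, lam j ^ r j * ((r j).factorial : ℝ≥0∞)⁻¹ := by
    refine prod_congr rfl fun j hj => ?_
    rw [Finsupp.add_apply, Finsupp.single_eq_of_ne (ne_of_mem_erase hj), add_zero]
  rw [h2, Finsupp.add_apply, Finsupp.single_eq_same, Nat.factorial_succ, Nat.cast_mul,
    ENNReal.mul_inv (Or.inl (by simp)) (Or.inl (by simp)), pow_succ]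
  have h3 : ((r i + 1 : ℕ) : ℝ≥0∞) * ((r i + 1 : ℕ) : ℝ≥0∞)⁻¹ = 1 :=
    ENNReal.mul_inv_cancel (by simp) (by simp)
  calc _ = (((r i + 1 : ℕ) : ℝ≥0∞) * ((r i + 1 : ℕ) : ℝ≥0∞)⁻¹) * (lam i * (lam i ^ r i *
        ((r i).factorial : ℝ≥0∞)⁻¹ *
        ∏ j ∈ s.erase i, lam j ^ r j * ((r j).factorial : ℝ≥0∞)⁻¹)) := by ring
    _ = _ := by rw [h3, one_mul]

/-- The Mecke equation for a product of Poisson weights. -/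
lemma tsum_mul_poissonWeight (lam : I → ℝ≥0∞) (i : I) (F : (I →₀ ℕ) → ℝ≥0∞) :
    ∑' r : I →₀ ℕ, (r i : ℝ≥0∞) * (poissonWeight lam r * F r) =
      lam i * ∑' r : I →₀ ℕ, poissonWeight lam r * F (r + Finsupp.single i 1) := by
  have hinj : Function.Injective fun r : I →₀ ℕ => r + Finsupp.single i 1 :=
    add_left_injective _
  rw [← hinj.tsum_eq, ← ENNReal.tsum_mul_left]
  · refine tsum_congr fun r => ?_
    rw [← mul_assoc, ← mul_assoc, ← poissonWeight_add_single]
    simp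
  -- Configurations with `r i = 0` contribute nothing, so every relevant one arises by adding an
  -- element `i`.
  · intro r hr
    have h0 : r i ≠ 0 := fun h => hr (by simp [h])
    refine ⟨r - Finsupp.single i 1, ?_⟩
    refine tsub_add_cancel_of_le ?_
    rw [Finsupp.single_le_iff]
    omega

/-- The size of a configuration whose elements `i` have size `s i`. -/
noncomputable def configSize (s : I → ℕ) (r : I →₀ ℕ) : ℕ := r.sum fun i k => k * s i

lemma configSize_add_single (s : I → ℕ) (r : I →₀ ℕ) (i : I) :
    configSize s (r + Finsupp.single i 1) = configSize s r + s i := by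
  classical
  rw [configSize, Finsupp.sum_add_index' (by simp) (by intros; ring), configSize,
    Finsupp.sum_single_index (by simp), one_mul]

lemma natCast_configSize (s : I → ℕ) (r : I →₀ ℕ) :
    (configSize s r : ℝ≥0∞) = ∑' i, (s i : ℝ≥0∞) * r i := by
  rw [tsum_eq_sum (s := r.support) (fun i hi => by simp [Finsupp.notMem_support_iff.1 hi]),
    configSize, Finsupp.sum]
  push_cast
  exact sum_congr rfl fun i _ => mul_comm _ _

open Classical in
/-- The total weight of the configurations with sizes `m` and `k`. -/
noncomputable def jointWeight (lam : I → ℝ≥0∞) (s t : I → ℕ) (m k : ℕ) : ℝ≥0∞ :=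
  ∑' r : I →₀ ℕ, poissonWeight lam r * if configSize s r = m ∧ configSize t r = k then 1 else 0

open Classical in
/-- The rate of the elements of size `j`. -/
noncomputable def sizeRate (lam : I → ℝ≥0∞) (s : I → ℕ) (j : ℕ) : ℝ≥0∞ :=
  ∑' i, if s i = j then (j : ℝ≥0∞) * lam i else 0

lemma jointWeight_comm (lam : I → ℝ≥0∞) (s t : I → ℕ) (m k : ℕ) :
    jointWeight lam s t m k = jointWeight lam t s k m := by
  simp only [jointWeight, and_comm]

/-- Write `m = ∑ s_i r_i` and apply the Mecke equation to each `r_i`. Removing one element with `s_i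
≠ 0` lowers the first size by `s_i` and leaves the second alone, as then `t_i = 0`. Grouping by
`s_i` gives a renewal recursion in `m` with `k` fixed. -/
lemma mul_jointWeight {lam : I → ℝ≥0∞} {s t : I → ℕ} (hst : ∀ i, s i = 0 ∨ t i = 0) (m k : ℕ) :
    (m : ℝ≥0∞) * jointWeight lam s t m k =
      ∑ q ∈ antidiagonal m, sizeRate lam s q.1 * jointWeight lam s t q.2 k := by
  classical
  calc (m : ℝ≥0∞) * jointWeight lam s t m k
      = ∑' r : I →₀ ℕ, ∑' i, (s i : ℝ≥0∞) * ((r i : ℝ≥0∞) * (poissonWeight lam r *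
          if configSize s r = m ∧ configSize t r = k then 1 else 0)) := by
        rw [jointWeight, ← ENNReal.tsum_mul_left]
        refine tsum_congr fun r => ?_
        simp_rw [← mul_assoc]
        rw [ENNReal.tsum_mul_right, ENNReal.tsum_mul_right, ← natCast_configSize]
        by_cases h : configSize s r = m ∧ configSize t r = k
        · rw [h.1]
        · simp [h]
    _ = ∑' i, (s i : ℝ≥0∞) * (lam i * ∑' r : I →₀ ℕ, poissonWeight lam r *
          if configSize s r + s i = m ∧ configSize t r + t i = k then 1 else 0) := by
        rw [ENNReal.tsum_comm]
        refine tsum_congr fun i => ?_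
        rw [ENNReal.tsum_mul_left, tsum_mul_poissonWeight lam i fun r =>
          if configSize s r = m ∧ configSize t r = k then 1 else 0]
        simp_rw [configSize_add_single]
    _ = ∑' i, ∑ q ∈ antidiagonal m, (if s i = q.1 then (q.1 : ℝ≥0∞) * lam i else 0) *
          jointWeight lam s t q.2 k := by
        refine tsum_congr fun i => ?_
        by_cases hi : s i ≤ m
        · rw [sum_eq_single (s i, m - s i)]
          · simp only [if_true]
            rw [mul_assoc]
            rcases Nat.eq_zero_or_pos (s i) with h0 | h0
            · simp [h0]
            · have ht : t i = 0 := (hst i).resolve_left h0.ne'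
              rw [jointWeight, ht]
              have : ∀ r : I →₀ ℕ, (configSize s r + s i = m ∧ configSize t r + 0 = k) ↔
                  (configSize s r = m - s i ∧ configSize t r = k) := fun r => by
                constructor <;> rintro ⟨h1, h2⟩ <;> constructor <;> omega
              simp_rw [this]
          · intro q hq hne
            rw [if_neg, zero_mul]
            intro h
            refine hne (Prod.ext h.symm ?_)
            have := HasAntidiagonal.mem_antidiagonal.1 hq
            simp only
            omega
          · intro h
            exact absurd (HasAntidiagonal.mem_antidiagonal.2 (by simp only; omega)) h
        · have h1 : ∀ r : I →₀ ℕ, ¬ (configSize s r + s i = m ∧ configSize t r + t i = k) := by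
            rintro r ⟨h, -⟩
            omega
          simp only [h1, if_false, mul_zero, tsum_zero]
          refine (sum_eq_zero fun q hq => ?_).symm
          have := HasAntidiagonal.mem_antidiagonal.1 hq
          rw [if_neg (by omega), zero_mul]
    _ = _ := by
        rw [Summable.tsum_finsetSum fun _ _ => ENNReal.summable]
        refine sum_congr rfl fun q _ => ?_
        rw [ENNReal.tsum_mul_right, sizeRate]

lemma jointWeight_zero_zero {lam : I → ℝ≥0∞} {s t : I → ℕ} (hst : ∀ i, s i ≠ 0 ∨ t i ≠ 0) :
    jointWeight lam s t 0 0 = 1 := by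
  classical
  rw [jointWeight, tsum_eq_single 0]
  · simp [poissonWeight_zero, configSize]
  · intro r hr
    rw [if_neg, mul_zero]
    rintro ⟨h1, h2⟩
    obtain ⟨i, hi⟩ := Finsupp.ne_iff.1 hr
    rw [Finsupp.zero_apply] at hi
    rw [configSize, Finsupp.sum, sum_eq_zero_iff] at h1 h2
    have h3 := h1 i (Finsupp.mem_support_iff.2 hi)
    have h4 := h2 i (Finsupp.mem_support_iff.2 hi)
    rcases hst i with h | h
    · exact (Nat.mul_ne_zero hi h) h3
    · exact (Nat.mul_ne_zero hi h) h4

/-- The recursion in `m` reduces to `m = 0`; the recursion in `k` then reduces to `(0, 0)`, where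
only the empty configuration counts. Independence thus follows from the recursions alone. -/
lemma jointWeight_eq_mul {lam : I → ℝ≥0∞} {s t : I → ℕ} (hst : ∀ i, s i = 0 ∨ t i = 0)
    (hst' : ∀ i, s i ≠ 0 ∨ t i ≠ 0) {a b : ℕ → ℝ} (ha : ∀ j, 0 ≤ a j) (ha0 : a 0 = 0)
    (hb : ∀ j, 0 ≤ b j) (hb0 : b 0 = 0) (hsa : ∀ j, sizeRate lam s j = ENNReal.ofReal (a j))
    (htb : ∀ j, sizeRate lam t j = ENNReal.ofReal (b j)) (m k : ℕ) :
    jointWeight lam s t m k = ENNReal.ofReal (renewal a m) * ENNReal.ofReal (renewal b k) := by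
  have h1 := eq_mul_renewal ha ha0 (c := fun m => jointWeight lam s t m k)
    (fun m => by simp_rw [← hsa]; exact mul_jointWeight hst m k) m
  have h2 := eq_mul_renewal hb hb0 (c := fun k => jointWeight lam t s k 0)
    (fun k => by simp_rw [← htb]; exact mul_jointWeight (fun i => (hst i).symm) k 0) k
  rw [h1, jointWeight_comm, h2, jointWeight_zero_zero fun i => (hst' i).symm, one_mul, mul_comm]

end PoissonWeight

/-! ### Spatial partitions as configurations -/

section Config

variable {d n : ℕ}

lemma SpatialPartition.mult_zero (lam : SpatialPartition d n) (x : Site d) : lam.mult x 0 = 0 :=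
  Multiset.count_eq_zero.2 fun h => (lt_irrefl 0) ((lam.part x).parts_pos h)

lemma SpatialPartition.occ_le (lam : SpatialPartition d n) (x : Site d) : lam.occ x ≤ n := by
  refine le_trans ?_ lam.total.le
  rw [Finsupp.sum]
  by_cases hx : x ∈ lam.occ.support
  · exact single_le_sum (f := fun x => lam.occ x) (fun _ _ => Nat.zero_le _) hx
  · rw [Finsupp.notMem_support_iff.1 hx]; exact Nat.zero_le _

lemma SpatialPartition.occ_pos_of_mult {lam : SpatialPartition d n} {x : Site d} {j : ℕ}
    (h : lam.mult x j ≠ 0) : lam.occ x ≠ 0 ∧ j ≤ n := by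
  have hj : j ∈ (lam.part x).parts := Multiset.count_ne_zero.1 h
  have h1 : j ≤ lam.occ x := by
    have h2 := Multiset.le_sum_of_mem hj
    rwa [(lam.part x).parts_sum] at h2
  have h2 := (lam.part x).parts_pos hj
  exact ⟨by omega, h1.trans (lam.occ_le x)⟩

/-- The positive integers up to `n`. -/
def partSizes (n : ℕ) : Finset ℕ+ := (range n).map ⟨Nat.succPNat, Nat.succPNat_injective⟩

lemma mem_partSizes {j : ℕ+} : j ∈ partSizes n ↔ (j : ℕ) ≤ n := by
  rw [partSizes, Finset.mem_map]
  constructor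
  · rintro ⟨i, hi, rfl⟩
    simpa [Nat.succ_le_iff] using hi
  · intro h
    exact ⟨j.natPred, by have := j.natPred_add_one; rw [mem_range]; omega, by simp⟩

lemma prod_partSizes {M : Type*} [CommMonoid M] (f : ℕ → M) :
    ∏ j ∈ partSizes n, f j = ∏ j ∈ Icc 1 n, f j := by
  rw [partSizes, prod_map]
  have : Icc 1 n = Ico 1 (n + 1) := rfl
  rw [this, prod_Ico_eq_prod_range, Nat.add_sub_cancel]
  exact prod_congr rfl fun i _ => by simp [Nat.succPNat, add_comm]

lemma sum_partSizes {M : Type*} [AddCommMonoid M] (f : ℕ → M) :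
    ∑ j ∈ partSizes n, f j = ∑ j ∈ Icc 1 n, f j :=
  prod_partSizes (M := Multiplicative M) f

/-- The multiplicities of a spatial partition as a finitely supported configuration. -/
noncomputable def SpatialPartition.toConfig (lam : SpatialPartition d n) : Site d × ℕ+ →₀ ℕ :=
  Finsupp.onFinset (lam.occ.support ×ˢ partSizes n) (fun p => lam.mult p.1 p.2) fun p hp => by
    have := SpatialPartition.occ_pos_of_mult hp
    exact mem_product.2 ⟨Finsupp.mem_support_iff.2 this.1, mem_partSizes.2 this.2⟩

lemma SpatialPartition.toConfig_apply (lam : SpatialPartition d n) (p : Site d × ℕ+) :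
    lam.toConfig p = lam.mult p.1 p.2 := rfl

lemma SpatialPartition.toConfig_support (lam : SpatialPartition d n) :
    lam.toConfig.support ⊆ lam.occ.support ×ˢ partSizes n := Finsupp.support_onFinset_subset

lemma SpatialPartition.sum_mult (lam : SpatialPartition d n) (x : Site d) :
    ∑ j ∈ partSizes n, lam.mult x j * (j : ℕ) = lam.occ x := by
  rw [sum_partSizes fun j => lam.mult x j * j, ← (lam.part x).parts_sum,
    sum_multiset_count]
  refine (sum_subset ?_ ?_).symm
  · intro j hj
    have hj' : j ∈ (lam.part x).parts := Multiset.mem_toFinset.1 hj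
    have := SpatialPartition.occ_pos_of_mult (lam := lam) (x := x) (j := j)
      (Multiset.count_ne_zero.2 hj')
    exact mem_Icc.2 ⟨(lam.part x).parts_pos hj', this.2⟩
  · intro j _ hj
    rw [SpatialPartition.mult,
      Multiset.count_eq_zero.2 fun h => hj (Multiset.mem_toFinset.2 h), zero_mul]

/-- The size of a part at the origin, and zero for the other parts. -/
def onSize (p : Site d × ℕ+) : ℕ := if p.1 = 0 then (p.2 : ℕ) else 0

/-- The size of a part away from the origin, and zero for the other parts. -/
def offSize (p : Site d × ℕ+) : ℕ := if p.1 = 0 then 0 else (p.2 : ℕ)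

lemma onSize_eq_zero_or (p : Site d × ℕ+) : offSize p = 0 ∨ onSize p = 0 := by
  rw [onSize, offSize]; split_ifs <;> simp

lemma onSize_ne_zero_or (p : Site d × ℕ+) : offSize p ≠ 0 ∨ onSize p ≠ 0 := by
  rw [onSize, offSize]; split_ifs <;> simp

lemma configSize_eq_sum {I : Type*} (s : I → ℕ) {r : I →₀ ℕ} {S : Finset I} (hs : r.support ⊆ S) :
    configSize s r = ∑ i ∈ S, r i * s i := Finsupp.sum_of_support_subset _ hs _ (by simp)

lemma SpatialPartition.configSize_onSize (lam : SpatialPartition d n) :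
    configSize onSize lam.toConfig = lam.occ 0 := by
  rw [configSize_eq_sum _ lam.toConfig_support, sum_product]
  have h : ∀ x : Site d, ∑ j ∈ partSizes n, lam.toConfig (x, j) * onSize (x, j) =
      if x = 0 then lam.occ x else 0 := by
    intro x
    rw [← lam.sum_mult x]
    simp only [toConfig_apply, onSize]
    split_ifs <;> simp
  simp_rw [h]
  rw [sum_ite_eq']
  split_ifs with h0
  · rfl
  · exact (Finsupp.notMem_support_iff.1 h0).symm

lemma SpatialPartition.configSize_add (lam : SpatialPartition d n) :
    configSize offSize lam.toConfig + configSize onSize lam.toConfig = n := by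
  rw [configSize_eq_sum _ lam.toConfig_support, configSize_eq_sum _ lam.toConfig_support,
    ← sum_add_distrib, sum_product]
  conv_rhs => rw [← lam.total, Finsupp.sum]
  refine sum_congr rfl fun x _ => ?_
  rw [← lam.sum_mult x]
  refine sum_congr rfl fun j _ => ?_
  rw [← mul_add, toConfig_apply, offSize, onSize]
  split_ifs <;> simp

lemma SpatialPartition.toConfig_injective :
    Function.Injective (SpatialPartition.toConfig (d := d) (n := n)) := by
  intro lam lam' h
  have hparts : ∀ x, (lam.part x).parts = (lam'.part x).parts := by
    intro x
    refine Multiset.ext.2 fun j => ?_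
    rcases Nat.eq_zero_or_pos j with rfl | hj
    · exact (lam.mult_zero x).trans (lam'.mult_zero x).symm
    · exact DFunLike.congr_fun h (x, ⟨j, hj⟩)
  obtain ⟨occ, part, total⟩ := lam
  obtain ⟨occ', part', total'⟩ := lam'
  have hocc : occ = occ' := by
    ext x
    rw [← (part x).parts_sum, ← (part' x).parts_sum]
    exact congrArg Multiset.sum (hparts x)
  subst hocc
  have : part = part' := funext fun x => Nat.Partition.ext (hparts x)
  subst this
  rfl

/-- The multiset of the parts of a configuration at a site. -/
noncomputable def configParts (r : Site d × ℕ+ →₀ ℕ) (x : Site d) : Multiset ℕ :=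
  ∑ p ∈ r.support, if p.1 = x then r p • {(p.2 : ℕ)} else 0

lemma count_configParts (r : Site d × ℕ+ →₀ ℕ) (x : Site d) (j : ℕ+) :
    (configParts r x).count (j : ℕ) = r (x, j) := by
  rw [configParts, Multiset.count_sum']
  rw [sum_eq_single (x, j)]
  · simp
  · rintro ⟨y, i⟩ _ hne
    simp only
    split_ifs with h
    · have : j ≠ i := fun hji => hne (by rw [h, hji])
      rw [Multiset.count_nsmul, Multiset.count_singleton,
        if_neg (fun h => this (PNat.coe_injective h)), mul_zero]
    · simp
  · intro h
    simp [Finsupp.notMem_support_iff.1 h]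

lemma pos_of_mem_configParts {r : Site d × ℕ+ →₀ ℕ} {x : Site d} {i : ℕ}
    (hi : i ∈ configParts r x) : 0 < i := by
  obtain ⟨p, _, hp⟩ := Multiset.mem_sum.1 hi
  split_ifs at hp
  · have := Multiset.mem_of_mem_nsmul hp
    rw [Multiset.mem_singleton.1 this]
    exact p.2.pos
  · simp at hp

lemma SpatialPartition.exists_toConfig_eq (r : Site d × ℕ+ →₀ ℕ)
    (hr : configSize offSize r + configSize onSize r = n) :
    ∃ lam : SpatialPartition d n, lam.toConfig = r := by
  classical
  set occ : Site d →₀ ℕ := Finsupp.onFinset (r.support.image Prod.fst)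
    (fun x => (configParts r x).sum) (fun x hx => by
      by_contra hmem
      refine hx ?_
      have : configParts r x = 0 := by
        rw [configParts]
        refine sum_eq_zero fun p hp => if_neg fun h => hmem ?_
        exact mem_image.2 ⟨p, hp, h⟩
      rw [this, Multiset.sum_zero]) with hocc
  -- Built with its own total; `configSize_add` identifies that total with `n` afterwards.
  let lam : SpatialPartition d (occ.sum fun _ k => k) :=
    { occ := occ
      part := fun x => ⟨configParts r x, pos_of_mem_configParts, rfl⟩
      total := rfl }
  have h1 : lam.toConfig = r := by
    ext p
    exact count_configParts r p.1 p.2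
  have h2 := lam.configSize_add
  rw [h1, hr] at h2
  clear_value lam
  subst h2
  exact ⟨lam, h1⟩

variable (V : EuclideanSpace ℝ (Fin d) → ℝ) (θ : ℕ → ℝ) (L : ℝ)

/-- The Poisson parameters of the multiplicities. -/
noncomputable def siteRate (p : Site d × ℕ+) : ℝ≥0∞ :=
  ENNReal.ofReal (θ p.2 / ((p.2 : ℕ) : ℝ) * Real.exp (-((p.2 : ℕ) : ℝ) * V (L⁻¹ • p.1.toSpace)))

lemma ofReal_weight (hθ : ∀ j, 0 ≤ θ j) (lam : SpatialPartition d n) :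
    ENNReal.ofReal (weight V θ L lam) = poissonWeight (siteRate V θ L) lam.toConfig := by
  have hnn : ∀ (x : Site d) (j : ℕ), 0 ≤ θ j / j * Real.exp (-(j : ℝ) * V (L⁻¹ • x.toSpace)) :=
    fun x j => mul_nonneg (div_nonneg (hθ j) (by positivity)) (Real.exp_nonneg _)
  rw [poissonWeight_eq_prod _ lam.toConfig_support, prod_product, weight,
    ENNReal.ofReal_prod_of_nonneg fun x _ => prod_nonneg fun j _ =>
      mul_nonneg (by positivity) (pow_nonneg (hnn x j) _)]
  refine prod_congr rfl fun x _ => ?_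
  rw [← prod_partSizes fun j => 1 / ((lam.mult x j).factorial : ℝ) *
      (θ j / j * Real.exp (-(j : ℝ) * V (L⁻¹ • x.toSpace))) ^ lam.mult x j,
    ENNReal.ofReal_prod_of_nonneg fun (j : ℕ+) _ =>
      mul_nonneg (by positivity) (pow_nonneg (hnn x (j : ℕ)) _)]
  refine prod_congr rfl fun j _ => ?_
  rw [ENNReal.ofReal_mul (by positivity), ENNReal.ofReal_pow (hnn x j), one_div,
    ENNReal.ofReal_inv_of_pos (by positivity), ENNReal.ofReal_natCast, mul_comm]
  rfl

/-- The total weight of the spatial partitions of `n` with given occupation number of the origin. -/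
lemma tsum_weight_mul (hθ : ∀ j, 0 ≤ θ j) (G : ℕ → ℝ≥0∞) :
    ∑' lam : SpatialPartition d n, ENNReal.ofReal (weight V θ L lam) * G (lam.occ 0) =
      ∑ q ∈ antidiagonal n, jointWeight (siteRate V θ L) offSize onSize q.1 q.2 * G q.2 := by
  classical
  set wt := poissonWeight (siteRate V θ L) with hwt
  calc _ = ∑' lam : SpatialPartition d n, (fun r => wt r *
          (if configSize offSize r + configSize onSize r = n then G (configSize onSize r) else 0))
          lam.toConfig := by
        refine tsum_congr fun lam => ?_
        simp only
        rw [if_pos lam.configSize_add, lam.configSize_onSize, ofReal_weight V θ L hθ]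
    _ = ∑' r : Site d × ℕ+ →₀ ℕ, wt r *
          (if configSize offSize r + configSize onSize r = n then G (configSize onSize r) else 0) := by
        refine SpatialPartition.toConfig_injective.tsum_eq (f := fun r => wt r *
          (if configSize offSize r + configSize onSize r = n then G (configSize onSize r) else 0))
          fun r hr => ?_
        refine SpatialPartition.exists_toConfig_eq r ?_
        by_contra h
        exact hr (by simp only; rw [if_neg h, mul_zero])
    _ = ∑' r : Site d × ℕ+ →₀ ℕ, ∑ q ∈ antidiagonal n, wt r *
          (if configSize offSize r = q.1 ∧ configSize onSize r = q.2 then 1 else 0) * G q.2 := by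
        refine tsum_congr fun r => ?_
        split_ifs with h
        · rw [sum_eq_single (configSize offSize r, configSize onSize r)]
          · simp
          · intro q _ hne
            rw [if_neg fun h => hne (Prod.ext h.1.symm h.2.symm), mul_zero, zero_mul]
          · intro hn
            exact absurd (HasAntidiagonal.mem_antidiagonal.2 h) hn
        · rw [mul_zero]
          refine (sum_eq_zero fun q hq => ?_).symm
          rw [if_neg, mul_zero, zero_mul]
          rintro ⟨h1, h2⟩
          exact h (by rw [h1, h2]; exact HasAntidiagonal.mem_antidiagonal.1 hq)
    _ = _ := by
        rw [Summable.tsum_finsetSum fun _ _ => ENNReal.summable]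
        refine sum_congr rfl fun q _ => ?_
        rw [ENNReal.tsum_mul_right, jointWeight]

lemma partitionFunction_eq (hθ : ∀ j, 0 ≤ θ j) :
    partitionFunction V θ L n =
      ∑ q ∈ antidiagonal n, jointWeight (siteRate V θ L) offSize onSize q.1 q.2 := by
  have := tsum_weight_mul (n := n) V θ L hθ fun _ => 1
  simpa [partitionFunction] using this

lemma isProbabilityMeasure_canonicalMeasure (h0 : partitionFunction V θ L n ≠ 0)
    (h1 : partitionFunction V θ L n ≠ ∞) : IsProbabilityMeasure (canonicalMeasure V θ L n) := by
  refine ⟨?_⟩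
  rw [canonicalMeasure, Measure.smul_apply, Measure.sum_apply _ MeasurableSet.univ]
  simp only [Measure.smul_apply, measure_univ, smul_eq_mul, mul_one]
  exact ENNReal.inv_mul_cancel h0 h1

/-- The law of the occupation number of the origin under the canonical measure. -/
lemma map_canonicalMeasure (hθ : ∀ j, 0 ≤ θ j) :
    (canonicalMeasure V θ L n).map (fun lam => lam.occ 0) =
      ∑ q ∈ antidiagonal n, ((partitionFunction V θ L n)⁻¹ *
        jointWeight (siteRate V θ L) offSize onSize q.1 q.2) • Measure.dirac q.2 := by
  ext s hs
  rw [Measure.map_apply (measurable_from_top) hs, canonicalMeasure, Measure.smul_apply,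
    Measure.sum_apply _ MeasurableSpace.measurableSet_top, Measure.coe_finsetSum, Finset.sum_apply]
  have h := tsum_weight_mul (n := n) V θ L hθ (s.indicator 1)
  simp only [Measure.smul_apply, smul_eq_mul, Measure.dirac_apply' _ hs]
  simp_rw [mul_assoc]
  rw [← mul_sum, ← h]
  congr 1
  refine tsum_congr fun lam => ?_
  rw [Measure.dirac_apply' _ MeasurableSpace.measurableSet_top]
  rfl

end Config

end SpatialPartitions

namespace SpatialPartitions
open scoped Topology

variable {d : ℕ} {δ γ : ℝ}

/-! ### The power trap -/

lemma powerTrap_smul {L : ℝ} (hL : 0 < L) (x : Site d) :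
    powerTrap d δ (L⁻¹ • x.toSpace) = L ^ (-δ) * x.len ^ δ := by
  rw [powerTrap, norm_smul, norm_inv, Real.norm_of_nonneg hL.le,
    Real.mul_rpow (by positivity) (norm_nonneg _), Real.inv_rpow hL.le, Real.rpow_neg hL.le]

/-- The rate of the particles of size `j` away from the origin. -/
noncomputable def offRate (d : ℕ) (δ γ v : ℝ) (j : ℕ) : ℝ := (j : ℝ) ^ γ * trapSum d δ (j * v)

lemma offRate_nonneg (v : ℝ) (j : ℕ) : 0 ≤ offRate d δ γ v j :=
  mul_nonneg (by positivity) (trapSum_nonneg _)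

lemma offRate_zero (hγ : 0 < γ) (v : ℝ) : offRate d δ γ v 0 = 0 := by
  simp [offRate, Real.zero_rpow hγ.ne']

lemma powerWeights_nonneg (j : ℕ) : 0 ≤ powerWeights γ j := by rw [powerWeights]; positivity

lemma natCast_mul_siteRate {L : ℝ} (p : Site d × ℕ+) :
    ((p.2 : ℕ) : ℝ≥0∞) * siteRate (powerTrap d δ) (powerWeights γ) L p =
      ENNReal.ofReal (((p.2 : ℕ) : ℝ) ^ γ *
        Real.exp (-((p.2 : ℕ) : ℝ) * powerTrap d δ (L⁻¹ • p.1.toSpace))) := by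
  have h0 : ((p.2 : ℕ) : ℝ) ≠ 0 := by exact_mod_cast p.2.ne_zero
  rw [siteRate, ← ENNReal.ofReal_natCast, ← ENNReal.ofReal_mul (by positivity), powerWeights,
    ← mul_assoc, mul_div_cancel₀ _ h0]

/-- The total rate of the particles of size `j` away from the origin. -/
lemma tsum_offSite_rate (hδ : 0 < δ) {L : ℝ} (hL : 0 < L) {j : ℕ} (hj : 0 < j) :
    ∑' x : {x : Site d // x ≠ 0}, ENNReal.ofReal ((j : ℝ) ^ γ *
        Real.exp (-(j : ℝ) * powerTrap d δ (L⁻¹ • x.1.toSpace))) =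
      ENNReal.ofReal (offRate d δ γ (L ^ (-δ)) j) := by
  have hj0 : (0 : ℝ) < j := by exact_mod_cast hj
  have hv : 0 < L ^ (-δ) := Real.rpow_pos_of_pos hL _
  rw [offRate, trapSum, ← tsum_mul_left, ENNReal.ofReal_tsum_of_nonneg
    (fun x => by positivity) ((summable_trapSum hδ (by positivity)).mul_left _)]
  refine tsum_congr fun x => ?_
  rw [powerTrap_smul hL]
  congr 3
  ring

lemma sizeRate_offSize (hδ : 0 < δ) (hγ : 0 < γ) {L : ℝ} (hL : 0 < L) (j : ℕ) :
    sizeRate (siteRate (powerTrap d δ) (powerWeights γ) L) offSize j =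
      ENNReal.ofReal (offRate d δ γ (L ^ (-δ)) j) := by
  classical
  rcases Nat.eq_zero_or_pos j with rfl | hj
  · simp [sizeRate, offRate_zero hγ]
  · rw [sizeRate, ENNReal.tsum_prod (f := fun x i => if offSize (x, i) = j then
      (j : ℝ≥0∞) * siteRate (powerTrap d δ) (powerWeights γ) L (x, i) else 0), ← tsum_offSite_rate hδ hL hj]
    have h1 := tsum_subtype {x : Site d | x ≠ 0} fun x => ENNReal.ofReal ((j : ℝ) ^ γ *
        Real.exp (-(j : ℝ) * powerTrap d δ (L⁻¹ • x.toSpace)))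
    refine Eq.trans ?_ h1.symm
    refine tsum_congr fun x => ?_
    by_cases hx : x = 0
    · simp [hx, offSize, hj.ne]
    · rw [Set.indicator_of_mem (by exact hx), tsum_eq_single (β := ℕ+) ⟨j, hj⟩]
      · simp only [offSize, if_neg hx, PNat.mk_coe, if_true]
        exact natCast_mul_siteRate (x, (⟨j, hj⟩ : ℕ+))
      · intro i hi
        refine if_neg ?_
        simp only [offSize, if_neg hx]
        exact fun h => hi (PNat.eq h)

/-- Since `V 0 = 0`, only `θ_j = j ^ γ` remains: the weights at the origin do not depend on `L`. -/
lemma sizeRate_onSize (hδ : 0 < δ) (hγ : 0 < γ) (L : ℝ) (j : ℕ) :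
    sizeRate (siteRate (powerTrap d δ) (powerWeights γ) L) onSize j =
      ENNReal.ofReal ((j : ℝ) ^ γ) := by
  classical
  rcases Nat.eq_zero_or_pos j with rfl | hj
  · simp [sizeRate, Real.zero_rpow hγ.ne']
  · rw [sizeRate, tsum_eq_single (((0 : Site d), (⟨j, hj⟩ : ℕ+)) : Site d × ℕ+)]
    · have h := natCast_mul_siteRate (δ := δ) (γ := γ) (L := L) ((0 : Site d), (⟨j, hj⟩ : ℕ+))
      have h0 : powerTrap d δ (L⁻¹ • Site.toSpace (0 : Site d)) = 0 := by
        have : Site.toSpace (0 : Site d) = 0 := by ext i; simp [Site.toSpace]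
        rw [this, smul_zero, powerTrap, norm_zero, Real.zero_rpow hδ.ne']
      simp only [h0, PNat.mk_coe, mul_zero, Real.exp_zero, mul_one] at h
      simpa [onSize] using h
    · rintro ⟨x, i⟩ hne
      refine if_neg ?_
      simp only [onSize]
      split_ifs with hx
      · exact fun h => hne (Prod.ext hx (PNat.eq h))
      · exact hj.ne

/-- The total weight of the spatial partitions with `k` particles at the origin and `m` particles
elsewhere factorizes. -/
lemma jointWeight_power (hδ : 0 < δ) (hγ : 0 < γ) {L : ℝ} (hL : 0 < L) (m k : ℕ) :
    jointWeight (siteRate (powerTrap d δ) (powerWeights γ) L) offSize onSize m k =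
      ENNReal.ofReal (renewal (offRate d δ γ (L ^ (-δ))) m) * ENNReal.ofReal (stretched γ k) :=
  jointWeight_eq_mul onSize_eq_zero_or onSize_ne_zero_or (offRate_nonneg _)
    (offRate_zero hγ _) (fun j => by positivity) (by simp [Real.zero_rpow hγ.ne'])
    (sizeRate_offSize hδ hγ hL) (sizeRate_onSize hδ hγ L) m k

/-! ### The critical fugacity and the critical density -/

lemma lintegral_exp_powerTrap (hδ : 0 < δ) (j : ℕ+) :
    ∫⁻ x : EuclideanSpace ℝ (Fin d),
        ENNReal.ofReal (Real.exp (-((j : ℕ) : ℝ) * powerTrap d δ x)) =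
      ENNReal.ofReal (((j : ℕ) : ℝ) ^ (-((d : ℝ) / δ))) * trapIntegral d δ 0 := by
  have h := lintegral_exp_trap (d := d) hδ (a := ((j : ℕ) : ℝ)) (by exact_mod_cast j.pos) 0
  rw [mul_zero] at h
  rw [← h]
  refine lintegral_congr fun y => ?_
  rw [sub_zero, max_eq_left (norm_nonneg y), neg_mul, powerTrap]

lemma trapIntegral_zero_pos : 0 < trapIntegral d δ 0 := by
  rw [trapIntegral, lintegral_pos_iff_support (by fun_prop)]
  have : Function.support (fun y : EuclideanSpace ℝ (Fin d) =>
      ENNReal.ofReal (Real.exp (-(max (‖y‖ - 0) 0) ^ δ))) = Set.univ := by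
    refine Set.eq_univ_of_forall fun y => ?_
    rw [Function.mem_support]
    exact (ENNReal.ofReal_pos.2 (Real.exp_pos _)).ne'
  rw [this]
  exact Measure.measure_univ_pos.2 (NeZero.ne _)

/-- Scaling the integral makes the coefficients a constant times `j ^ (γ - d / δ)`: the radius of
convergence is `1`, and the series converges there when `d / δ > 1 + γ`. -/
lemma density_power_eq (hδ : 0 < δ) (z : ℝ≥0∞) :
    density (powerTrap d δ) (powerWeights γ) z = ∑' j : ℕ+,
      ENNReal.ofReal (((j : ℕ) : ℝ) ^ (γ - d / δ) * (trapIntegral d δ 0).toReal) *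
        z ^ (j : ℕ) := by
  refine tsum_congr fun j => ?_
  have hj : (0 : ℝ) < ((j : ℕ) : ℝ) := by exact_mod_cast j.pos
  rw [lintegral_exp_powerTrap hδ, ENNReal.ofReal_mul (by positivity),
    ENNReal.ofReal_toReal (trapIntegral_lt_top hδ le_rfl).ne, sub_eq_add_neg, Real.rpow_add hj,
    ENNReal.ofReal_mul (by positivity), powerWeights]
  ring

lemma summable_density (hκ : 1 + γ < (d : ℝ) / δ) :
    Summable fun j : ℕ => (j : ℝ) ^ (γ - d / δ) * (trapIntegral d δ 0).toReal :=
  (Real.summable_nat_rpow.2 (by linarith)).mul_right _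

lemma density_power_one (hδ : 0 < δ) (hκ : 1 + γ < (d : ℝ) / δ) :
    density (powerTrap d δ) (powerWeights γ) 1 =
      ENNReal.ofReal (∑' j : ℕ, (j : ℝ) ^ (γ - d / δ) * (trapIntegral d δ 0).toReal) := by
  rw [density_power_eq hδ]
  simp_rw [one_pow, mul_one]
  have hs := summable_density (d := d) hκ
  have hI : 0 ≤ (trapIntegral d δ 0).toReal := ENNReal.toReal_nonneg
  generalize (trapIntegral d δ 0).toReal = I at hs hI ⊢
  have h0 : γ - d / δ ≠ 0 := by linarith
  have hnn : ∀ j : ℕ, 0 ≤ (j : ℝ) ^ (γ - d / δ) * I := fun j => by positivity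
  rw [tsum_pnat_eq_tsum_succ (f := fun j : ℕ => ENNReal.ofReal ((j : ℝ) ^ (γ - d / δ) * I)),
    hs.tsum_eq_zero_add, Nat.cast_zero, Real.zero_rpow h0, zero_mul, zero_add,
    ENNReal.ofReal_tsum_of_nonneg (fun j => hnn (j + 1)) ((summable_nat_add_iff 1).2 hs)]

lemma density_power_of_one_lt (hδ : 0 < δ) {z : ℝ≥0∞} (hz : 1 < z) :
    density (powerTrap d δ) (powerWeights γ) z = ∞ := by
  by_contra hne
  obtain ⟨c, hc1, hcz⟩ := ENNReal.lt_iff_exists_nnreal_btwn.1 hz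
  have hc : (1 : ℝ) < c := by exact_mod_cast hc1
  set I := (trapIntegral d δ 0).toReal with hI
  have hI0 : 0 < I := ENNReal.toReal_pos trapIntegral_zero_pos.ne' (trapIntegral_lt_top hδ le_rfl).ne
  rw [density_power_eq hδ] at hne
  have hle : ∑' j : ℕ+, ENNReal.ofReal (((j : ℕ) : ℝ) ^ (γ - d / δ) * I * (c : ℝ) ^ (j : ℕ)) ≠ ∞ := by
    refine ne_top_of_le_ne_top hne (ENNReal.tsum_le_tsum fun j => ?_)
    rw [ENNReal.ofReal_mul (by positivity), ENNReal.ofReal_pow (by positivity),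
      ENNReal.ofReal_coe_nnreal]
    gcongr
  rw [tsum_pnat_eq_tsum_succ (f := fun j : ℕ =>
    ENNReal.ofReal ((j : ℝ) ^ (γ - d / δ) * I * (c : ℝ) ^ j))] at hle
  have hs : Summable fun j : ℕ =>
      ((j + 1 : ℕ) : ℝ) ^ (γ - d / δ) * I * (c : ℝ) ^ (j + 1) := by
    have := ENNReal.summable_toReal hle
    refine this.congr fun j => ?_
    rw [ENNReal.toReal_ofReal (by positivity)]
  have ht := hs.tendsto_atTop_zero
  -- Convergence would send the terms to `0`. Multiplied by the null sequence `j ^ k / c ^ j` they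
  -- equal `I j ^ (γ - d / δ + k) ≥ I > 0`, a contradiction.
  obtain ⟨k, hk⟩ := exists_nat_gt (d / δ - γ)
  have ht2 := (tendsto_pow_const_div_const_pow_of_one_lt k hc).comp (tendsto_add_atTop_nat 1)
  have hmul := ht.mul ht2
  rw [mul_zero] at hmul
  have hge : ∀ j : ℕ, I ≤ ((j + 1 : ℕ) : ℝ) ^ (γ - d / δ) * I * (c : ℝ) ^ (j + 1) *
      (((j + 1 : ℕ) : ℝ) ^ k / (c : ℝ) ^ (j + 1)) := by
    intro j
    have hj : (1 : ℝ) ≤ ((j + 1 : ℕ) : ℝ) := by exact_mod_cast Nat.succ_le_succ (Nat.zero_le j)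
    have hj0 : (0 : ℝ) < ((j + 1 : ℕ) : ℝ) := by linarith
    have e : ((j + 1 : ℕ) : ℝ) ^ (γ - d / δ) * I * (c : ℝ) ^ (j + 1) *
        (((j + 1 : ℕ) : ℝ) ^ k / (c : ℝ) ^ (j + 1)) =
        I * ((j + 1 : ℕ) : ℝ) ^ (γ - d / δ + k) := by
      rw [Real.rpow_add hj0, Real.rpow_natCast]
      have : (c : ℝ) ^ (j + 1) ≠ 0 := by positivity
      field_simp
    rw [e]
    exact le_mul_of_one_le_right hI0.le (Real.one_le_rpow hj (by linarith))
  exact absurd (ge_of_tendsto' hmul hge) (not_le.2 hI0)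

lemma criticalFugacity_power (hδ : 0 < δ) (hκ : 1 + γ < (d : ℝ) / δ) :
    criticalFugacity (powerTrap d δ) (powerWeights γ) = 1 := by
  refine le_antisymm (sSup_le fun z hz => ?_) (le_sSup ?_)
  · by_contra h
    exact (lt_irrefl _) (density_power_of_one_lt (γ := γ) (d := d) hδ (not_le.1 h) ▸ hz :
      (∞ : ℝ≥0∞) < ∞)
  · rw [Set.mem_ofPred_eq, density_power_one hδ hκ]
    exact ENNReal.ofReal_lt_top

lemma criticalDensity_power (hδ : 0 < δ) (hκ : 1 + γ < (d : ℝ) / δ) :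
    criticalDensity (powerTrap d δ) (powerWeights γ) =
      ENNReal.ofReal (∑' j : ℕ, (j : ℝ) ^ (γ - d / δ) * (trapIntegral d δ 0).toReal) := by
  rw [criticalDensity, criticalFugacity_power hδ hκ, density_power_one hδ hκ]

/-! ### The critical mean number of particles away from the origin -/

/-- Uses `(k + 1) P(k + 1) = r P(k)`. -/
lemma lintegral_natCast_poissonMeasure (r : ℝ≥0) :
    ∫⁻ k, (k : ℝ≥0∞) ∂(poissonMeasure r) = r := by
  rw [lintegral_countable']
  have h1 : ∀ k : ℕ, ((k + 1 : ℕ) : ℝ≥0∞) * poissonMeasure r {k + 1} =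
      r * poissonMeasure r {k} := by
    intro k
    rw [poissonMeasure_singleton, poissonMeasure_singleton, ← ENNReal.ofReal_natCast,
      ← ENNReal.ofReal_coe_nnreal, ← ENNReal.ofReal_mul (by positivity),
      ← ENNReal.ofReal_mul (by positivity)]
    congr 1
    rw [Nat.factorial_succ]
    have : (k.factorial : ℝ) ≠ 0 := by positivity
    push_cast
    field_simp
    ring
  have h2 : ∑' k : ℕ, poissonMeasure r {k} = 1 := by
    have := lintegral_countable' (μ := poissonMeasure r) (fun _ : ℕ => (1 : ℝ≥0∞))
    simpa using this.symm
  rw [tsum_eq_zero_add' ENNReal.summable]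
  simp_rw [h1]
  rw [ENNReal.tsum_mul_left, h2]
  simp

/-- Tonelli and the marginal means suffice; independence plays no role. -/
lemma criticalMeanOffOrigin_power (hδ : 0 < δ) (hγ : 0 < γ) (hκ : 1 + γ < (d : ℝ) / δ) {L : ℝ}
    (hL : 0 < L) (hs : Summable (offRate d δ γ (L ^ (-δ)))) :
    criticalMeanOffOrigin (powerTrap d δ) (powerWeights γ) L =
      ENNReal.ofReal (∑' j, offRate d δ γ (L ^ (-δ)) j) := by
  rw [criticalMeanOffOrigin, criticalFugacity_power hδ hκ]
  simp only [particlesOffOrigin]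
  have hmeas : ∀ p : Site d × ℕ+, Measurable fun R : Site d × ℕ+ → ℕ => (R p : ℝ≥0∞) := fun p =>
    (measurable_from_top (f := fun k : ℕ => (k : ℝ≥0∞))).comp (measurable_pi_apply p)
  have hmean : ∀ p : Site d × ℕ+,
      ∫⁻ R, (R p : ℝ≥0∞) ∂(grandCanonicalMeasure (powerTrap d δ) (powerWeights γ) L
        (1 : ℝ≥0∞).toNNReal) = siteRate (powerTrap d δ) (powerWeights γ) L p := by
    intro p
    rw [grandCanonicalMeasure]
    refine ((measurePreserving_eval_infinitePi (fun p : Site d × ℕ+ => poissonMeasure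
      (Real.toNNReal (powerWeights γ p.2 / ((p.2 : ℕ) : ℝ) *
        (((1 : ℝ≥0∞).toNNReal : ℝ≥0) : ℝ) ^ (p.2 : ℕ) *
        Real.exp (-((p.2 : ℕ) : ℝ) * powerTrap d δ (L⁻¹ • p.1.toSpace))))) p).lintegral_comp
      (f := fun k : ℕ => (k : ℝ≥0∞)) measurable_from_top).trans ?_
    rw [lintegral_natCast_poissonMeasure]
    simp [siteRate, ENNReal.ofReal]
  rw [lintegral_tsum fun x => (Measurable.tsum fun j => (hmeas _).const_mul _).aemeasurable]
  have h1 : ∀ x : {x : Site d // x ≠ 0}, ∫⁻ R, ∑' j : ℕ+, ((j : ℕ) : ℝ≥0∞) * (R (x.1, j) : ℝ≥0∞)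
      ∂(grandCanonicalMeasure (powerTrap d δ) (powerWeights γ) L (1 : ℝ≥0∞).toNNReal) =
      ∑' j : ℕ+, ENNReal.ofReal (((j : ℕ) : ℝ) ^ γ *
        Real.exp (-((j : ℕ) : ℝ) * powerTrap d δ (L⁻¹ • x.1.toSpace))) := by
    intro x
    rw [lintegral_tsum fun j => ((hmeas _).const_mul _).aemeasurable]
    refine tsum_congr fun j => ?_
    rw [lintegral_const_mul _ (hmeas _), hmean]
    exact natCast_mul_siteRate (x.1, j)
  simp_rw [h1]
  rw [ENNReal.tsum_comm]
  simp_rw [fun j : ℕ+ => tsum_offSite_rate (γ := γ) (d := d) hδ hL j.pos]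
  rw [tsum_pnat_eq_tsum_succ (f := fun j : ℕ => ENNReal.ofReal (offRate d δ γ (L ^ (-δ)) j)),
    ENNReal.ofReal_tsum_of_nonneg (offRate_nonneg _) hs,
    tsum_eq_zero_add' (f := fun j => ENNReal.ofReal (offRate d δ γ (L ^ (-δ)) j)) ENNReal.summable,
    offRate_zero hγ, ENNReal.ofReal_zero, zero_add]

end SpatialPartitions

namespace SpatialPartitions
open scoped Topology

variable {d : ℕ} {δ γ ρ : ℝ}

/-! ### Moments of the rates -/

lemma natCast_pow_mul_offRate (hγ : 0 < γ) (v : ℝ) (k j : ℕ) :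
    (j : ℝ) ^ k * offRate d δ γ v j = (j : ℝ) ^ (γ + k) * trapSum d δ (j * v) := by
  rcases Nat.eq_zero_or_pos j with rfl | hj
  · have : γ + k ≠ 0 := by positivity
    simp [offRate_zero hγ, Real.zero_rpow this]
  · have hj0 : (0 : ℝ) < j := by exact_mod_cast hj
    rw [offRate, ← mul_assoc, Real.rpow_add hj0, Real.rpow_natCast]
    ring

lemma hasSum_pow_mul_offRate (hγ : 0 < γ) {k : ℕ} (hk : (d : ℝ) < δ * (γ + k + 1)) {v : ℝ}
    (hv : 0 < v) : HasSum (fun j : ℕ => (j : ℝ) ^ k * offRate d δ γ v j)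
      (∑' x : {x : Site d // x ≠ 0}, polyExpSum (γ + k) (v * x.1.len ^ δ)) := by
  simp_rw [natCast_pow_mul_offRate hγ]
  exact hasSum_rpow_mul_trapSum (by positivity) hk hv

lemma tendsto_mul_tsum_pow_mul_offRate (hγ : 0 < γ) {k : ℕ} (hk : (d : ℝ) < δ * (γ + k + 1)) :
    Tendsto (fun v : ℝ => v ^ (γ + k + 1) * ∑' j : ℕ, (j : ℝ) ^ k * offRate d δ γ v j) (𝓝[>] 0)
      (𝓝 (Real.Gamma (γ + k + 1) *
        ∑' x : {x : Site d // x ≠ 0}, x.1.len ^ (-(δ * (γ + k + 1))))) := by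
  refine (tendsto_mul_tsum_polyExpSum (p := γ + k) (by positivity) hk).congr' ?_
  filter_upwards [self_mem_nhdsWithin] with v hv
  rw [(hasSum_pow_mul_offRate hγ hk hv).tsum_eq]

lemma summable_natCast_mul_offRate (hγ : 0 < γ) (hk : (d : ℝ) < δ * (γ + 2)) {v : ℝ}
    (hv : 0 < v) : Summable fun j : ℕ => (j : ℝ) * offRate d δ γ v j := by
  have := (hasSum_pow_mul_offRate (d := d) (δ := δ) hγ (k := 1)
    (by push_cast; rw [add_assoc, one_add_one_eq_two]; exact hk) hv).summable
  simpa using this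

lemma summable_sq_mul_offRate (hδ : 0 < δ) (hγ : 0 < γ) (hk : (d : ℝ) < δ * (γ + 2)) {v : ℝ}
    (hv : 0 < v) : Summable fun j : ℕ => (j : ℝ) ^ 2 * offRate d δ γ v j :=
  (hasSum_pow_mul_offRate (d := d) (δ := δ) hγ (k := 2) (by push_cast; nlinarith) hv).summable

/-! ### The canonical law of the occupation number of the origin -/

/-- The law of the number of particles away from the origin under the critical grand-canonical
measure. -/
noncomputable def offLaw (d : ℕ) (δ γ v : ℝ) (m : ℕ) : ℝ :=
  renewal (offRate d δ γ v) m / ∑' k, renewal (offRate d δ γ v) k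

lemma isCompoundPoisson_offLaw (hγ : 0 < γ) (hk : (d : ℝ) < δ * (γ + 2)) {v : ℝ} (hv : 0 < v) :
    IsCompoundPoisson (offRate d δ γ v) (offLaw d δ γ v) :=
  isCompoundPoisson_renewal (offRate_nonneg v) (offRate_zero hγ v)
    (IsCompoundPoisson.summable_rate (summable_natCast_mul_offRate hγ hk hv))

/-- The tilt vanishes for `m > n`, so the series is the finite convolution of the canonical
ensemble. -/
lemma tsum_mul_tilt {𝕜 : Type*} [RCLike 𝕜] (p : ℕ → ℝ) (l n : ℕ) (f : ℕ → 𝕜) :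
    ∑' m, ((p m * tilt γ l n m : ℝ) : 𝕜) * f m =
      ∑ q ∈ Finset.HasAntidiagonal.antidiagonal n, ((p q.1 * (stretched γ q.2 / stretched γ l) : ℝ) : 𝕜) *
        f q.1 := by
  rw [Finset.Nat.sum_antidiagonal_eq_sum_range_succ_mk, tsum_eq_sum (s := Finset.range (n + 1))]
  · refine Finset.sum_congr rfl fun m hm => ?_
    rw [tilt, if_pos (Nat.lt_succ_iff.1 (Finset.mem_range.1 hm))]
  · intro m hm
    rw [tilt, if_neg fun h => hm (Finset.mem_range.2 (Nat.lt_succ_of_le h))]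
    simp

lemma partitionFunction_power (hδ : 0 < δ) (hγ : 0 < γ) {L : ℝ} (hL : 0 < L) (n : ℕ) :
    partitionFunction (powerTrap d δ) (powerWeights γ) L n =
      ENNReal.ofReal (∑ q ∈ Finset.HasAntidiagonal.antidiagonal n,
        renewal (offRate d δ γ (L ^ (-δ))) q.1 * stretched γ q.2) := by
  have hnn := renewal_nonneg (offRate_nonneg (d := d) (δ := δ) (γ := γ) (L ^ (-δ)))
  rw [partitionFunction_eq _ _ _ powerWeights_nonneg, ENNReal.ofReal_sum_of_nonneg
    fun q _ => mul_nonneg (hnn _) (zero_le_one.trans (one_le_stretched hγ _))]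
  refine Finset.sum_congr rfl fun q _ => ?_
  rw [jointWeight_power hδ hγ hL, ENNReal.ofReal_mul (hnn _)]

lemma sum_renewal_mul_stretched_pos (hγ : 0 < γ) (v : ℝ) (n : ℕ) :
    0 < ∑ q ∈ Finset.HasAntidiagonal.antidiagonal n, renewal (offRate d δ γ v) q.1 * stretched γ q.2 := by
  have hnn := renewal_nonneg (offRate_nonneg (d := d) (δ := δ) (γ := γ) v)
  refine Finset.sum_pos' (fun q _ => mul_nonneg (hnn _)
    (zero_le_one.trans (one_le_stretched hγ _))) ⟨(0, n), by simp, ?_⟩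
  simp only [renewal_zero, one_mul]
  exact zero_lt_one.trans_le (one_le_stretched hγ n)

lemma isProbabilityMeasure_power (hδ : 0 < δ) (hγ : 0 < γ) {L : ℝ} (hL : 0 < L) (n : ℕ) :
    IsProbabilityMeasure (canonicalMeasure (powerTrap d δ) (powerWeights γ) L n) := by
  refine isProbabilityMeasure_canonicalMeasure _ _ _ ?_ ?_ <;>
    rw [partitionFunction_power hδ hγ hL]
  · exact (ENNReal.ofReal_pos.2 (sum_renewal_mul_stretched_pos hγ _ n)).ne'
  · exact ENNReal.ofReal_ne_top

/-- Covers `n = 0`, where the box length degenerates to `0` and the results for `L > 0` do not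
apply; only the empty partition occurs. -/
lemma isProbabilityMeasure_canonicalMeasure_zero (V : EuclideanSpace ℝ (Fin d) → ℝ) {θ : ℕ → ℝ}
    (hθ : ∀ j, 0 ≤ θ j) (L : ℝ) : IsProbabilityMeasure (canonicalMeasure V θ L 0) := by
  have h : partitionFunction V θ L 0 = 1 := by
    rw [partitionFunction_eq _ _ _ hθ]
    simpa using jointWeight_zero_zero (lam := siteRate V θ L) onSize_ne_zero_or
  exact isProbabilityMeasure_canonicalMeasure _ _ _ (by simp [h]) (by simp [h])

/-- Canonical expectations are expectations under the tilted critical law. -/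
lemma integral_canonicalMeasure (hδ : 0 < δ) (hγ : 0 < γ) (hk : (d : ℝ) < δ * (γ + 2)) {L : ℝ}
    (hL : 0 < L) (n l : ℕ) (f : ℕ → ℂ) :
    ∫ lam, f (lam.occ 0) ∂(canonicalMeasure (powerTrap d δ) (powerWeights γ) L n) =
      (∑' m, ((offLaw d δ γ (L ^ (-δ)) m * tilt γ l n m : ℝ) : ℂ) * f (n - m)) /
        ((∑' m, offLaw d δ γ (L ^ (-δ)) m * tilt γ l n m : ℝ) : ℂ) := by
  set v := L ^ (-δ) with hv
  have hv0 : 0 < v := Real.rpow_pos_of_pos hL _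
  have hnn := renewal_nonneg (offRate_nonneg (d := d) (δ := δ) (γ := γ) v)
  set Z := ∑ q ∈ Finset.HasAntidiagonal.antidiagonal n, renewal (offRate d δ γ v) q.1 * stretched γ q.2 with hZ
  have hZ0 : 0 < Z := sum_renewal_mul_stretched_pos hγ v n
  set H := ∑' k, renewal (offRate d δ γ v) k with hH
  have hH0 : 0 < H := (summable_renewal (offRate_nonneg v) (offRate_zero hγ v)
    (IsCompoundPoisson.summable_rate (summable_natCast_mul_offRate hγ hk hv0))).tsum_pos hnn 0
    (by simp [renewal_zero])
  have hwl := zero_lt_one.trans_le (one_le_stretched hγ l)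
  have h1 : ∫ lam, f (lam.occ 0) ∂(canonicalMeasure (powerTrap d δ) (powerWeights γ) L n) =
      ∫ k, f k ∂((canonicalMeasure (powerTrap d δ) (powerWeights γ) L n).map
        fun lam => lam.occ 0) := by
    rw [integral_map measurable_from_top.aemeasurable
      (measurable_from_top (f := f)).aestronglyMeasurable]
  have h2 : ∫ k, f k ∂((canonicalMeasure (powerTrap d δ) (powerWeights γ) L n).map
        fun lam => lam.occ 0) = ∑ q ∈ Finset.HasAntidiagonal.antidiagonal n,
        ((renewal (offRate d δ γ v) q.1 * stretched γ q.2 / Z : ℝ) : ℂ) * f q.2 := by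
    rw [map_canonicalMeasure _ _ _ powerWeights_nonneg, integral_finsetSum_measure]
    · refine Finset.sum_congr rfl fun q _ => ?_
      rw [integral_smul_measure, integral_dirac, partitionFunction_power hδ hγ hL,
        jointWeight_power hδ hγ hL, ENNReal.toReal_mul, ENNReal.toReal_inv, ENNReal.toReal_mul,
        ENNReal.toReal_ofReal hZ0.le, ENNReal.toReal_ofReal (hnn _),
        ENNReal.toReal_ofReal (zero_le_one.trans (one_le_stretched hγ _)), Complex.real_smul]
      congr 2
      rw [inv_mul_eq_div]
    · intro q _
      refine Integrable.smul_measure (integrable_dirac (by simp)) ?_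
      rw [partitionFunction_power hδ hγ hL, jointWeight_power hδ hγ hL]
      exact ENNReal.mul_ne_top (ENNReal.inv_ne_top.2 (ENNReal.ofReal_pos.2 hZ0).ne')
        (ENNReal.mul_ne_top ENNReal.ofReal_ne_top ENNReal.ofReal_ne_top)
  -- The normalizations `H` and `stretched γ l` appear in numerator and denominator alike and
  -- cancel, so `l` is arbitrary here.
  have h3 : ∑' m, offLaw d δ γ v m * tilt γ l n m = Z / (H * stretched γ l) := by
    have := tsum_mul_tilt (𝕜 := ℝ) (γ := γ) (offLaw d δ γ v) l n fun _ => 1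
    simp only [mul_one, RCLike.ofReal_real_eq_id, id] at this
    rw [this, hZ, Finset.sum_div]
    refine Finset.sum_congr rfl fun q _ => ?_
    rw [offLaw, ← hH, div_mul_div_comm]
  have h4 : ∑' m, ((offLaw d δ γ v m * tilt γ l n m : ℝ) : ℂ) * f (n - m) =
      ∑ q ∈ Finset.HasAntidiagonal.antidiagonal n,
        ((offLaw d δ γ v q.1 * (stretched γ q.2 / stretched γ l) : ℝ) : ℂ) * f (n - q.1) :=
    tsum_mul_tilt (𝕜 := ℂ) _ l n fun m => f (n - m)
  rw [h1, h2, h4, h3, Finset.sum_div]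
  refine Finset.sum_congr rfl fun q hq => ?_
  have hq2 : n - q.1 = q.2 := by
    have := Finset.HasAntidiagonal.mem_antidiagonal.1 hq
    omega
  rw [hq2, offLaw, ← hH]
  have e1 : (H : ℂ) ≠ 0 := by exact_mod_cast hH0.ne'
  have e2 : (Z : ℂ) ≠ 0 := by exact_mod_cast hZ0.ne'
  have e3 : (stretched γ l : ℂ) ≠ 0 := by exact_mod_cast hwl.ne'
  push_cast
  field_simp

/-! ### The scaling -/

lemma boxLength_pos (hρ : 0 < ρ) {n : ℕ} (hn : 0 < n) : 0 < boxLength d ρ n :=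
  Real.rpow_pos_of_pos (div_pos (by exact_mod_cast hn) hρ) _

lemma boxLength_pow (hd : 0 < d) (hρ : 0 < ρ) (n : ℕ) : boxLength d ρ n ^ d = n / ρ := by
  rw [boxLength, ← Real.rpow_natCast, ← Real.rpow_mul (by positivity), one_div_mul_cancel
    (by positivity), Real.rpow_one]

lemma tendsto_boxLength (hd : 0 < d) (hρ : 0 < ρ) : Tendsto (boxLength d ρ) atTop atTop :=
  (tendsto_rpow_atTop (by positivity)).comp (tendsto_natCast_atTop_atTop.atTop_div_const hρ)

lemma tendsto_boxLength_rpow_neg (hd : 0 < d) (hρ : 0 < ρ) (hδ : 0 < δ) :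
    Tendsto (fun n => boxLength d ρ n ^ (-δ)) atTop (𝓝[>] 0) := by
  refine tendsto_nhdsWithin_iff.2 ⟨(tendsto_rpow_neg_atTop hδ).comp (tendsto_boxLength hd hρ), ?_⟩
  filter_upwards [eventually_gt_atTop 0] with n hn
  exact Real.rpow_pos_of_pos (boxLength_pos hρ hn) _

end SpatialPartitions

namespace SpatialPartitions
open scoped Topology

variable {d : ℕ} {δ γ ρ : ℝ}

/-! ### The tilted compound Poisson law is asymptotically normal -/

lemma norm_tsum_mul_sub_tsum_le {p q : ℕ → ℝ} (hp : Summable p) (hp0 : ∀ m, 0 ≤ p m)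
    (hs : Summable fun m => p m * |q m - 1|) {f : ℕ → ℂ} (hf : ∀ m, ‖f m‖ = 1) :
    ‖∑' m, ((p m * q m : ℝ) : ℂ) * f m - ∑' m, (p m : ℂ) * f m‖ ≤ ∑' m, p m * |q m - 1| := by
  have h1 : Summable fun m => (p m : ℂ) * f m :=
    (hp.congr fun m => by rw [norm_mul, hf, mul_one, Complex.norm_of_nonneg (hp0 m)]).of_norm
  have hn : ∀ m, ‖((p m * (q m - 1) : ℝ) : ℂ) * f m‖ = p m * |q m - 1| := fun m => by
    rw [norm_mul, hf, mul_one, Complex.norm_real, norm_mul, Real.norm_of_nonneg (hp0 m),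
      Real.norm_eq_abs]
  have h2 : Summable fun m => ((p m * (q m - 1) : ℝ) : ℂ) * f m :=
    (hs.congr fun m => (hn m).symm).of_norm
  have h3 : ∑' m, ((p m * q m : ℝ) : ℂ) * f m - ∑' m, (p m : ℂ) * f m =
      ∑' m, ((p m * (q m - 1) : ℝ) : ℂ) * f m := by
    rw [sub_eq_iff_eq_add, ← h2.tsum_add h1]
    exact tsum_congr fun m => by push_cast; ring
  rw [h3]
  exact tsum_of_norm_bounded hs.hasSum fun m => (hn m).le

section Tilted

variable {a p : ℕ → ℕ → ℝ} {l : ℕ → ℕ}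

/-- Since `l` is at least a constant times `n`, the rate `b = 4 l ^ (-1 / (1 + γ))` tends to `0`,
and `hB` says that `b² B → 0`. In the quantitative bound, `n → ∞` is taken with `ε` fixed. -/
lemma tendsto_tsum_abs_tilt_sub_one (hγ : 0 < γ) (hγ1 : γ ≤ 1)
    (h : ∀ᶠ n in atTop, IsCompoundPoisson (a n) (p n))
    (hs : ∀ᶠ n in atTop, Summable fun j : ℕ => (j : ℝ) * a n j) {c : ℝ} (hc : 0 < c)
    (hA : ∀ᶠ n : ℕ in atTop, c * n ≤ n - ∑' j, a n j)
    (hB : Tendsto (fun n : ℕ => (n : ℝ) ^ (-(2 / (1 + γ))) * ∑' j : ℕ, (j : ℝ) * a n j) atTop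
      (𝓝 0)) (hl : ∀ n : ℕ, l n = ⌊(n : ℝ) - ∑' j, a n j⌋₊) :
    (∀ᶠ n in atTop, Summable fun m => p n m * |tilt γ (l n) n m - 1|) ∧
      Tendsto (fun n => ∑' m, p n m * |tilt γ (l n) n m - 1|) atTop (𝓝 0) := by
  have hlc : ∀ᶠ n : ℕ in atTop, c / 2 * n ≤ l n ∧ 0 < l n ∧ 0 < n ∧
      (l n : ℝ) ≤ n - ∑' j, a n j ∧ n - ∑' j, a n j ≤ l n + 1 := by
    filter_upwards [hA, eventually_gt_atTop 0,
      tendsto_natCast_atTop_atTop.eventually_ge_atTop (2 / c)] with n h1 hn0 hn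
    have h2 : (0 : ℝ) ≤ n - ∑' j, a n j := le_trans (by positivity) h1
    have h3 := Nat.lt_floor_add_one ((n : ℝ) - ∑' j, a n j)
    rw [← hl] at h3
    rw [div_le_iff₀ hc] at hn
    have h4 : c / 2 * n ≤ l n := by nlinarith
    have hn1 : (0 : ℝ) < n := by exact_mod_cast hn0
    refine ⟨h4, ?_, hn0, ?_, h3.le⟩
    · have : (0 : ℝ) < l n := lt_of_lt_of_le (by positivity) h4
      exact_mod_cast this
    · rw [hl]; exact Nat.floor_le h2
  have hlt : Tendsto (fun n => (l n : ℝ)) atTop atTop :=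
    tendsto_atTop_mono' _ (hlc.mono fun n hn => hn.1)
      (tendsto_natCast_atTop_atTop.const_mul_atTop (by positivity))
  have hb : Tendsto (fun n => 4 * (l n : ℝ) ^ (-(1 / (1 + γ)))) atTop (𝓝 0) := by
    simpa using ((tendsto_rpow_neg_atTop (y := 1 / (1 + γ)) (by positivity)).comp hlt).const_mul 4
  have hB2 : Tendsto (fun n => (4 * (l n : ℝ) ^ (-(1 / (1 + γ)))) ^ 2 *
      ∑' j : ℕ, (j : ℝ) * a n j) atTop (𝓝 0) := by
    have hub := hB.const_mul (16 * (c / 2) ^ (-(2 / (1 + γ))))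
    rw [mul_zero] at hub
    have hB0 : ∀ᶠ n in atTop, 0 ≤ ∑' j : ℕ, (j : ℝ) * a n j := h.mono fun n hn =>
      tsum_nonneg fun j => mul_nonneg (Nat.cast_nonneg _) (hn.rate_nonneg j)
    refine squeeze_zero' (hB0.mono fun n hn => by positivity) ?_ hub
    filter_upwards [hB0, hlc] with n h0 ⟨h1, h2, h3, _⟩
    have hl0 : (0 : ℝ) < l n := by exact_mod_cast h2
    have hn0 : (0 : ℝ) < n := by exact_mod_cast h3
    have e1 : (4 * (l n : ℝ) ^ (-(1 / (1 + γ)))) ^ 2 = 16 * (l n : ℝ) ^ (-(2 / (1 + γ))) := by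
      rw [mul_pow, ← Real.rpow_natCast, ← Real.rpow_natCast, ← Real.rpow_mul hl0.le]
      norm_num
      ring_nf
    have e2 : (l n : ℝ) ^ (-(2 / (1 + γ))) ≤ (c / 2 * n) ^ (-(2 / (1 + γ))) :=
      Real.rpow_le_rpow_of_nonpos (by positivity) h1 (neg_nonpos.2 (by positivity))
    rw [Real.mul_rpow (by positivity) hn0.le] at e2
    rw [e1]
    exact (mul_le_mul_of_nonneg_right (mul_le_mul_of_nonneg_left e2 (by norm_num : (0 : ℝ) ≤ 16))
      h0).trans_eq (by ring)
  have hsum : ∀ ε : ℝ, 0 < ε → ∀ᶠ n in atTop,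
      (Summable fun m => p n m * |tilt γ (l n) n m - 1|) ∧
      ∑' m, p n m * |tilt γ (l n) n m - 1| ≤ 4 * ε := by
    intro ε hε
    -- This quantity is eventually at most `ε²`, so after division by `ε` the bound is `3 ε + ε`.
    have hF : Tendsto (fun n => Real.exp (2 * (4 * (l n : ℝ) ^ (-(1 / (1 + γ)))) +
        2 * ((4 * (l n : ℝ) ^ (-(1 / (1 + γ)))) ^ 2 * ∑' j : ℕ, (j : ℝ) * a n j)) - 1 +
        2 * ((4 * (l n : ℝ) ^ (-(1 / (1 + γ)))) ^ 2 * ∑' j : ℕ, (j : ℝ) * a n j))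
        atTop (𝓝 0) := by
      have h1 := (((hb.const_mul 2).add (hB2.const_mul 2)).rexp.sub_const 1).add (hB2.const_mul 2)
      simpa using h1
    filter_upwards [h, hs, hlc, hb.eventually_le_const (u := 1 / 2) (by norm_num),
      hF.eventually_le_const (u := ε * ε) (by positivity)] with n h1 h2 ⟨_, h3, _, h4, h5⟩ h6 h7
    obtain ⟨g1, g2⟩ := tsum_abs_tilt_sub_one_le hγ hγ1 h1 h2 h3 rfl (by linarith) h4 h5 hε
    refine ⟨g1, g2.trans ?_⟩
    have := (div_le_iff₀ hε).2 h7
    linarith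
  refine ⟨(hsum 1 one_pos).mono fun n hn => hn.1, Metric.tendsto_nhds.2 fun ε hε => ?_⟩
  filter_upwards [hsum (ε / 8) (by positivity), h] with n hn h1
  rw [Real.dist_eq, sub_zero, abs_of_nonneg
    (tsum_nonneg fun m => mul_nonneg (h1.nonneg m) (abs_nonneg _))]
  linarith [hn.2]

/-- Replacing the tilt `q` by `1` costs its `L¹` distance, in the numerator and in the
normalization; `norm_charFun_sub_le` treats what remains. Condition `hD` is of Lyapunov type. -/
lemma tendsto_charFun_tilted {q : ℕ → ℕ → ℝ} {r : ℕ → ℝ} {s : ℝ}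
    (h : ∀ᶠ n in atTop, IsCompoundPoisson (a n) (p n))
    (hs2 : ∀ᶠ n in atTop, Summable fun j : ℕ => (j : ℝ) * a n j)
    (hs3 : ∀ᶠ n in atTop, Summable fun j : ℕ => (j : ℝ) ^ 2 * a n j)
    (hq : ∀ᶠ n in atTop, Summable fun m => p n m * |q n m - 1|)
    (hq0 : Tendsto (fun n => ∑' m, p n m * |q n m - 1|) atTop (𝓝 0))
    (hB : Tendsto (fun n => r n ^ 2 * ∑' j : ℕ, (j : ℝ) * a n j) atTop (𝓝 s))
    (hD : Tendsto (fun n => |r n| ^ 3 * ∑' j : ℕ, (j : ℝ) ^ 2 * a n j) atTop (𝓝 0)) (t : ℝ) :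
    Tendsto (fun n => (∑' m : ℕ, ((p n m * q n m : ℝ) : ℂ) *
        Complex.exp (Complex.I * (t * r n * (m - ∑' j, a n j) : ℝ))) /
      ((∑' m, p n m * q n m : ℝ) : ℂ)) atTop (𝓝 (Complex.exp (-(t ^ 2 / 2 * s : ℝ)))) := by
  have hden : Tendsto (fun n => ((∑' m, p n m * q n m : ℝ) : ℂ)) atTop (𝓝 1) := by
    refine tendsto_iff_norm_sub_tendsto_zero.2 (squeeze_zero' (.of_forall fun _ => norm_nonneg _)
      ?_ hq0)
    filter_upwards [h, hq] with n h1 h2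
    have h3 := norm_tsum_mul_sub_tsum_le h1.hasSum.summable h1.nonneg h2 (f := fun _ => 1)
      (fun _ => norm_one)
    have h4 : ∑' m, (p n m : ℂ) = 1 := by
      rw [← Complex.ofReal_tsum, h1.hasSum.tsum_eq, Complex.ofReal_one]
    simp only [mul_one] at h3
    rwa [h4, ← Complex.ofReal_tsum] at h3
  have hexp : Tendsto (fun n => Complex.exp (-((t * r n) ^ 2 / 2 *
      ∑' j : ℕ, (j : ℝ) * a n j : ℝ))) atTop (𝓝 (Complex.exp (-(t ^ 2 / 2 * s : ℝ)))) := by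
    refine (Complex.continuous_exp.tendsto _).comp (Tendsto.neg ?_)
    refine (Complex.continuous_ofReal.tendsto _).comp ((hB.const_mul (t ^ 2 / 2)).congr fun n => ?_)
    ring
  have hnum : Tendsto (fun n => ∑' m : ℕ, ((p n m * q n m : ℝ) : ℂ) *
        Complex.exp (Complex.I * (t * r n * (m - ∑' j, a n j) : ℝ))) atTop
      (𝓝 (Complex.exp (-(t ^ 2 / 2 * s : ℝ)))) := by
    have hz := hq0.add (hD.const_mul (2 * |t| ^ 3))
    rw [mul_zero, add_zero] at hz
    refine Filter.Tendsto.congr_dist hexp (squeeze_zero' (.of_forall fun _ => dist_nonneg) ?_ hz)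
    filter_upwards [h, hs2, hs3, hq] with n h1 h2 h3 h4
    have e1 := norm_tsum_mul_sub_tsum_le h1.hasSum.summable h1.nonneg h4
      (f := fun m => Complex.exp (Complex.I * (t * r n * (m - ∑' j, a n j) : ℝ)))
      (fun m => IsCompoundPoisson.norm_exp_I_mul_ofReal _)
    have e2 := h1.norm_charFun_sub_le h2 h3 (t * r n)
    rw [abs_mul] at e2
    rw [dist_comm, dist_eq_norm, ← sub_add_sub_cancel]
    have e3 : 2 * (|t| * |r n|) ^ 3 * ∑' j : ℕ, (j : ℝ) ^ 2 * a n j =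
        2 * |t| ^ 3 * (|r n| ^ 3 * ∑' j : ℕ, (j : ℝ) ^ 2 * a n j) := by ring
    exact (norm_add_le _ _).trans (add_le_add e1 (e2.trans_eq e3))
  have := hnum.div hden one_ne_zero
  rw [div_one] at this
  exact this

end Tilted

/-! ### Fluctuations of the occupation number of the origin -/

lemma boxLength_rpow_neg_rpow (hd : 0 < d) (hδ : 0 < δ) (hρ : 0 < ρ) {n : ℕ} (hn : 0 < n)
    (q : ℝ) : (boxLength d ρ n ^ (-δ)) ^ q = (n / ρ) ^ (-(δ * q / d)) := by
  have hL := boxLength_pos (d := d) hρ hn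
  rw [← boxLength_pow hd hρ, ← Real.rpow_natCast, ← Real.rpow_mul hL.le, ← Real.rpow_mul hL.le]
  congr 1
  field_simp

lemma tendsto_tsum_abs_tilt_offLaw (hd : 0 < d) (hδ : 0 < δ) (hγ : 0 < γ)
    (hlow : (1 + γ) * (1 + γ / 2) < (d : ℝ) / δ) (hupp : (d : ℝ) / δ < γ + 2) (hρ0 : 0 < ρ)
    (hρ : ∑' j : ℕ, (j : ℝ) ^ (γ - d / δ) * (trapIntegral d δ 0).toReal < ρ) {l : ℕ → ℕ}
    (hl : ∀ n, l n = ⌊(n : ℝ) - ∑' j, offRate d δ γ (boxLength d ρ n ^ (-δ)) j⌋₊) :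
    (∀ᶠ n in atTop, Summable fun m =>
        offLaw d δ γ (boxLength d ρ n ^ (-δ)) m * |tilt γ (l n) n m - 1|) ∧
      Tendsto (fun n => ∑' m,
        offLaw d δ γ (boxLength d ρ n ^ (-δ)) m * |tilt γ (l n) n m - 1|) atTop (𝓝 0) := by
  have hk : (d : ℝ) < δ * (γ + 2) := by rwa [div_lt_iff₀' hδ] at hupp
  -- The two bounds on `d / δ` together give `(1 + γ)(1 + γ / 2) < 2 (1 + γ / 2)`.
  have hγ1 : γ ≤ 1 := by nlinarith
  have hκ : 1 + γ < (d : ℝ) / δ := by nlinarith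
  have hv := tendsto_boxLength_rpow_neg hd hρ0 hδ
  have hv0 : ∀ᶠ n in atTop, 0 < boxLength d ρ n ^ (-δ) := (tendsto_nhdsWithin_iff.1 hv).2
  -- Some room above the critical density: eventually `A < (ρ' / ρ) n`, leaving the fraction `1 - ρ'
  -- / ρ` for the origin.
  obtain ⟨ρ', h1, h2⟩ := exists_between hρ
  refine tendsto_tsum_abs_tilt_sub_one (a := fun n => offRate d δ γ (boxLength d ρ n ^ (-δ)))
    (c := 1 - ρ' / ρ) hγ hγ1 (hv0.mono fun n hn => isCompoundPoisson_offLaw hγ hk hn)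
    (hv0.mono fun n hn => summable_natCast_mul_offRate hγ hk hn)
    (sub_pos.2 ((div_lt_one hρ0).2 h2)) ?_ ?_ hl
  · filter_upwards [hv.eventually (eventually_mul_tsum_trapSum_lt hδ hγ hκ h1),
      eventually_gt_atTop 0] with n h3 hn
    have hd0 : (d : ℝ) ≠ 0 := by positivity
    have hn0 : (0 : ℝ) < n := by exact_mod_cast hn
    rw [boxLength_rpow_neg_rpow hd hδ hρ0 hn, show -(δ * (d / δ) / d) = (-1 : ℝ) by field_simp,
      Real.rpow_neg_one, inv_mul_lt_iff₀ (by positivity)] at h3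
    have h4 : (n : ℝ) / ρ * ρ' = ρ' / ρ * n := by ring
    rw [h4] at h3
    simp only [offRate]
    linarith
  · have hlim := (tendsto_mul_tsum_pow_mul_offRate (d := d) (δ := δ) hγ (k := 1)
      (by push_cast; rw [add_assoc, one_add_one_eq_two]; exact hk)).comp hv
    -- This is `hlow` rearranged. As `v ^ (d / δ) = ρ / n` and `B` has order `v ^ (-(γ + 2))`, it
    -- makes `n ^ (-2 / (1 + γ)) B` vanish.
    have hpos : 0 < d / δ * (2 / (1 + γ)) - (γ + 2) := by
      rw [sub_pos, mul_div_assoc', lt_div_iff₀ (by positivity)]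
      nlinarith
    have hz : Tendsto (fun n : ℕ => ρ ^ (-(2 / (1 + γ))) *
        (boxLength d ρ n ^ (-δ)) ^ (d / δ * (2 / (1 + γ)) - (γ + 2))) atTop (𝓝 0) := by
      have := ((Real.continuousAt_rpow_const 0 _ (Or.inr hpos.le)).tendsto.comp
        (tendsto_nhdsWithin_iff.1 hv).1).const_mul (ρ ^ (-(2 / (1 + γ))))
      rwa [Real.zero_rpow hpos.ne', mul_zero] at this
    have := hz.mul hlim
    rw [zero_mul] at this
    refine this.congr' ?_
    filter_upwards [hv0, eventually_gt_atTop 0] with n h3 hn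
    have hn0 : (0 : ℝ) < n := by exact_mod_cast hn
    have hd0 : (d : ℝ) ≠ 0 := by positivity
    have e1 : (boxLength d ρ n ^ (-δ)) ^ (d / δ * (2 / (1 + γ)) - (γ + 2)) *
        (boxLength d ρ n ^ (-δ)) ^ (γ + (1 : ℕ) + 1) = (n / ρ) ^ (-(2 / (1 + γ))) := by
      rw [← Real.rpow_add h3, boxLength_rpow_neg_rpow hd hδ hρ0 hn]
      congr 1
      push_cast
      field_simp
      ring
    have e2 : (n : ℝ) ^ (-(2 / (1 + γ))) = ρ ^ (-(2 / (1 + γ))) * (n / ρ) ^ (-(2 / (1 + γ))) := by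
      rw [← Real.mul_rpow hρ0.le (by positivity), mul_div_cancel₀ _ hρ0.ne']
    rw [e2, ← e1]
    simp only [Function.comp, pow_one]
    ring

lemma integral_exp_canonicalMeasure (hδ : 0 < δ) (hγ : 0 < γ) (hk : (d : ℝ) < δ * (γ + 2)) {L : ℝ}
    (hL : 0 < L) (n l : ℕ) (u A : ℝ) :
    ∫ lam : SpatialPartition d n, Complex.exp (Complex.I * (u * (lam.occ 0 - (n - A)) : ℝ))
        ∂(canonicalMeasure (powerTrap d δ) (powerWeights γ) L n) =
      (∑' m : ℕ, ((offLaw d δ γ (L ^ (-δ)) m * tilt γ l n m : ℝ) : ℂ) *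
          Complex.exp (Complex.I * (-u * (m - A) : ℝ))) /
        ((∑' m, offLaw d δ γ (L ^ (-δ)) m * tilt γ l n m : ℝ) : ℂ) := by
  rw [integral_canonicalMeasure hδ hγ hk hL n l
    (fun k => Complex.exp (Complex.I * (u * (k - (n - A)) : ℝ)))]
  congr 1
  refine tsum_congr fun m => ?_
  by_cases hm : m ≤ n
  · rw [Nat.cast_sub hm]
    congr 4
    ring
  -- For `m > n` the zero tilt makes the truncated `n - m` irrelevant.
  · simp [tilt, hm]

/-- The characteristic functions of the rescaled occupation number of the origin converge. -/
lemma tendsto_integral_exp_canonicalMeasure (hd : 0 < d) (hδ : 0 < δ) (hγ : 0 < γ)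
    (hlow : (1 + γ) * (1 + γ / 2) < (d : ℝ) / δ) (hupp : (d : ℝ) / δ < γ + 2) (hρ0 : 0 < ρ)
    (hρ : ∑' j : ℕ, (j : ℝ) ^ (γ - d / δ) * (trapIntegral d δ 0).toReal < ρ) (t : ℝ) :
    Tendsto (fun n : ℕ => ∫ lam : SpatialPartition d n,
        Complex.exp (Complex.I * (t * (boxLength d ρ n ^ (-δ)) ^ (1 + γ / 2) * (lam.occ 0 -
          (n - ∑' j, offRate d δ γ (boxLength d ρ n ^ (-δ)) j)) : ℝ))
        ∂(canonicalMeasure (powerTrap d δ) (powerWeights γ) (boxLength d ρ n) n)) atTop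
      (𝓝 (Complex.exp (-(t ^ 2 / 2 * (Real.Gamma (γ + 2) *
        ∑' x : {x : Site d // x ≠ 0}, x.1.len ^ (-(δ * (γ + 2)))) : ℝ)))) := by
  have hk : (d : ℝ) < δ * (γ + 2) := by rwa [div_lt_iff₀' hδ] at hupp
  have hv := tendsto_boxLength_rpow_neg hd hρ0 hδ
  have hv0 : ∀ᶠ n in atTop, 0 < boxLength d ρ n ^ (-δ) := (tendsto_nhdsWithin_iff.1 hv).2
  obtain ⟨h1, h2⟩ := tendsto_tsum_abs_tilt_offLaw hd hδ hγ hlow hupp hρ0 hρ fun _ => rfl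
  have hB := (tendsto_mul_tsum_pow_mul_offRate (d := d) (δ := δ) hγ (k := 1)
    (by push_cast; rw [add_assoc, one_add_one_eq_two]; exact hk)).comp hv
  have hD := (tendsto_mul_tsum_pow_mul_offRate (d := d) (δ := δ) hγ (k := 2)
    (by push_cast; nlinarith)).comp hv
  -- The factor left in `|r|³ D`, since `3 (1 + γ / 2) = γ / 2 + (γ + 3)`.
  have hz : Tendsto (fun n : ℕ => (boxLength d ρ n ^ (-δ)) ^ (γ / 2)) atTop (𝓝 0) := by
    have := (Real.continuousAt_rpow_const 0 (γ / 2) (Or.inr (by positivity))).tendsto.comp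
      (tendsto_nhdsWithin_iff.1 hv).1
    rwa [Real.zero_rpow (by positivity)] at this
  have hD' := hz.mul hD
  rw [zero_mul] at hD'
  rw [Nat.cast_one, add_assoc, one_add_one_eq_two] at hB
  refine (tendsto_charFun_tilted
    (a := fun n => offRate d δ γ (boxLength d ρ n ^ (-δ)))
    -- The sign reflects `H_0 - (n - A) = -(M - A)`.
    (r := fun n => -(boxLength d ρ n ^ (-δ)) ^ (1 + γ / 2))
    (hv0.mono fun n hn => isCompoundPoisson_offLaw hγ hk hn)
    (hv0.mono fun n hn => summable_natCast_mul_offRate hγ hk hn)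
    (hv0.mono fun n hn => summable_sq_mul_offRate hδ hγ hk hn) h1 h2
    (hB.congr' ?_) (hD'.congr' ?_) t).congr' ?_
  · filter_upwards [hv0] with n hn
    have e : (-(boxLength d ρ n ^ (-δ)) ^ (1 + γ / 2)) ^ 2 =
        (boxLength d ρ n ^ (-δ)) ^ (γ + 2) := by
      rw [neg_sq, ← Real.rpow_mul_natCast hn.le]
      congr 1
      push_cast
      ring
    rw [e]
    simp only [Function.comp, pow_one]
  · filter_upwards [hv0] with n hn
    have e : |-(boxLength d ρ n ^ (-δ)) ^ (1 + γ / 2)| ^ 3 =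
        (boxLength d ρ n ^ (-δ)) ^ (γ / 2) * (boxLength d ρ n ^ (-δ)) ^ (γ + (2 : ℕ) + 1) := by
      rw [abs_neg, abs_of_pos (Real.rpow_pos_of_pos hn _), ← Real.rpow_mul_natCast hn.le,
        ← Real.rpow_add hn]
      congr 1
      push_cast
      ring
    rw [e]
    simp only [Function.comp]
    ring
  · filter_upwards [eventually_gt_atTop 0] with n hn
    rw [integral_exp_canonicalMeasure hδ hγ hk (boxLength_pos hρ0 hn) n, ← mul_neg]

end SpatialPartitions

/-! ### The limit theorem. -/

open SpatialPartitions in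
theorem theorem5p4 (d : ℕ) (δ γ ρ : ℝ) (hδ : 0 < δ) (hγ : 0 < γ)
    (hlow : (1 + γ) * (1 + γ / 2) < (d : ℝ) / δ) (hupp : (d : ℝ) / δ < γ + 2)
    (hρ : criticalDensity (powerTrap d δ) (powerWeights γ) < ENNReal.ofReal ρ) :
    -- the variance of the limit and the centering are finite
    (Summable fun x : {x : Site d // x ≠ 0} => ‖x.1.toSpace‖ ^ (-(δ * (γ + 2)))) ∧
    (∀ L : ℝ, 0 < L → criticalMeanOffOrigin (powerTrap d δ) (powerWeights γ) L ≠ ∞) ∧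
    -- the canonical measures are well-defined probability measures
    ∃ _ : ∀ n : ℕ, IsProbabilityMeasure
        (canonicalMeasure (powerTrap d δ) (powerWeights γ) (boxLength d ρ n) n),
      TendstoInDistribution
        (fun (n : ℕ) (lam : SpatialPartition d n) =>
          (originOccupation lam -
              (ρ - finiteCriticalDensity (powerTrap d δ) (powerWeights γ) (boxLength d ρ n)) *
                boxLength d ρ n ^ d) /
            boxLength d ρ n ^ (δ * (1 + γ / 2)))
        atTop
        (fun y : ℝ =>
          Real.sqrt (Real.Gamma (γ + 2) *
            ∑' x : {x : Site d // x ≠ 0}, ‖x.1.toSpace‖ ^ (-(δ * (γ + 2)))) * y)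
        (fun n : ℕ => canonicalMeasure (powerTrap d δ) (powerWeights γ) (boxLength d ρ n) n)
        (gaussianReal 0 1) := by
  have hk : (d : ℝ) < δ * (γ + 2) := by rwa [div_lt_iff₀' hδ] at hupp
  have hκ : 1 + γ < (d : ℝ) / δ := by nlinarith
  have hd : 0 < d := by
    rcases Nat.eq_zero_or_pos d with rfl | hd
    · simp at hκ; linarith
    · exact hd
  have hρ0 : 0 < ρ := ENNReal.ofReal_pos.1 (bot_le.trans_lt hρ)
  rw [criticalDensity_power hδ hκ, ENNReal.ofReal_lt_ofReal_iff hρ0] at hρ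
  have hmean : ∀ L : ℝ, 0 < L → criticalMeanOffOrigin (powerTrap d δ) (powerWeights γ) L =
      ENNReal.ofReal (∑' j, offRate d δ γ (L ^ (-δ)) j) := fun L hL =>
    criticalMeanOffOrigin_power hδ hγ hκ hL (IsCompoundPoisson.summable_rate
      (summable_natCast_mul_offRate hγ hk (Real.rpow_pos_of_pos hL _)))
  have hprob : ∀ n : ℕ, IsProbabilityMeasure
      (canonicalMeasure (powerTrap d δ) (powerWeights γ) (boxLength d ρ n) n) := fun n => by
    rcases Nat.eq_zero_or_pos n with rfl | hn
    · exact isProbabilityMeasure_canonicalMeasure_zero _ powerWeights_nonneg _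
    · exact isProbabilityMeasure_power hδ hγ (boxLength_pos hρ0 hn) n
  refine ⟨summable_len_rpow hk, fun L hL => ?_, hprob, ⟨fun n => measurable_from_top.aemeasurable,
    by fun_prop, ?_⟩⟩
  · rw [hmean L hL]
    exact ENNReal.ofReal_ne_top
  -- Lévy's continuity theorem reduces the claim to characteristic functions.
  · refine ProbabilityMeasure.tendsto_iff_tendsto_charFun.2 fun t => ?_
    simp only [ProbabilityMeasure.coe_mk]
    have hσ : 0 ≤ Real.Gamma (γ + 2) *
        ∑' x : {x : Site d // x ≠ 0}, ‖x.1.toSpace‖ ^ (-(δ * (γ + 2))) :=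
      mul_nonneg (Real.Gamma_pos_of_pos (by linarith)).le (tsum_nonneg fun x => by positivity)
    have hlim := tendsto_integral_exp_canonicalMeasure hd hδ hγ hlow hupp hρ0 hρ t
    rw [charFun_map_mul, charFun_gaussianReal]
    refine (hlim.congr' ?_).trans_eq ?_
    · filter_upwards [eventually_gt_atTop 0] with n hn
      have hL := boxLength_pos (d := d) hρ0 hn
      rw [charFun_apply_real, integral_map measurable_from_top.aemeasurable
        (by fun_prop)]
      refine integral_congr_ae (.of_forall fun lam => ?_)
      have e1 : boxLength d ρ n ^ (δ * (1 + γ / 2)) =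
          ((boxLength d ρ n ^ (-δ)) ^ (1 + γ / 2))⁻¹ := by
        rw [← Real.rpow_mul hL.le, ← Real.rpow_neg hL.le]
        congr 1
        ring
      -- The centring is exactly `n - A`, because `ρ L ^ d = n` and `ρ_c^L L ^ d` is the critical
      -- mean `A`.
      have e2 : (ρ - finiteCriticalDensity (powerTrap d δ) (powerWeights γ) (boxLength d ρ n)) *
          boxLength d ρ n ^ d = n - ∑' j, offRate d δ γ (boxLength d ρ n ^ (-δ)) j := by
        rw [finiteCriticalDensity, hmean _ hL, ENNReal.toReal_ofReal
          (tsum_nonneg (offRate_nonneg _)), sub_mul, div_mul_cancel₀ _ (by positivity),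
          boxLength_pow hd hρ0, mul_div_cancel₀ _ hρ0.ne']
      simp only [e1, e2, originOccupation, div_inv_eq_mul]
      congr 1
      push_cast
      ring
    · congr 2
      simp only [Complex.ofReal_zero, mul_zero, zero_mul, zero_sub, NNReal.coe_one,
        Complex.ofReal_one, one_mul]
      rw [← Complex.ofReal_pow, mul_pow, Real.sq_sqrt hσ]
      push_cast
      ring_nf
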